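/- All graphs are finite, simple and connected; $W_p(G)$ denotes the Wiener polarity index of $G$, the number of unordered pairs of vertices of $G$ at distance three. A benzenoid graph is a 2-connected plane graph in which the boundary of every inner face is a 6-cycle and every 6-cycle is the boundary of some inner face, such that two distinct 6-cycles are either disjoint or have exactly one common edge, and no three 6-cycles share a common edge; its inner faces are called hexagons. It is catacondensed if no vertex lies in three hexagons. A phenylene is a graph obtained from a catacondensed benzenoid graph with at least two hexagons by inserting a quadrilateral (a face bounded by a 4-cycle) between every two adjacent hexagons (two faces are adjacent if they have a common edge); its hexagons are its inner faces bounded by 6-cycles. A hexagon of a catacondensed benzenoid graph or of a phenylene is terminal if it is adjacent to exactly one other inner face, branched if it is adjacent to exactly three other inner faces, and angular if it is adjacent to exactly two other inner faces and its two vertices of degree two are adjacent. Extension 1 attaches exactly two new hexagons to an arbitrary terminal hexagon $h_0$ so that $h_0$ becomes branched; Extension 2 attaches exactly one new hexagon to an arbitrary terminal hexagon $h_0$ so that $h_0$ becomes angular. New hexagons are attached only along edges of $h_0$ with both ends of degree two, and two new hexagons along edges without a common vertex; in the case of phenylenes, a quadrilateral is inserted between $h_0$ and each new hexagon. For $h\ge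 2$ let $\mathcal B_h$ (respectively $\mathcal P_h$) be the set of all graphs that can be obtained from the catacondensed benzenoid graph (respectively the phenylene) with exactly two hexagons as follows: if $h$ is even, by performing Extension 1 exactly $\frac h2-1$ times; if $h$ is odd, by performing Extension 1 exactly $\frac{h-1}2-1$ times and Extension 2 exactly once, in an arbitrary order. Graphs are considered up to isomorphism. **Theorem.** Let $h\ge 2$. If $G$ is a catacondensed benzenoid graph (respectively a phenylene) with exactly $h$ hexagons and $G'$ is an arbitrary graph from $\mathcal B_h$ (respectively $\mathcal P_h$), then $W_p(G)\le W_p(G')$, and equality holds if and only if $G\in\mathcal B_h$ (respectively $G\in\mathcal P_h$). -/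

import Mathlib

universe u v

namespace Benzenoid

/-! ### Basic graph notions -/

/-- The Wiener polarity index: the number of unordered pairs of vertices at distance three. -/
noncomputable def wienerPolarity {V : Type u} (G : SimpleGraph V) : ℕ :=
  {s : Sym2 V | ∃ a b : V, s = s(a, b) ∧ G.dist a b = 3}.ncard

/-- The degree of a vertex. -/
noncomputable def deg {V : Type u} (G : SimpleGraph V) (x : V) : ℕ :=
  (G.neighborSet x).ncard

/-- `C` is a `k`-cycle of `G`, viewed as a subgraph. -/
def IsCycleOfLength {V : Type u} (G : SimpleGraph V) (k : ℕ) (C : G.Subgraph) : Prop :=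
  ∃ (x : V) (w : G.Walk x x), w.IsCycle ∧ w.length = k ∧ w.toSubgraph = C

/-- `G` is finite and 2-connected: it has at least three (and finitely many) vertices, is
connected, and has no cut vertex. (`Nat.card` is `0` on infinite types.) -/
structure IsTwoConnected {V : Type u} (G : SimpleGraph V) : Prop where
  three_le_card : 3 ≤ Nat.card V
  connected : G.Connected
  no_cut_vertex : ∀ x : V, (G.induce {y | y ≠ x}).Connected

/-! ### Plane graphs -/

/-- The involution on darts (oriented edges) which reverses the orientation. -/
def dartRev {V : Type u} (G : SimpleGraph V) : Equiv.Perm G.Dart :=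
  Function.Involutive.toPerm SimpleGraph.Dart.symm SimpleGraph.Dart.symm_involutive

/-- The faces of a rotation `rot` on the darts of `G` are the orbits of the permutation that sends
the dart `a → b` to the successor, in the rotation at `b`, of the reversed dart `b → a`. -/
def RotFace {V : Type u} (G : SimpleGraph V) (rot : Equiv.Perm G.Dart) : Type u :=
  Quotient (Equiv.Perm.SameCycle.setoid (rot * dartRev G))

/-- A plane graph with underlying graph `G`, given combinatorially: a connected graph with a
rotation system (a cyclic ordering of the darts leaving each vertex) of genus zero, that is with
`|V| - |E| + |F| = 2`, together with the choice of one face as the outer face. -/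
structure PlaneMap {V : Type u} (G : SimpleGraph V) where
  /-- the next dart in the cyclic order around the starting vertex -/
  rot : Equiv.Perm G.Dart
  rot_sameCycle : ∀ d e : G.Dart, rot.SameCycle d e ↔ d.fst = e.fst
  connected : G.Connected
  euler : Nat.card V + Nat.card (RotFace G rot) = Nat.card G.edgeSet + 2
  /-- the outer face -/
  outer : RotFace G rot

/-- The darts traversed by the boundary walk of a face. -/
def PlaneMap.faceDarts {V : Type u} {G : SimpleGraph V} (M : PlaneMap G) (f : RotFace G M.rot) :
    Set G.Dart :=
  {d | Quotient.mk (Equiv.Perm.SameCycle.setoid (M.rot * dartRev G)) d = f}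

/-! ### Benzenoid graphs -/

/-- `G`, drawn in the plane as `M`, is a benzenoid graph. -/
structure IsBenzenoid {V : Type u} (G : SimpleGraph V) (M : PlaneMap G) : Prop where
  twoConnected : IsTwoConnected G
  /-- The boundary walk of every inner face is a cycle with six edges. -/
  inner_hexagonal : ∀ f : RotFace G M.rot, f ≠ M.outer →
    (M.faceDarts f).ncard = 6 ∧ Set.InjOn (fun d : G.Dart => d.fst) (M.faceDarts f)
  /-- Every 6-cycle is the boundary of some inner face. -/
  hexagon_inner : ∀ C : G.Subgraph, IsCycleOfLength G 6 C →
    ∃ f : RotFace G M.rot, f ≠ M.outer ∧ C.edgeSet = SimpleGraph.Dart.edge '' M.faceDarts f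
  /-- Two 6-cycles are disjoint or have exactly one common edge. -/
  disjoint_or_one_edge : ∀ C D : G.Subgraph, IsCycleOfLength G 6 C → IsCycleOfLength G 6 D →
    C ≠ D → Disjoint C.verts D.verts ∨ ∃! e : Sym2 V, e ∈ C.edgeSet ∧ e ∈ D.edgeSet
  /-- No three 6-cycles share a common edge. -/
  no_three_edge : ∀ C D E : G.Subgraph, IsCycleOfLength G 6 C → IsCycleOfLength G 6 D →
    IsCycleOfLength G 6 E → C ≠ D → C ≠ E → D ≠ E →
    ¬ ∃ e : Sym2 V, e ∈ C.edgeSet ∧ e ∈ D.edgeSet ∧ e ∈ E.edgeSet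

/-- An internal vertex: a vertex shared by three hexagons. -/
def IsInternalVertex {V : Type u} (G : SimpleGraph V) (x : V) : Prop :=
  ∃ C D E : G.Subgraph, IsCycleOfLength G 6 C ∧ IsCycleOfLength G 6 D ∧ IsCycleOfLength G 6 E ∧
    C ≠ D ∧ C ≠ E ∧ D ≠ E ∧ x ∈ C.verts ∧ x ∈ D.verts ∧ x ∈ E.verts

/-- Catacondensed benzenoid graphs: benzenoid graphs without internal vertices. -/
def IsCatacondensed {V : Type u} (G : SimpleGraph V) : Prop :=
  (∃ M : PlaneMap G, IsBenzenoid G M) ∧ ∀ x : V, ¬ IsInternalVertex G x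

/-- The number of hexagons. In a benzenoid graph the hexagons (inner faces) are by definition the
6-cycles; in a phenylene the inner faces bounded by a 6-cycle are also exactly the 6-cycles. -/
noncomputable def numHexagons {V : Type u} (G : SimpleGraph V) : ℕ :=
  {C : G.Subgraph | IsCycleOfLength G 6 C}.ncard

/-! ### Phenylenes -/

/-- The graph obtained from `G` by inserting a quadrilateral between any two adjacent hexagons.
Every vertex `x` is replaced by one copy `(x, C)` for each hexagon `C` containing it; each hexagon
keeps its edges, and the copies of a vertex in two hexagons are joined. So the common
edge `x y` of two adjacent hexagons `C`, `D` becomes the quadrilateral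
`(x, C), (y, C), (y, D), (x, D)`. -/
def insertQuadrilaterals {V : Type u} (G : SimpleGraph V) :
    SimpleGraph {p : V × G.Subgraph // IsCycleOfLength G 6 p.2 ∧ p.1 ∈ p.2.verts} where
  Adj p q := (p.1.2 = q.1.2 ∧ p.1.2.Adj p.1.1 q.1.1) ∨ (p.1.1 = q.1.1 ∧ p.1.2 ≠ q.1.2)
  symm := ⟨by
    rintro p q (⟨h1, h2⟩ | ⟨h1, h2⟩)
    · exact Or.inl ⟨h1.symm, by rw [← h1]; exact h2.symm⟩
    · exact Or.inr ⟨h1.symm, h2.symm⟩⟩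
  loopless := ⟨by
    rintro p (⟨-, h⟩ | ⟨-, h⟩)
    · exact h.ne rfl
    · exact h rfl⟩

/-- Phenylenes: graphs isomorphic to the graph obtained by inserting quadrilaterals between all
pairs of adjacent hexagons of a catacondensed benzenoid graph with at least two hexagons. -/
def IsPhenylene {W : Type u} (G : SimpleGraph W) : Prop :=
  ∃ (V : Type u) (S : SimpleGraph V), IsCatacondensed S ∧ 2 ≤ numHexagons S ∧
    Nonempty (insertQuadrilaterals S ≃g G)

/-! ### Types of hexagons -/

/-- The boundary cycles of the inner faces of a catacondensed benzenoid graph (all its 6-cycles;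
it has no 4-cycle) or of a phenylene (all its 6-cycles and all its 4-cycles). -/
def IsInnerFace {V : Type u} (G : SimpleGraph V) (C : G.Subgraph) : Prop :=
  IsCycleOfLength G 6 C ∨ IsCycleOfLength G 4 C

/-- The number of other inner faces adjacent to (that is, having a common edge with) `C`. -/
noncomputable def numAdjacentFaces {V : Type u} (G : SimpleGraph V) (C : G.Subgraph) : ℕ :=
  {D : G.Subgraph | IsInnerFace G D ∧ D ≠ C ∧ (C.edgeSet ∩ D.edgeSet).Nonempty}.ncard

/-- A terminal hexagon: adjacent to exactly one other inner face. -/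
def IsTerminal {V : Type u} (G : SimpleGraph V) (C : G.Subgraph) : Prop :=
  IsCycleOfLength G 6 C ∧ numAdjacentFaces G C = 1

/-- A branched hexagon: adjacent to exactly three other inner faces. -/
def IsBranched {V : Type u} (G : SimpleGraph V) (C : G.Subgraph) : Prop :=
  IsCycleOfLength G 6 C ∧ numAdjacentFaces G C = 3

/-- An angular hexagon: adjacent to exactly two other inner faces, and its two vertices of degree
two are adjacent. -/
def IsAngular {V : Type u} (G : SimpleGraph V) (C : G.Subgraph) : Prop :=
  IsCycleOfLength G 6 C ∧ numAdjacentFaces G C = 2 ∧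
    ∃ a b : V, {x | x ∈ C.verts ∧ deg G x = 2} = {a, b} ∧ G.Adj a b

/-! ### Attaching hexagons -/

/-- Add to `G` a path with `n` new inner vertices from `x` to `y`. If `x y` is an edge, this
attaches an `(n + 2)`-cycle along that edge. -/
def attachPath {V : Type u} (n : ℕ) (G : SimpleGraph V) (x y : V) : SimpleGraph (V ⊕ Fin n) where
  Adj p q := match p, q with
    | .inl a, .inl b => G.Adj a b
    | .inl a, .inr j => (a = x ∧ j.val = 0) ∨ (a = y ∧ j.val + 1 = n)
    | .inr i, .inl b => (b = x ∧ i.val = 0) ∨ (b = y ∧ i.val + 1 = n)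
    | .inr i, .inr j => i.val + 1 = j.val ∨ j.val + 1 = i.val
  symm := ⟨by
    rintro (a | i) (b | j) h
    · exact SimpleGraph.Adj.symm (G := G) h
    · exact h
    · exact h
    · exact h.symm⟩
  loopless := ⟨by
    rintro (a | i) h
    · exact G.irrefl h
    · rcases h with h | h <;> omega⟩

/-- The inclusion of the old graph. -/
def attachPathIncl {V : Type u} (n : ℕ) (G : SimpleGraph V) (x y : V) :
    G →g attachPath n G x y where
  toFun := Sum.inl
  map_rel' h := h

/-- Attach a new hexagon to a benzenoid graph along the edge `x y`. -/
abbrev attachHex {V : Type u} (G : SimpleGraph V) (x y : V) : SimpleGraph (V ⊕ Fin 4) :=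
  attachPath 4 G x y

/-- The inclusion of the old graph. -/
abbrev attachHexIncl {V : Type u} (G : SimpleGraph V) (x y : V) : G →g attachHex G x y :=
  attachPathIncl 4 G x y

/-- Attach a new hexagon to a phenylene at the edge `x y`: first attach a quadrilateral along
`x y`, then attach a hexagon along the opposite edge of the quadrilateral. -/
abbrev attachQuadHex {V : Type u} (G : SimpleGraph V) (x y : V) :
    SimpleGraph ((V ⊕ Fin 2) ⊕ Fin 4) :=
  attachPath 4 (attachPath 2 G x y) (Sum.inr 0) (Sum.inr 1)

/-- The inclusion of the old graph. -/
abbrev attachQuadHexIncl {V : Type u} (G : SimpleGraph V) (x y : V) : G →g attachQuadHex G x y :=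
  (attachPathIncl 4 (attachPath 2 G x y) (Sum.inr 0) (Sum.inr 1)).comp (attachPathIncl 2 G x y)

/-- The edge `x y` of the hexagon `C` is free: both its ends have degree two. These are the edges
of `C` at which a new hexagon can be attached within the class of catacondensed benzenoid graphs
(or of phenylenes), since there all vertices have degree two or three. -/
def IsFreeEdge {V : Type u} (G : SimpleGraph V) (C : G.Subgraph) (x y : V) : Prop :=
  C.Adj x y ∧ deg G x = 2 ∧ deg G y = 2

/-- Extension 1 for benzenoid graphs: attach exactly two new hexagons to a terminal hexagon `C`
of `G₀` (at two free edges without a common vertex), so that `C` becomes branched. -/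
def HexExtensionOne {V W : Type u} (G₀ : SimpleGraph V) (G : SimpleGraph W) : Prop :=
  ∃ (C : G₀.Subgraph) (x y z t : V), IsTerminal G₀ C ∧
    IsFreeEdge G₀ C x y ∧ IsFreeEdge G₀ C z t ∧ Disjoint ({x, y} : Set V) {z, t} ∧
    IsBranched (attachHex (attachHex G₀ x y) (Sum.inl z) (Sum.inl t))
      (C.map ((attachHexIncl (attachHex G₀ x y) (Sum.inl z) (Sum.inl t)).comp
        (attachHexIncl G₀ x y))) ∧
    Nonempty (attachHex (attachHex G₀ x y) (Sum.inl z) (Sum.inl t) ≃g G)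

/-- Extension 2 for benzenoid graphs: attach exactly one new hexagon to a terminal hexagon `C`
of `G₀`, so that `C` becomes angular. -/
def HexExtensionTwo {V W : Type u} (G₀ : SimpleGraph V) (G : SimpleGraph W) : Prop :=
  ∃ (C : G₀.Subgraph) (x y : V), IsTerminal G₀ C ∧ IsFreeEdge G₀ C x y ∧
    IsAngular (attachHex G₀ x y) (C.map (attachHexIncl G₀ x y)) ∧
    Nonempty (attachHex G₀ x y ≃g G)

/-- Extension 1 for phenylenes. -/
def QuadHexExtensionOne {V W : Type u} (G₀ : SimpleGraph V) (G : SimpleGraph W) : Prop :=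
  ∃ (C : G₀.Subgraph) (x y z t : V), IsTerminal G₀ C ∧
    IsFreeEdge G₀ C x y ∧ IsFreeEdge G₀ C z t ∧ Disjoint ({x, y} : Set V) {z, t} ∧
    IsBranched (attachQuadHex (attachQuadHex G₀ x y) (Sum.inl (Sum.inl z)) (Sum.inl (Sum.inl t)))
      (C.map ((attachQuadHexIncl (attachQuadHex G₀ x y) (Sum.inl (Sum.inl z))
        (Sum.inl (Sum.inl t))).comp (attachQuadHexIncl G₀ x y))) ∧
    Nonempty (attachQuadHex (attachQuadHex G₀ x y) (Sum.inl (Sum.inl z))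
      (Sum.inl (Sum.inl t)) ≃g G)

/-- Extension 2 for phenylenes. -/
def QuadHexExtensionTwo {V W : Type u} (G₀ : SimpleGraph V) (G : SimpleGraph W) : Prop :=
  ∃ (C : G₀.Subgraph) (x y : V), IsTerminal G₀ C ∧ IsFreeEdge G₀ C x y ∧
    IsAngular (attachQuadHex G₀ x y) (C.map (attachQuadHexIncl G₀ x y)) ∧
    Nonempty (attachQuadHex G₀ x y ≃g G)

/-! ### The extremal families -/

/-- `BuiltB k l G`: the graph `G` can be obtained from the catacondensed benzenoid graph with
exactly two hexagons by performing Extension 1 exactly `k` times and Extension 2 exactly `l` times,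
in an arbitrary order. -/
inductive BuiltB : ℕ → ℕ → ∀ {V : Type u}, SimpleGraph V → Prop
  | base {V : Type u} (G : SimpleGraph V) :
      IsCatacondensed G → numHexagons G = 2 → BuiltB 0 0 G
  | extensionOne {k l : ℕ} {V W : Type u} (G₀ : SimpleGraph V) (G : SimpleGraph W) :
      BuiltB k l G₀ → HexExtensionOne G₀ G → BuiltB (k + 1) l G
  | extensionTwo {k l : ℕ} {V W : Type u} (G₀ : SimpleGraph V) (G : SimpleGraph W) :
      BuiltB k l G₀ → HexExtensionTwo G₀ G → BuiltB k (l + 1) G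

/-- `BuiltP k l G`: the graph `G` can be obtained from the phenylene with exactly two hexagons by
performing Extension 1 exactly `k` times and Extension 2 exactly `l` times, in an arbitrary
order. -/
inductive BuiltP : ℕ → ℕ → ∀ {V : Type u}, SimpleGraph V → Prop
  | base {V : Type u} (G : SimpleGraph V) :
      IsPhenylene G → numHexagons G = 2 → BuiltP 0 0 G
  | extensionOne {k l : ℕ} {V W : Type u} (G₀ : SimpleGraph V) (G : SimpleGraph W) :
      BuiltP k l G₀ → QuadHexExtensionOne G₀ G → BuiltP (k + 1) l G
  | extensionTwo {k l : ℕ} {V W : Type u} (G₀ : SimpleGraph V) (G : SimpleGraph W) :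
      BuiltP k l G₀ → QuadHexExtensionTwo G₀ G → BuiltP k (l + 1) G

/-- Membership in the family `ℬ_h`, for `h ≥ 2` (so that the subtractions do not truncate). -/
def FamilyB (h : ℕ) {V : Type u} (G : SimpleGraph V) : Prop :=
  (Even h ∧ BuiltB (h / 2 - 1) 0 G) ∨ (Odd h ∧ BuiltB ((h - 1) / 2 - 1) 1 G)

/-- Membership in the family `𝒫_h`, for `h ≥ 2`. -/
def FamilyP (h : ℕ) {V : Type u} (G : SimpleGraph V) : Prop :=
  (Even h ∧ BuiltP (h / 2 - 1) 0 G) ∨ (Odd h ∧ BuiltP ((h - 1) / 2 - 1) 1 G)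

end Benzenoid

/-! The graph is rebuilt from two hexagons, and the index depends only on how many steps of each
kind are used. Attaching a hexagon along an edge with both ends of degree two raises the index by a
constant g (5 for benzenoids, 9 for phenylenes, where a quadrilateral comes first) plus the degrees
of the two vertices of the old hexagon that flank this edge (`Nice.wienerPolarity_att`). At a
terminal hexagon a linear step therefore gains g + 4, Extension 2 gains g + 5, and Extension 1 gains
(g + 5) + (g + 6). After l linear steps, a Extensions 2 and b Extensions 1, `Grown.spec` gives h = 2
+ l + a + 2b and, equivalently, 2 W_p = 2g + 14 + (2g + 11)(h - 2) - (3l + a). As l + a has the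
parity of h, the loss 3l + a is least exactly when l = 0 and a is the parity of h; these are the
graphs of the extremal family.

That every graph arises in this way is a statement about tree-likeness, proved homologically. By
Euler's formula the sequence of functions on vertices, edges and faces over ZMod 2 is exact at the
edges, so a function on the edges with zero sum around every hexagon is the difference of a
potential on the vertices (`IsBenzenoid.exists_potential`). Two choices of such a function carry the
geometry: functions supported at one vertex show that hexagons with a common vertex share an edge
(`HexSystem.link_connected`), and a function supported on two edges of a hexagon shows that a new
hexagon meets a linked set of hexagons in a single edge (`HexSystem.inter_subset_of_linked`).

The growth then keeps every hexagon of the current part either complete (all its neighbours are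
present) or terminal. A terminal hexagon with missing neighbours receives all of them at once, one
or two, which is one of the three steps (`HexSystem.Stage.exists_larger`). The same set of hexagons
describes the benzenoid (`unionGraph`) and the phenylene (`splitGraph`), so one induction, with a
Boolean `q`, serves both classes.

For the equality case, a graph grown without linear steps must be recognised as a family member, so
the two-hexagon graph must be known to be catacondensed. All such graphs are isomorphic, and the
given member of the family was itself built from one; the property is transported along an
isomorphism. -/

namespace Benzenoid

open SimpleGraph

/-! ### Cyclically labelled cycles and the subgraphs they trace -/

/-- `c` labels the vertices of a `k`-cycle of `G` in cyclic order. -/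
structure Cyc {V : Type u} (G : SimpleGraph V) {k : ℕ} [NeZero k] (c : Fin k → V) : Prop where
  inj : Function.Injective c
  adj : ∀ i, G.Adj (c i) (c (i + 1))

namespace Cyc

variable {V : Type u} {W : Type v} {G : SimpleGraph V} {H : SimpleGraph W} {k : ℕ} [NeZero k]
  {c : Fin k → V}

/-- The subgraph traced by a labelled cycle. -/
def sub (h : Cyc G c) : G.Subgraph where
  verts := Set.range c
  Adj a b := ∃ i, (a = c i ∧ b = c (i + 1)) ∨ (b = c i ∧ a = c (i + 1))
  adj_sub := by
    rintro a b ⟨i, ⟨rfl, rfl⟩ | ⟨rfl, rfl⟩⟩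
    · exact h.adj i
    · exact (h.adj i).symm
  edge_vert := by
    rintro a b ⟨i, ⟨rfl, rfl⟩ | ⟨rfl, rfl⟩⟩ <;> exact ⟨_, rfl⟩
  symm := ⟨by
    rintro a b ⟨i, h | h⟩
    · exact ⟨i, Or.inr h⟩
    · exact ⟨i, Or.inl h⟩⟩

theorem mem_verts (h : Cyc G c) {a : V} : a ∈ h.sub.verts ↔ ∃ i, c i = a := Iff.rfl

theorem sub_adj (h : Cyc G c) {a b : V} :
    h.sub.Adj a b ↔ ∃ i, (a = c i ∧ b = c (i + 1)) ∨ (b = c i ∧ a = c (i + 1)) := Iff.rfl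

theorem apply_mem (h : Cyc G c) (i : Fin k) : c i ∈ h.sub.verts := ⟨i, rfl⟩

theorem sub_adj_succ (h : Cyc G c) (i : Fin k) : h.sub.Adj (c i) (c (i + 1)) :=
  ⟨i, Or.inl ⟨rfl, rfl⟩⟩

theorem sub_adj_apply (h : Cyc G c) {i : Fin k} {b : V} :
    h.sub.Adj (c i) b ↔ b = c (i + 1) ∨ b = c (i - 1) := by
  rw [sub_adj]
  constructor
  · rintro ⟨j, ⟨h1, rfl⟩ | ⟨rfl, h1⟩⟩
    · rw [h.inj h1]; exact Or.inl rfl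
    · rw [h.inj h1]; right; congr 1; abel
  · rintro (rfl | rfl)
    · exact ⟨i, Or.inl ⟨rfl, rfl⟩⟩
    · exact ⟨i - 1, Or.inr ⟨rfl, by congr 1; abel⟩⟩

theorem sub_adj_apply_apply (h : Cyc G c) {i j : Fin k} :
    h.sub.Adj (c i) (c j) ↔ j = i + 1 ∨ j = i - 1 := by
  rw [sub_adj_apply, h.inj.eq_iff, h.inj.eq_iff]

theorem rotate (h : Cyc G c) (r : Fin k) : Cyc G (fun i => c (i + r)) where
  inj := h.inj.comp (add_left_injective r)
  adj i := by
    have := h.adj (i + r)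
    rwa [add_right_comm] at this

theorem reflect (h : Cyc G c) : Cyc G (fun i => c (-i)) where
  inj := h.inj.comp neg_injective
  adj i := by
    have := h.adj (-(i + 1))
    rw [neg_add, neg_add_cancel_right] at this
    rw [neg_add]
    exact this.symm

theorem sub_rotate (h : Cyc G c) (r : Fin k) : (h.rotate r).sub = h.sub := by
  ext a b
  · constructor
    · rintro ⟨i, rfl⟩; exact ⟨_, rfl⟩
    · rintro ⟨i, rfl⟩; exact ⟨i - r, by simp⟩
  · constructor
    · rintro ⟨i, hi⟩
      refine ⟨i + r, ?_⟩
      simpa only [add_right_comm] using hi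
    · rintro ⟨i, hi⟩
      refine ⟨i - r, ?_⟩
      have e : i - r + 1 + r = i + 1 := by abel
      simpa only [sub_add_cancel, e] using hi

theorem sub_reflect (h : Cyc G c) : h.reflect.sub = h.sub := by
  ext a b
  · constructor
    · rintro ⟨i, rfl⟩; exact ⟨_, rfl⟩
    · rintro ⟨i, rfl⟩; exact ⟨-i, by simp⟩
  · constructor
    · rintro ⟨i, hi⟩
      refine ⟨-(i + 1), ?_⟩
      have e : -(i + 1) + 1 = -i := by abel
      rw [e]; tauto
    · rintro ⟨i, hi⟩
      refine ⟨-(i + 1), ?_⟩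
      have e : -(-(i + 1) + 1) = i := by abel
      show (a = c (- -(i + 1)) ∧ b = c (-(-(i + 1) + 1))) ∨
        (b = c (- -(i + 1)) ∧ a = c (-(-(i + 1) + 1)))
      rw [e, neg_neg]; tauto

theorem map (h : Cyc G c) (f : G →g H) (hf : Function.Injective f) : Cyc H (fun i => f (c i)) where
  inj := hf.comp h.inj
  adj i := f.map_adj (h.adj i)

theorem sub_map (h : Cyc G c) (f : G →g H) (hf : Function.Injective f) :
    (h.map f hf).sub = h.sub.map f := by
  ext a b
  · simp [Subgraph.map_verts, sub]
  · simp only [Subgraph.map_adj, Relation.Map, sub_adj]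
    constructor
    · rintro ⟨i, ⟨rfl, rfl⟩ | ⟨rfl, rfl⟩⟩
      · exact ⟨_, _, ⟨i, Or.inl ⟨rfl, rfl⟩⟩, rfl, rfl⟩
      · exact ⟨_, _, ⟨i, Or.inr ⟨rfl, rfl⟩⟩, rfl, rfl⟩
    · rintro ⟨_, _, ⟨i, ⟨rfl, rfl⟩ | ⟨rfl, rfl⟩⟩, rfl, rfl⟩
      · exact ⟨i, Or.inl ⟨rfl, rfl⟩⟩
      · exact ⟨i, Or.inr ⟨rfl, rfl⟩⟩

/-- A cycle can be relabelled so that a given oriented edge comes first. -/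
theorem exists_relabel (h : Cyc G c) {a b : V} (hab : h.sub.Adj a b) (r : Fin k) :
    ∃ (c' : Fin k → V) (h' : Cyc G c'), h'.sub = h.sub ∧ c' r = a ∧ c' (r + 1) = b := by
  obtain ⟨i, ⟨rfl, rfl⟩ | ⟨rfl, rfl⟩⟩ := hab
  · refine ⟨_, h.rotate (i - r), h.sub_rotate _, by simp, ?_⟩
    show c _ = c _
    congr 1; abel
  · refine ⟨_, h.reflect.rotate (-(i + 1) - r), ?_, ?_, ?_⟩
    · exact (h.reflect.sub_rotate _).trans h.sub_reflect
    · show c _ = c _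
      congr 1; abel
    · show c _ = c _
      congr 1; abel

end Cyc

section CycleOfLength

variable {V : Type u} {G : SimpleGraph V}

theorem IsCycleOfLength.exists_cyc {k : ℕ} [NeZero k] {C : G.Subgraph}
    (hC : IsCycleOfLength G k C) : ∃ (c : Fin k → V) (h : Cyc G c), h.sub = C := by
  obtain ⟨x, w, hw, rfl, rfl⟩ := hC
  have h3 := hw.three_le_length
  -- Addition in `Fin` wraps from the last index to 0; this agrees with the walk because a closed
  -- walk has the same vertex at positions `w.length` and 0.
  have hval : ∀ i : Fin w.length, w.getVert (i + 1 : Fin w.length).val = w.getVert (i.val + 1) := by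
    intro i
    rw [Fin.val_add]
    have h1 : ((1 : Fin w.length) : ℕ) = 1 := by
      rw [Fin.val_one', Nat.mod_eq_of_lt (by omega)]
    rw [h1]
    by_cases hi : i.val + 1 = w.length
    · rw [hi, Nat.mod_self]; simp
    · rw [Nat.mod_eq_of_lt (by omega)]
  have hc : Cyc G (fun i : Fin w.length => w.getVert i.val) := by
    refine ⟨?_, ?_⟩
    · intro i j hij
      have := hw.getVert_injOn' (by simp; omega) (by simp; omega) hij
      exact Fin.ext this
    · intro i
      show G.Adj _ _
      rw [hval]
      exact w.adj_getVert_succ i.2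
  refine ⟨_, hc, ?_⟩
  ext a b
  · rw [Cyc.mem_verts, Walk.mem_verts_toSubgraph, Walk.mem_support_iff_exists_getVert]
    constructor
    · rintro ⟨i, rfl⟩; exact ⟨i, rfl, by omega⟩
    · rintro ⟨n, rfl, hn⟩
      by_cases h : n = w.length
      · exact ⟨⟨0, by omega⟩, by subst h; simp⟩
      · exact ⟨⟨n, by omega⟩, rfl⟩
  · rw [Cyc.sub_adj, Walk.toSubgraph_adj_iff]
    constructor
    · rintro ⟨i, hi⟩
      refine ⟨i, ?_, i.2⟩
      rw [hval] at hi
      rw [Sym2.eq_iff]; tauto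
    · rintro ⟨i, hi, hlt⟩
      refine ⟨⟨i, hlt⟩, ?_⟩
      rw [hval]
      rw [Sym2.eq_iff] at hi
      simp only
      tauto

theorem exists_fin_six {P : Fin 6 → Prop} :
    (∃ i, P i) ↔ P 0 ∨ P 1 ∨ P 2 ∨ P 3 ∨ P 4 ∨ P 5 := by
  simp [Fin.exists_fin_succ]

theorem exists_fin_four {P : Fin 4 → Prop} : (∃ i, P i) ↔ P 0 ∨ P 1 ∨ P 2 ∨ P 3 := by
  simp [Fin.exists_fin_succ]

theorem Cyc.isCycleOfLength_six {c : Fin 6 → V} (h : Cyc G c) : IsCycleOfLength G 6 h.sub := by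
  let w : G.Walk (c 0) (c 0) := .cons (h.adj 0) (.cons (h.adj 1) (.cons (h.adj 2)
    (.cons (h.adj 3) (.cons (h.adj 4) (.cons (h.adj 5) .nil)))))
  refine ⟨c 0, w, ?_, rfl, ?_⟩
  · simp only [w]
    rw [Walk.cons_isCycle_iff]
    constructor
    · simp only [Walk.cons_isPath_iff, Walk.support_cons, Walk.support_nil, Walk.IsPath.nil,
        List.mem_cons, List.not_mem_nil, or_false, true_and, h.inj.eq_iff]
      decide
    · simp only [Walk.edges_cons, Walk.edges_nil, List.mem_cons, List.not_mem_nil, or_false,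
        Sym2.eq_iff, h.inj.eq_iff]
      decide
  · ext a b
    · rw [Walk.mem_verts_toSubgraph, Cyc.mem_verts, exists_fin_six]
      simp only [w, Walk.support_cons, Walk.support_nil, List.mem_cons, List.not_mem_nil, or_false]
      simp only [Fin.reduceAdd, zero_add]
      tauto
    · rw [← Subgraph.mem_edgeSet, Walk.mem_edges_toSubgraph, Cyc.sub_adj, exists_fin_six]
      simp only [w, Walk.edges_cons, Walk.edges_nil, List.mem_cons, List.not_mem_nil, or_false,
        Sym2.eq_iff, and_comm (a := b = _)]
      simp only [Fin.reduceAdd, zero_add]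

theorem Cyc.isCycleOfLength_four {c : Fin 4 → V} (h : Cyc G c) : IsCycleOfLength G 4 h.sub := by
  let w : G.Walk (c 0) (c 0) := .cons (h.adj 0) (.cons (h.adj 1) (.cons (h.adj 2)
    (.cons (h.adj 3) .nil)))
  refine ⟨c 0, w, ?_, rfl, ?_⟩
  · simp only [w]
    rw [Walk.cons_isCycle_iff]
    constructor
    · simp only [Walk.cons_isPath_iff, Walk.support_cons, Walk.support_nil, Walk.IsPath.nil,
        List.mem_cons, List.not_mem_nil, or_false, true_and, h.inj.eq_iff]
      decide
    · simp only [Walk.edges_cons, Walk.edges_nil, List.mem_cons, List.not_mem_nil, or_false,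
        Sym2.eq_iff, h.inj.eq_iff]
      decide
  · ext a b
    · rw [Walk.mem_verts_toSubgraph, Cyc.mem_verts, exists_fin_four]
      simp only [w, Walk.support_cons, Walk.support_nil, List.mem_cons, List.not_mem_nil, or_false]
      simp only [Fin.reduceAdd, zero_add]
      tauto
    · rw [← Subgraph.mem_edgeSet, Walk.mem_edges_toSubgraph, Cyc.sub_adj, exists_fin_four]
      simp only [w, Walk.edges_cons, Walk.edges_nil, List.mem_cons, List.not_mem_nil, or_false,
        Sym2.eq_iff, and_comm (a := b = _)]
      simp only [Fin.reduceAdd, zero_add]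

end CycleOfLength

/-! ### Exactness over `ZMod 2` for plane graphs, from Euler's formula -/

section PlaneMap

variable {V : Type u} {G : SimpleGraph V}

theorem const_of_adj {α : Type*} (hG : G.Connected) (s : V → α)
    (hs : ∀ a b, G.Adj a b → s a = s b) (a b : V) : s a = s b := by
  obtain ⟨w⟩ := hG.preconnected a b
  induction w with
  | nil => rfl
  | cons h _ ih => exact (hs _ _ h).trans ih

open Classical in
/-- Push a function on darts forward to edges. -/
noncomputable def dartSum (G : SimpleGraph V) [Fintype G.Dart] :
    (G.Dart → ZMod 2) →ₗ[ZMod 2] (G.edgeSet → ZMod 2) where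
  toFun x e := ∑ d : G.Dart with d.edge = e.1, x d
  map_add' x y := by ext e; simp [Finset.sum_add_distrib]
  map_smul' r x := by ext e; simp [Finset.mul_sum]

theorem dartSum_apply [Fintype G.Dart] (x : G.Dart → ZMod 2) (d : G.Dart) :
    dartSum G x ⟨d.edge, d.edge_mem⟩ = x d + x d.symm := by
  classical
  have : (Finset.univ.filter fun d' : G.Dart => d'.edge = d.edge) = {d, d.symm} := by
    ext d'
    simp [dart_edge_eq_iff]
  simp only [dartSum, LinearMap.coe_mk, AddHom.coe_mk]
  rw [this, Finset.sum_pair d.symm_ne.symm]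

theorem dartSum_eq_zero_iff [Fintype G.Dart] (x : G.Dart → ZMod 2) :
    dartSum G x = 0 ↔ ∀ d, x d = x d.symm := by
  constructor
  · intro h d
    have := congrFun h ⟨d.edge, d.edge_mem⟩
    rw [dartSum_apply] at this
    exact CharTwo.add_eq_zero.1 this
  · intro h
    ext ⟨e, he⟩
    induction e with
    | _ a b =>
      have := dartSum_apply x ⟨(a, b), he⟩
      rw [← h ⟨(a, b), he⟩] at this
      rw [Pi.zero_apply, ← CharTwo.add_self_eq_zero (x ⟨(a, b), he⟩)]
      exact this

/-- Used on both sides of the dimension count: for functions on faces and for functions on vertices,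
the kernel of the coboundary consists of the constants. -/
theorem finrank_ker_eq_one_of_const {α : Type*} [Fintype α] [Nonempty α] {M : Type*}
    [AddCommGroup M] [Module (ZMod 2) M] (L : (α → ZMod 2) →ₗ[ZMod 2] M)
    (h1 : L 1 = 0) (hc : ∀ c, L c = 0 → ∀ a b, c a = c b) :
    Module.finrank (ZMod 2) (LinearMap.ker L) = 1 := by
  obtain ⟨a0⟩ := ‹Nonempty α›
  rw [finrank_eq_one_iff_of_nonzero' (⟨1, h1⟩ : LinearMap.ker L)]
  · rintro ⟨c, hcc⟩
    refine ⟨c a0, Subtype.ext ?_⟩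
    ext a
    simpa using hc c hcc a0 a
  · intro h
    have := congrFun (congrArg Subtype.val h) a0
    simp at this

namespace PlaneMap

variable (M : PlaneMap G)

/-- The face to the side of a dart. -/
def face (d : G.Dart) : RotFace G M.rot :=
  Quotient.mk (Equiv.Perm.SameCycle.setoid (M.rot * dartRev G)) d

/-- The permutation whose orbits are the faces. -/
def next : Equiv.Perm G.Dart := M.rot * dartRev G

theorem next_apply (d : G.Dart) : M.next d = M.rot d.symm := rfl

theorem face_eq_iff {d e : G.Dart} : M.face d = M.face e ↔ M.next.SameCycle d e :=
  Quotient.eq (r := Equiv.Perm.SameCycle.setoid (M.rot * dartRev G))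

theorem face_surjective : Function.Surjective M.face := Quotient.mk_surjective

theorem face_next (d : G.Dart) : M.face (M.next d) = M.face d :=
  M.face_eq_iff.2 (Equiv.Perm.sameCycle_apply_left.2 (Equiv.Perm.SameCycle.refl _ _))

theorem fst_rot (d : G.Dart) : (M.rot d).fst = d.fst :=
  (M.rot_sameCycle (M.rot d) d).1
    (Equiv.Perm.sameCycle_apply_left.2 (Equiv.Perm.SameCycle.refl _ _))

theorem fst_next (d : G.Dart) : (M.next d).fst = d.snd := by
  rw [next_apply, fst_rot]; rfl

/-- Functions on the faces that agree on the two sides of every edge are constant. -/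
theorem const_of_face_symm {α : Type*} (c : RotFace G M.rot → α)
    (h : ∀ d, c (M.face d) = c (M.face d.symm)) (f f' : RotFace G M.rot) : c f = c f' := by
  -- The dart after `d.symm` on its face is `M.rot d`, so crossing the edge of `d` leads to the face
  -- of the rotated dart. Hence `c` is constant around each vertex, and by connectedness everywhere.
  have hrot : ∀ d, c (M.face (M.rot d)) = c (M.face d) := by
    intro d
    rw [h d, ← M.face_next d.symm, next_apply, Dart.symm_symm]
  have hpow : ∀ (n : ℕ) d, c (M.face ((M.rot ^ n) d)) = c (M.face d) := by
    intro n
    induction n with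
    | zero => intro d; rfl
    | succ n ih => intro d; rw [pow_succ, Equiv.Perm.mul_apply, ih, hrot]
  have hfst : ∀ d e : G.Dart, d.fst = e.fst → c (M.face d) = c (M.face e) := by
    intro d e hde
    obtain ⟨n, hn⟩ := (M.rot_sameCycle d e).2 hde
    rcases n with n | n
    · rw [← hn]; exact (hpow n d).symm
    · rw [zpow_negSucc, Equiv.Perm.inv_eq_iff_eq] at hn
      rw [hn, hpow]
  obtain ⟨d, rfl⟩ := M.face_surjective f
  obtain ⟨e, rfl⟩ := M.face_surjective f'
  suffices H : ∀ (a b : V) (w : G.Walk a b) (d e : G.Dart), d.fst = a → e.fst = b →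
      c (M.face d) = c (M.face e) by
    obtain ⟨w⟩ := M.connected.preconnected d.fst e.fst
    exact H _ _ w d e rfl rfl
  intro a b w
  induction w with
  | nil => intro d e hd he; exact hfst d e (hd.trans he.symm)
  | @cons a m b hab _ ih =>
    intro d e hd he
    rw [hfst d ⟨(a, m), hab⟩ hd, h]
    exact ih _ e rfl he

open Classical in
/-- The sum of the values of a function on the edges over the boundary walks of the faces. -/
noncomputable def faceSum [Fintype G.Dart] :
    (G.edgeSet → ZMod 2) →ₗ[ZMod 2] (RotFace G M.rot → ZMod 2) where
  toFun A f := ∑ d : G.Dart with M.face d = f, A ⟨d.edge, d.edge_mem⟩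
  map_add' x y := by ext e; simp [Finset.sum_add_distrib]
  map_smul' r x := by ext e; simp [Finset.mul_sum]

/-- Pull a function on the faces back to the darts. -/
noncomputable def facePull : (RotFace G M.rot → ZMod 2) →ₗ[ZMod 2] (G.Dart → ZMod 2) :=
  LinearMap.funLeft _ _ M.face

/-- Every edge is counted once for each of its two darts, and these contributions cancel modulo 2.
-/
theorem faceSum_sum [Fintype G.Dart] [Fintype (RotFace G M.rot)] (A : G.edgeSet → ZMod 2) :
    ∑ f, M.faceSum A f = 0 := by
  classical
  simp only [faceSum, LinearMap.coe_mk, AddHom.coe_mk]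
  simp_rw [Finset.sum_filter]
  rw [Finset.sum_comm]
  simp only [Finset.sum_ite_eq, Finset.mem_univ, if_true]
  refine Finset.sum_involution (fun d _ => d.symm) ?_ ?_ ?_ ?_
  · intro d _
    simp only [Dart.edge_symm]
    exact CharTwo.add_self_eq_zero _
  · intro d _ _
    exact d.symm_ne
  · simp
  · intro d _
    exact d.symm_symm

/-- Around a face the coboundary of `s` sums the values at the starts and at the ends of the darts;
`next` permutes the darts of the face and carries ends to starts, so the two sums cancel. -/
theorem faceSum_dartSum_fst [Fintype G.Dart] (s : V → ZMod 2) :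
    M.faceSum (dartSum G (fun d => s d.fst)) = 0 := by
  classical
  ext f
  simp only [faceSum, LinearMap.coe_mk, AddHom.coe_mk, dartSum_apply, Finset.sum_add_distrib,
    Pi.zero_apply]
  rw [CharTwo.add_eq_zero]
  symm
  refine Finset.sum_bij (fun d _ => M.next d) ?_ ?_ ?_ ?_
  · intro d hd
    simpa [face_next] using hd
  · intro d _ e _ h
    exact M.next.injective h
  · intro d hd
    refine ⟨M.next.symm d, ?_, by simp⟩
    have := M.face_next (M.next.symm d)
    rw [Equiv.apply_symm_apply] at this
    simpa [← this] using hd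
  · intro d _
    rw [PlaneMap.fst_next]; rfl

/-- The matrix of `faceSum` is the transpose of that of `dartSum ∘ facePull`, which sends a function
on the faces to its differences across the edges. The kernel of the latter is the constants, and
transposition preserves rank. -/
theorem faceSum_rank [Finite V] [Fintype G.Dart] [Fintype (RotFace G M.rot)]
    [Fintype G.edgeSet] : Module.finrank (ZMod 2) (LinearMap.range M.faceSum) + 1 =
      Fintype.card (RotFace G M.rot) := by
  classical
  let L := dartSum G ∘ₗ M.facePull
  have hL : LinearMap.toMatrix' M.faceSum = (LinearMap.toMatrix' L).transpose := by
    ext f e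
    rw [Matrix.transpose_apply, LinearMap.toMatrix'_apply, LinearMap.toMatrix'_apply]
    simp only [faceSum, L, facePull, dartSum, LinearMap.coe_comp, Function.comp_apply,
      LinearMap.coe_mk, AddHom.coe_mk, LinearMap.funLeft_apply, Pi.single_apply]
    rw [Finset.sum_ite, Finset.sum_ite]
    simp only [Finset.sum_const_zero, add_zero, Finset.filter_filter]
    congr 1
    ext d
    simp only [Finset.mem_filter, Finset.mem_univ, true_and, Subtype.ext_iff]
    tauto
  have : Nonempty (RotFace G M.rot) := ⟨M.outer⟩
  have hker : Module.finrank (ZMod 2) (LinearMap.ker L) = 1 := by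
    apply finrank_ker_eq_one_of_const
    · exact (dartSum_eq_zero_iff _).2 fun d => rfl
    · intro c hc
      exact M.const_of_face_symm c ((dartSum_eq_zero_iff _).1 hc)
  have h1 := LinearMap.finrank_range_add_finrank_ker L
  rw [hker, Module.finrank_fintype_fun_eq_card] at h1
  rw [← h1]
  congr 1
  have h2 := Matrix.rank_transpose (LinearMap.toMatrix' L)
  rw [← hL] at h2
  have h3 : (LinearMap.toMatrix' M.faceSum).mulVecLin = M.faceSum :=
    LinearMap.ext fun x => LinearMap.toMatrix'_mulVec _ x
  have h4 : (LinearMap.toMatrix' L).mulVecLin = L :=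
    LinearMap.ext fun x => LinearMap.toMatrix'_mulVec _ x
  rwa [Matrix.rank, Matrix.rank, h3, h4] at h2

/-- A function on the edges with zero sum around every face is a coboundary. -/
theorem exists_potential [Finite V] [Fintype G.Dart] (A : G.edgeSet → ZMod 2)
    (hA : M.faceSum A = 0) : ∃ s : V → ZMod 2, dartSum G (fun d => s d.fst) = A := by
  classical
  have := Fintype.ofFinite V
  have : Fintype G.edgeSet := Fintype.ofFinite _
  have : Finite (RotFace G M.rot) := Finite.of_surjective _ M.face_surjective
  have := Fintype.ofFinite (RotFace G M.rot)
  let δ : (V → ZMod 2) →ₗ[ZMod 2] (G.edgeSet → ZMod 2) :=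
    dartSum G ∘ₗ LinearMap.funLeft _ _ (fun d : G.Dart => d.fst)
  have hle : LinearMap.range δ ≤ LinearMap.ker M.faceSum := by
    rintro _ ⟨s, rfl⟩
    exact M.faceSum_dartSum_fst s
  have := M.connected.nonempty
  have hker : Module.finrank (ZMod 2) (LinearMap.ker δ) = 1 := by
    apply finrank_ker_eq_one_of_const
    · exact (dartSum_eq_zero_iff _).2 fun d => rfl
    · intro s hs
      refine const_of_adj M.connected s fun a b hab => ?_
      exact (dartSum_eq_zero_iff _).1 hs ⟨(a, b), hab⟩
  have h1 := LinearMap.finrank_range_add_finrank_ker δ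
  have h2 := LinearMap.finrank_range_add_finrank_ker M.faceSum
  have h3 := M.faceSum_rank
  have h4 := M.euler
  rw [hker, Module.finrank_fintype_fun_eq_card] at h1
  rw [Module.finrank_fintype_fun_eq_card] at h2
  rw [Nat.card_eq_fintype_card, Nat.card_eq_fintype_card, Nat.card_eq_fintype_card] at h4
  -- The image of the coboundary has dimension |V| - 1 and the kernel of `faceSum` has dimension |E|
  -- - |F| + 1; Euler's formula makes them equal.
  have := Submodule.eq_of_le_of_finrank_eq hle (by omega)
  have hA' : A ∈ LinearMap.range δ := by rw [this]; exact hA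
  exact hA'

end PlaneMap

/-- A function on the edges with zero sum around every 6-cycle is a coboundary. -/
theorem IsBenzenoid.exists_potential {M : PlaneMap G} (hM : IsBenzenoid G M)
    (A : Sym2 V → ZMod 2)
    (hA : ∀ c : Fin 6 → V, Cyc G c → ∑ i, A s(c i, c (i + 1)) = 0) :
    ∃ s : V → ZMod 2, ∀ a b, G.Adj a b → A s(a, b) = s a + s b := by
  classical
  have hfin : Finite V := Nat.finite_of_card_ne_zero (by have := hM.twoConnected.three_le_card; omega)
  have := Fintype.ofFinite V
  have : Fintype G.Dart := Fintype.ofFinite _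
  have : Finite (RotFace G M.rot) := Finite.of_surjective _ M.face_surjective
  have := Fintype.ofFinite (RotFace G M.rot)
  have inner : ∀ f, f ≠ M.outer → M.faceSum (fun e => A e.1) f = 0 := by
    intro f hf
    obtain ⟨h6, hinj⟩ := hM.inner_hexagonal f hf
    obtain ⟨d, rfl⟩ := M.face_surjective f
    -- The darts of the face are the orbit of `d` under `next`, so the period equals their number,
    -- six; their starting vertices, distinct by assumption, label a 6-cycle.
    set n := Function.minimalPeriod M.next d with hn
    have hfin : d ∈ Function.periodicPts M.next :=
      ⟨orderOf M.next, orderOf_pos _, by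
        rw [Function.IsPeriodicPt, Function.IsFixedPt, ← Equiv.Perm.coe_pow, pow_orderOf_eq_one]
        rfl⟩
    have hpos : 0 < n := Function.minimalPeriod_pos_of_mem_periodicPts hfin
    have himg : M.faceDarts (M.face d) = (fun i => M.next^[i] d) '' Set.Iio n := by
      ext e
      constructor
      · intro he
        obtain ⟨i, -, -, hi⟩ := (M.face_eq_iff.1 (Eq.symm he)).exists_pow_eq''
        refine ⟨i % n, Nat.mod_lt _ hpos, ?_⟩
        simp only [hn]
        rw [Function.iterate_mod_minimalPeriod_eq, ← Equiv.Perm.coe_pow, hi]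
      · rintro ⟨i, -, rfl⟩
        show M.face (M.next^[i] d) = M.face d
        clear hn
        induction i with
        | zero => rfl
        | succ i ih => rw [Function.iterate_succ_apply', PlaneMap.face_next, ih]
    have hn6 : n = 6 := by
      rw [himg, Set.InjOn.ncard_image Function.iterate_injOn_Iio_minimalPeriod] at h6
      simpa using h6
    have hbij : Set.BijOn (fun i : Fin 6 => M.next^[i.1] d) Set.univ (M.faceDarts (M.face d)) := by
      refine ⟨?_, ?_, ?_⟩
      · intro i _
        rw [himg]
        exact ⟨i.1, by rw [hn6]; exact i.2, rfl⟩
      · intro i _ j _ hij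
        exact Fin.ext (Function.iterate_injOn_Iio_minimalPeriod
          (by rw [← hn, hn6]; exact i.2) (by rw [← hn, hn6]; exact j.2) hij)
      · intro e he
        rw [himg] at he
        obtain ⟨i, hi, rfl⟩ := he
        rw [hn6] at hi
        exact ⟨⟨i, hi⟩, trivial, rfl⟩
    have hsucc : ∀ i : Fin 6, M.next^[(i + 1 : Fin 6).1] d = M.next (M.next^[i.1] d) := by
      intro i
      rw [← Function.iterate_succ_apply' M.next]
      have h0 : (i + 1 : Fin 6).1 = (i.1 + 1) % n := by rw [hn6]; rfl
      rw [h0, hn, Function.iterate_mod_minimalPeriod_eq]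
    have hcyc : Cyc G (fun i : Fin 6 => (M.next^[i.1] d).fst) := by
      constructor
      · intro i j hij
        exact hbij.injOn trivial trivial
          (hinj (hbij.mapsTo trivial) (hbij.mapsTo trivial) hij)
      · intro i
        simp only [hsucc, PlaneMap.fst_next]
        exact (M.next^[i.1] d).adj
    have key := hA _ hcyc
    rw [← key]
    simp only [PlaneMap.faceSum, LinearMap.coe_mk, AddHom.coe_mk]
    symm
    refine Finset.sum_bij (fun i _ => M.next^[i.1] d) ?_ ?_ ?_ ?_
    · intro i _
      exact Finset.mem_filter.2 ⟨Finset.mem_univ _, hbij.mapsTo (Set.mem_univ i)⟩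
    · intro i _ j _ hij
      exact hbij.injOn trivial trivial hij
    · intro e he
      obtain ⟨i, -, hi⟩ := hbij.surjOn (Finset.mem_filter.1 he).2
      exact ⟨i, Finset.mem_univ _, hi⟩
    · intro i _
      simp only [hsucc, PlaneMap.fst_next]
      rfl
  have hzero : M.faceSum (fun e => A e.1) = 0 := by
    ext f
    -- The sums over all faces add up to zero, so the outer face needs no condition of its own.
    by_cases hf : f = M.outer
    · have := M.faceSum_sum (fun e => A e.1)
      rw [Finset.sum_eq_single M.outer (fun f _ h => inner f h) (by simp)] at this
      rw [hf, this]; rfl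
    · exact inner f hf
  obtain ⟨s, hs⟩ := M.exists_potential _ hzero
  refine ⟨s, fun a b hab => ?_⟩
  have := congrFun hs ⟨s(a, b), hab⟩
  rw [← this]
  exact dartSum_apply _ ⟨(a, b), hab⟩

end PlaneMap

/-! ### Tree-like structure of the hexagons -/

/-- The properties of the hexagons of a catacondensed benzenoid graph on which its tree-like
structure rests. -/
structure HexSystem {V : Type u} (G : SimpleGraph V) : Prop where
  finite : Finite V
  connected : G.Connected
  exists_third : ∀ a b : V, ∃ c, c ≠ a ∧ c ≠ b
  no_cut_vertex : ∀ x : V, (G.induce {y | y ≠ x}).Connected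
  exists_potential : ∀ A : Sym2 V → ZMod 2,
    (∀ c : Fin 6 → V, Cyc G c → ∑ i, A s(c i, c (i + 1)) = 0) →
    ∃ s : V → ZMod 2, ∀ a b, G.Adj a b → A s(a, b) = s a + s b
  disjoint_or_one_edge : ∀ C D : G.Subgraph, IsCycleOfLength G 6 C → IsCycleOfLength G 6 D →
    C ≠ D → Disjoint C.verts D.verts ∨ ∃! e : Sym2 V, e ∈ C.edgeSet ∧ e ∈ D.edgeSet
  no_internal : ∀ x : V, ¬ IsInternalVertex G x

theorem IsCatacondensed.hexSystem {V : Type u} {G : SimpleGraph V} (h : IsCatacondensed G) :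
    HexSystem G := by
  obtain ⟨⟨M, hM⟩, hi⟩ := h
  have h3 := hM.twoConnected.three_le_card
  have hf : Finite V := Nat.finite_of_card_ne_zero (by omega)
  refine ⟨hf, hM.twoConnected.connected, ?_, hM.twoConnected.no_cut_vertex, hM.exists_potential,
    hM.disjoint_or_one_edge, hi⟩
  intro a b
  by_contra! hc
  have : (Set.univ : Set V) ⊆ {a, b} := by
    intro c _
    by_cases hca : c = a
    · exact Or.inl hca
    · exact Or.inr (hc c hca)
  have h1 := Set.ncard_le_ncard this (Set.toFinite _)
  rw [Set.ncard_univ] at h1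
  have := Set.ncard_insert_le a ({b} : Set V)
  rw [Set.ncard_singleton] at this
  omega

theorem IsCycleOfLength.exists_cyc_of_adj {V : Type u} {G : SimpleGraph V} {k : ℕ} [NeZero k]
    {C : G.Subgraph} (hC : IsCycleOfLength G k C) {a b : V} (hab : C.Adj a b) (r : Fin k) :
    ∃ (c : Fin k → V) (h : Cyc G c), h.sub = C ∧ c r = a ∧ c (r + 1) = b := by
  obtain ⟨c, h, rfl⟩ := hC.exists_cyc
  exact h.exists_relabel hab r

/-- The six edges of a labelled hexagon are distinct, so the sum runs over the edge set of the
subgraph and does not see the labelling. -/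
theorem Cyc.sum_edges_congr {V : Type u} {G : SimpleGraph V} {M : Type*} [AddCommMonoid M]
    {c d : Fin 6 → V} (hc : Cyc G c) (hd : Cyc G d) (h : hc.sub = hd.sub) (f : Sym2 V → M) :
    ∑ i, f s(c i, c (i + 1)) = ∑ i, f s(d i, d (i + 1)) := by
  classical
  have inj : ∀ {c : Fin 6 → V}, Cyc G c →
      Set.InjOn (fun i => s(c i, c (i + 1))) (Finset.univ : Finset (Fin 6)) := by
    intro c hc i _ j _ hij
    simp only [Sym2.eq_iff, hc.inj.eq_iff] at hij
    revert i j
    decide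
  have mem : ∀ {c : Fin 6 → V} (hc : Cyc G c) (e : Sym2 V),
      e ∈ Finset.univ.image (fun i => s(c i, c (i + 1))) ↔ e ∈ hc.sub.edgeSet := by
    intro c hc e
    induction e with
    | _ a b =>
      rw [Subgraph.mem_edgeSet, hc.sub_adj]
      simp only [Finset.mem_image, Finset.mem_univ, true_and, Sym2.eq_iff]
      constructor
      · rintro ⟨i, hi⟩
        exact ⟨i, by rcases hi with ⟨rfl, rfl⟩ | ⟨rfl, rfl⟩ <;> tauto⟩
      · rintro ⟨i, hi⟩
        exact ⟨i, by rcases hi with ⟨rfl, rfl⟩ | ⟨rfl, rfl⟩ <;> tauto⟩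
  rw [← Finset.sum_image (f := f) (inj hc), ← Finset.sum_image (f := f) (inj hd)]
  congr 1
  ext e
  rw [mem hc, mem hd, h]

namespace HexSystem

variable {V : Type u} {G : SimpleGraph V} (S : HexSystem G)
include S

theorem eq_or_eq_or_eq {C D E : G.Subgraph} (hC : IsCycleOfLength G 6 C)
    (hD : IsCycleOfLength G 6 D) (hE : IsCycleOfLength G 6 E) {x : V} (h1 : x ∈ C.verts)
    (h2 : x ∈ D.verts) (h3 : x ∈ E.verts) : C = D ∨ C = E ∨ D = E := by
  by_contra! h
  exact S.no_internal x ⟨C, D, E, hC, hD, hE, h.1, h.2.1, h.2.2, h1, h2, h3⟩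

/-- If every hexagon through `z` contains both or none of its neighbours at `z` in `A`, then `A`
contains all the neighbours of `z` or none. -/
theorem link_connected (z : V) (A : Set V)
    (hA : ∀ c : Fin 6 → V, Cyc G c → ∀ i, c i = z → (c (i + 1) ∈ A ↔ c (i - 1) ∈ A)) {a b : V}
    (ha : G.Adj z a) (hb : G.Adj z b) : a ∈ A ↔ b ∈ A := by
  classical
  -- `f` marks the edges from `z` into `A`. A hexagon through `z` uses two edges at `z`, both marked
  -- or both unmarked, so its sum is zero.
  let f : Sym2 V → ZMod 2 := fun e => if ∃ a ∈ A, e = s(z, a) then 1 else 0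
  have f1 : ∀ a, f s(z, a) = if a ∈ A then 1 else 0 := by
    intro a
    simp only [f]
    congr 1
    apply propext
    constructor
    · rintro ⟨a', h, h'⟩
      rw [Sym2.congr_right] at h'
      rwa [h']
    · intro h; exact ⟨a, h, rfl⟩
  have f2 : ∀ a b, a ≠ z → b ≠ z → f s(a, b) = 0 := by
    intro a b ha hb
    simp only [f]
    rw [if_neg]
    rintro ⟨a', -, h'⟩
    rw [Sym2.eq_iff] at h'
    rcases h' with ⟨h, -⟩ | ⟨-, h⟩
    · exact ha h
    · exact hb h
  obtain ⟨s, hs⟩ := S.exists_potential f (by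
    intro c hc
    by_cases hz : ∃ j, c j = z
    · obtain ⟨j, rfl⟩ := hz
      rw [Fintype.sum_eq_add j (j - 1)]
      · rw [sub_add_cancel, Sym2.eq_swap (a := c (j - 1)), f1, f1]
        simp only [hA c hc j rfl]
        exact CharTwo.add_self_eq_zero _
      · intro h
        revert h; clear * -; revert j; decide
      · rintro i ⟨h1, h2⟩
        apply f2
        · exact hc.inj.ne h1
        · exact hc.inj.ne (fun h => h2 (by rw [← h]; abel))
    · push Not at hz
      exact Finset.sum_eq_zero fun i _ => f2 _ _ (hz _) (hz _))
  -- Away from `z` all values of `f` vanish, and the graph without `z` is connected; hence the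
  -- potential is constant there.
  have key : s a = s b := by
    have hc := S.no_cut_vertex z
    exact const_of_adj hc (fun y : {y | y ≠ z} => s y.1) (by
      rintro ⟨u, hu⟩ ⟨w, hw⟩ huw
      have := hs u w huw
      rw [f2 _ _ hu hw] at this
      exact CharTwo.add_eq_zero.1 this.symm) ⟨a, ha.ne'⟩ ⟨b, hb.ne'⟩
  have h1 := hs z a ha
  have h2 := hs z b hb
  rw [key, ← h2, f1, f1] at h1
  by_cases h3 : a ∈ A <;> by_cases h4 : b ∈ A <;> simp_all

/-- If `a b` lay in no hexagon, `link_connected` at `a` with the set {b} would make `b` the only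
neighbour of `a`. Then `b` would separate `a` from any third vertex. -/
theorem exists_hexagon_of_adj {a b : V} (hab : G.Adj a b) :
    ∃ C : G.Subgraph, IsCycleOfLength G 6 C ∧ C.Adj a b := by
  by_contra! hc
  obtain ⟨e, he1, he2⟩ := S.exists_third a b
  have hnb : ∀ w, G.Adj a w → w = b := by
    intro w hw
    refine (S.link_connected a {b} ?_ hab hw).1 rfl
    rintro c h i rfl
    constructor
    · intro h1
      rw [← Set.mem_singleton_iff.1 h1] at hc
      exact absurd (h.sub_adj_succ i) (hc _ h.isCycleOfLength_six)
    · intro h1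
      rw [← Set.mem_singleton_iff.1 h1] at hc
      exact absurd (h.sub_adj_apply.2 (Or.inr rfl)) (hc _ h.isCycleOfLength_six)
  have hconn := S.no_cut_vertex b
  have := const_of_adj hconn (fun y : {y | y ≠ b} => y.1 = a) (by
    rintro ⟨u, hu⟩ ⟨w, hw⟩ huw
    have huw' : G.Adj u w := huw
    apply propext
    constructor
    · rintro rfl; exact absurd (hnb _ huw') hw
    · rintro rfl; exact absurd (hnb _ huw'.symm) hu) ⟨a, hab.ne⟩ ⟨e, he2⟩
  exact he1 (this.mp rfl)

theorem exists_hexagon_of_vertex (a : V) :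
    ∃ C : G.Subgraph, IsCycleOfLength G 6 C ∧ a ∈ C.verts := by
  obtain ⟨e, he, -⟩ := S.exists_third a a
  obtain ⟨w⟩ := S.connected.preconnected a e
  cases w with
  | nil => exact absurd rfl he
  | cons h _ =>
    obtain ⟨C, hC, h1⟩ := S.exists_hexagon_of_adj h
    exact ⟨C, hC, C.edge_vert h1⟩

/-- Two hexagons with a common vertex `z` have a common edge at `z`. -/
theorem exists_common_adj {C D : G.Subgraph} (hC : IsCycleOfLength G 6 C)
    (hD : IsCycleOfLength G 6 D) (hne : C ≠ D) {z : V} (h1 : z ∈ C.verts) (h2 : z ∈ D.verts) :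
    ∃ a, C.Adj z a ∧ D.Adj z a := by
  obtain ⟨c, hc, rfl⟩ := hC.exists_cyc
  obtain ⟨d, hd, rfl⟩ := hD.exists_cyc
  obtain ⟨i, rfl⟩ := h1
  obtain ⟨j, hj⟩ := h2
  by_contra! hcon
  -- Without internal vertices, the hexagons through `z` are only `C` and `D`. If they shared no
  -- edge at `z`, the neighbours of `z` in `C` would be a set respected by both, and the neighbours
  -- in `D` would have to belong to it.
  have := S.link_connected (c i) {w | hc.sub.Adj (c i) w} (by
    intro e he k hk
    rcases S.eq_or_eq_or_eq hC hD he.isCycleOfLength_six (hc.apply_mem i) ⟨j, hj⟩ ⟨k, hk⟩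
      with h | h | h
    · exact absurd h hne
    · rw [Set.mem_ofPred_eq, Set.mem_ofPred_eq, h, ← hk, he.sub_adj_apply, he.sub_adj_apply]
      simp
    · rw [Set.mem_ofPred_eq, Set.mem_ofPred_eq]
      have h1 : hd.sub.Adj (c i) (e (k + 1)) := by
        rw [h, ← hk, he.sub_adj_apply]; exact Or.inl rfl
      have h2 : hd.sub.Adj (c i) (e (k - 1)) := by
        rw [h, ← hk, he.sub_adj_apply]; exact Or.inr rfl
      exact ⟨fun h => absurd h1 (hcon _ h), fun h => absurd h2 (hcon _ h)⟩)
    (hc.adj i) (hj ▸ hd.adj j)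
  exact hcon _ (this.1 (hc.sub_adj_succ i)) (hj ▸ hd.sub_adj_succ j)

/-- Two hexagons with a common vertex have exactly an edge in common. -/
theorem exists_inter_eq {C D : G.Subgraph} (hC : IsCycleOfLength G 6 C)
    (hD : IsCycleOfLength G 6 D) (hne : C ≠ D) {z : V} (h1 : z ∈ C.verts) (h2 : z ∈ D.verts) :
    ∃ x y, C.Adj x y ∧ D.Adj x y ∧ ∀ w, w ∈ C.verts → w ∈ D.verts → w = x ∨ w = y := by
  obtain ⟨a, h3, h4⟩ := S.exists_common_adj hC hD hne h1 h2
  refine ⟨z, a, h3, h4, fun w hw1 hw2 => ?_⟩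
  rcases S.disjoint_or_one_edge C D hC hD hne with h | ⟨e, -, he⟩
  · exact absurd h2 (Set.disjoint_left.1 h h1)
  · obtain ⟨b, h5, h6⟩ := S.exists_common_adj hC hD hne hw1 hw2
    have := (he s(w, b) ⟨h5, h6⟩).trans (he s(z, a) ⟨h3, h4⟩).symm
    rw [Sym2.eq_iff] at this
    tauto

theorem adj_of_mem_of_mem {C D : G.Subgraph} (hC : IsCycleOfLength G 6 C)
    (hD : IsCycleOfLength G 6 D) (hne : C ≠ D) {x y : V} (hxy : x ≠ y) (h1 : x ∈ C.verts)
    (h2 : x ∈ D.verts) (h3 : y ∈ C.verts) (h4 : y ∈ D.verts) : C.Adj x y ∧ D.Adj x y := by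
  obtain ⟨a, b, h5, h6, h7⟩ := S.exists_inter_eq hC hD hne h1 h2
  rcases h7 x h1 h2 with rfl | rfl <;> rcases h7 y h3 h4 with rfl | rfl
  · exact absurd rfl hxy
  · exact ⟨h5, h6⟩
  · exact ⟨h5.symm, h6.symm⟩
  · exact absurd rfl hxy

theorem inter_subset {C D : G.Subgraph} (hC : IsCycleOfLength G 6 C)
    (hD : IsCycleOfLength G 6 D) (hne : C ≠ D) {x y : V} (hxy : x ≠ y) (h1 : x ∈ C.verts)
    (h2 : x ∈ D.verts) (h3 : y ∈ C.verts) (h4 : y ∈ D.verts) {w : V} (h5 : w ∈ C.verts)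
    (h6 : w ∈ D.verts) : w = x ∨ w = y := by
  obtain ⟨a, b, -, -, h7⟩ := S.exists_inter_eq hC hD hne h1 h2
  rcases h7 x h1 h2 with rfl | rfl <;> rcases h7 y h3 h4 with rfl | rfl <;>
    rcases h7 w h5 h6 with rfl | rfl <;> tauto

omit S in
/-- A set of hexagons is linked if it cannot be split into two parts without common vertices. -/
def Linked (T : Set G.Subgraph) : Prop :=
  ∀ s : V → ZMod 2, (∀ E ∈ T, ∀ a ∈ E.verts, ∀ b ∈ E.verts, s a = s b) →
    ∀ E ∈ T, ∀ a ∈ E.verts, ∀ F ∈ T, ∀ b ∈ F.verts, s a = s b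

/-- The absence of cycles of hexagons. Label `D` so that the edge shared with `C` is `d 5`, `d 0`,
and mark the two edges of `D` next to it. The marks sum to zero on `D` and are absent from all other
hexagons. The resulting potential is constant on the linked set `T`, with value `s (d 0)`, but takes
the other value on `d 1`, ..., `d 4`; so none of these is a vertex of a hexagon in `T`. -/
theorem inter_subset_of_linked {T : Set G.Subgraph} (hT : ∀ E ∈ T, IsCycleOfLength G 6 E)
    (hL : Linked T) {C D : G.Subgraph} (hC : C ∈ T) (hD : IsCycleOfLength G 6 D) (hDT : D ∉ T)
    {x y : V} (hCxy : C.Adj x y) (hDxy : D.Adj x y) {E : G.Subgraph} (hE : E ∈ T) {w : V}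
    (h1 : w ∈ E.verts) (h2 : w ∈ D.verts) : w = x ∨ w = y := by
  classical
  obtain ⟨d, hd, rfl, rfl, rfl⟩ := hD.exists_cyc_of_adj hDxy 5
  have h50 : (5 : Fin 6) + 1 = 0 := rfl
  rw [h50] at hCxy hDxy ⊢
  have hCD : C ≠ hd.sub := fun h => hDT (h ▸ hC)
  let f : Sym2 V → ZMod 2 := fun e => if e = s(d 0, d 1) ∨ e = s(d 4, d 5) then 1 else 0
  have f0 : ∀ a b, ¬ (a = d 0 ∧ b = d 1) → ¬ (a = d 1 ∧ b = d 0) → ¬ (a = d 4 ∧ b = d 5) →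
      ¬ (a = d 5 ∧ b = d 4) → f s(a, b) = 0 := by
    intro a b h1 h2 h3 h4
    simp only [f, Sym2.eq_iff]
    rw [if_neg]; tauto
  -- Each marked edge has an end in both `C` and `D`. Another hexagon containing it would be a third
  -- one at that vertex unless it is `C`, and `C` meets `D` only in `d 5`, `d 0`.
  have hother : ∀ (E : G.Subgraph), IsCycleOfLength G 6 E → E ≠ hd.sub → ∀ a b, E.Adj a b →
      f s(a, b) = 0 := by
    intro E hE hne a b hab
    have hno : ∀ i j : Fin 6, (i = 0 ∧ j = 1 ∨ i = 5 ∧ j = 4) → ¬ E.Adj (d i) (d j) := by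
      intro i j hij hadj
      have hi : d i ∈ C.verts := by
        rcases hij with ⟨rfl, -⟩ | ⟨rfl, -⟩
        · exact C.edge_vert hCxy.symm
        · exact C.edge_vert hCxy
      rcases S.eq_or_eq_or_eq (hT C hC) hE hd.isCycleOfLength_six hi (E.edge_vert hadj)
        (hd.apply_mem i) with rfl | h | h
      · have := S.inter_subset (hT C hC) hd.isCycleOfLength_six hCD
          (hd.inj.ne (by decide : (5 : Fin 6) ≠ 0)) (C.edge_vert hCxy) (hd.apply_mem 5)
          (C.edge_vert hCxy.symm) (hd.apply_mem 0) (C.edge_vert hadj.symm) (hd.apply_mem j)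
        rw [hd.inj.eq_iff, hd.inj.eq_iff] at this
        revert this
        rcases hij with ⟨rfl, rfl⟩ | ⟨rfl, rfl⟩ <;> decide
      · exact hCD h
      · exact hne h
    apply f0
    · rintro ⟨rfl, rfl⟩; exact hno 0 1 (by decide) hab
    · rintro ⟨rfl, rfl⟩; exact hno 0 1 (by decide) hab.symm
    · rintro ⟨rfl, rfl⟩; exact hno 5 4 (by decide) hab.symm
    · rintro ⟨rfl, rfl⟩; exact hno 5 4 (by decide) hab
  have hinner : ∀ i j : Fin 6, (i = 1 ∨ i = 2 ∨ i = 3) → j = i + 1 → f s(d i, d j) = 0 := by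
    intro i j hi hj
    subst hj
    apply f0 <;> simp only [hd.inj.eq_iff] <;> revert i <;> decide
  obtain ⟨s, hs⟩ := S.exists_potential f (by
    intro e he
    by_cases hne : he.sub = hd.sub
    · rw [he.sum_edges_congr hd hne f, Fin.sum_univ_six]
      simp only [Fin.reduceAdd, zero_add]
      rw [hinner 1 2 (by decide) rfl, hinner 2 3 (by decide) rfl, hinner 3 4 (by decide) rfl,
        f0 (d 5) (d 0) (by simp only [hd.inj.eq_iff]; decide) (by simp only [hd.inj.eq_iff]; decide)
          (by simp only [hd.inj.eq_iff]; decide) (by simp only [hd.inj.eq_iff]; decide)]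
      simp only [f, true_or, or_true, if_true]
      decide
    · exact Finset.sum_eq_zero fun i _ => hother _ he.isCycleOfLength_six hne _ _
        (he.sub_adj_succ i))
  have hconst : ∀ E ∈ T, ∀ a ∈ E.verts, ∀ b ∈ E.verts, s a = s b := by
    intro E hE
    have hE6 := hT E hE
    obtain ⟨e, he, rfl⟩ := hE6.exists_cyc
    have hstep : ∀ i, s (e i) = s (e (i + 1)) := by
      intro i
      have := hs _ _ (he.adj i)
      rw [hother _ hE6 (fun h => hDT (h ▸ hE)) _ _ (he.sub_adj_succ i)] at this
      exact CharTwo.add_eq_zero.1 this.symm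
    have h0 : ∀ i, s (e i) = s (e 0) := by
      have h1 := hstep 0; have h2 := hstep 1; have h3 := hstep 2; have h4 := hstep 3
      have h5 := hstep 4
      simp only [zero_add, Fin.reduceAdd] at h1 h2 h3 h4 h5
      intro i
      fin_cases i
      · rfl
      · exact h1.symm
      · exact (h1.trans h2).symm
      · exact (h1.trans (h2.trans h3)).symm
      · exact (h1.trans (h2.trans (h3.trans h4))).symm
      · exact (h1.trans (h2.trans (h3.trans (h4.trans h5)))).symm
    rintro _ ⟨i, rfl⟩ _ ⟨j, rfl⟩
    rw [h0 i, h0 j]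
  have hw : s w = s (d 0) := hL s hconst E hE w h1 C hC _ (C.edge_vert hCxy.symm)
  have h01 : s (d 1) ≠ s (d 0) := by
    intro h
    have := hs _ _ (hd.adj 0)
    simp only [zero_add, f, true_or, if_true, h] at this
    rw [CharTwo.add_self_eq_zero] at this
    exact one_ne_zero this
  have hin : ∀ i j : Fin 6, (i = 1 ∨ i = 2 ∨ i = 3) → j = i + 1 → s (d i) = s (d j) := by
    intro i j hi hj
    have := hs (d i) (d j) (hj ▸ hd.adj i)
    rw [hinner i j hi hj] at this
    exact CharTwo.add_eq_zero.1 this.symm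
  have h12 := hin 1 2 (by decide) rfl
  have h23 := hin 2 3 (by decide) rfl
  have h34 := hin 3 4 (by decide) rfl
  obtain ⟨i, rfl⟩ := h2
  fin_cases i
  · exact Or.inr rfl
  · exact absurd hw h01
  · exact absurd (h12.trans hw) h01
  · exact absurd (h12.trans (h23.trans hw)) h01
  · exact absurd (h12.trans (h23.trans (h34.trans hw))) h01
  · exact Or.inl rfl

end HexSystem

/-! ### Degrees two and three -/

section Degree

variable {V : Type u} {G : SimpleGraph V}

theorem deg_eq_two_of_forall {z a b : V} (hab : a ≠ b)
    (h : ∀ w, G.Adj z w ↔ w = a ∨ w = b) : deg G z = 2 := by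
  have : G.neighborSet z = {a, b} := by ext w; exact h w
  rw [deg, this, Set.ncard_pair hab]

theorem deg_eq_three_of_forall {z a b c : V} (hab : a ≠ b) (hac : a ≠ c) (hbc : b ≠ c)
    (h : ∀ w, G.Adj z w ↔ w = a ∨ w = b ∨ w = c) : deg G z = 3 := by
  have : G.neighborSet z = {a, b, c} := by ext w; exact h w
  rw [deg, this, Set.ncard_insert_of_notMem (by simp [hab, hac]) (Set.toFinite _),
    Set.ncard_pair hbc]

theorem adj_iff_of_deg_eq_two {z a b : V} (hz : deg G z = 2) (ha : G.Adj z a) (hb : G.Adj z b)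
    (hab : a ≠ b) (w : V) : G.Adj z w ↔ w = a ∨ w = b := by
  have hfin : (G.neighborSet z).Finite := Set.finite_of_ncard_ne_zero (by rw [← deg, hz]; decide)
  have : ({a, b} : Set V) = G.neighborSet z := by
    apply Set.eq_of_subset_of_ncard_le _ _ hfin
    · rintro w (rfl | rfl)
      · exact ha
      · exact hb
    · rw [Set.ncard_pair hab, ← deg, hz]
  have h2 : w ∈ G.neighborSet z ↔ w ∈ ({a, b} : Set V) := by rw [this]
  exact h2

/-- A cycle through a vertex of degree two contains both edges at this vertex. -/
theorem Cyc.sub_adj_of_deg_eq_two {k : ℕ} [NeZero k] (hk : 3 ≤ k) {c : Fin k → V} (h : Cyc G c)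
    {z w : V} (hz : z ∈ h.sub.verts) (hdeg : deg G z = 2) (hw : G.Adj z w) : h.sub.Adj z w := by
  obtain ⟨i, rfl⟩ := hz
  have hne : c (i + 1) ≠ c (i - 1) := by
    apply h.inj.ne
    intro h'
    have h2 : (1 : Fin k) + 1 = 0 := by
      calc (1 : Fin k) + 1 = (i + 1) - (i - 1) := by abel
        _ = 0 := by rw [h', sub_self]
    have h3 := congrArg Fin.val h2
    rw [Fin.val_add, Fin.val_one', Fin.val_zero, Nat.mod_eq_of_lt (a := 1) (by omega),
      Nat.mod_eq_of_lt (by omega)] at h3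
    omega
  have h1 : G.Adj (c i) (c (i - 1)) := (h.sub_adj_apply.2 (Or.inr rfl)).adj_sub
  exact h.sub_adj_apply.2 ((adj_iff_of_deg_eq_two hdeg (h.adj i) h1 hne w).1 hw)

theorem deg_iso {W : Type v} {H : SimpleGraph W} (φ : G ≃g H) (z : V) : deg H (φ z) = deg G z := by
  have : H.neighborSet (φ z) = φ '' G.neighborSet z := by
    ext w
    constructor
    · intro h
      exact ⟨φ.symm w, by simpa [mem_neighborSet, ← φ.map_adj_iff] using h, by simp⟩
    · rintro ⟨a, ha, rfl⟩
      exact φ.map_adj_iff.2 ha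
  rw [deg, this, Set.ncard_image_of_injective _ φ.injective, deg]

end Degree

/-! ### Attaching a path: degrees and short cycles -/

section AttachPath

variable {V : Type u} {G : SimpleGraph V} {n : ℕ} {x y : V}

theorem attachPath_inl_inl {a b : V} :
    (attachPath n G x y).Adj (.inl a) (.inl b) ↔ G.Adj a b := Iff.rfl

theorem attachPath_inl_inr {a : V} {j : Fin n} :
    (attachPath n G x y).Adj (.inl a) (.inr j) ↔ (a = x ∧ j.val = 0) ∨ (a = y ∧ j.val + 1 = n) :=
  Iff.rfl

theorem attachPath_inr_inl {b : V} {i : Fin n} :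
    (attachPath n G x y).Adj (.inr i) (.inl b) ↔ (b = x ∧ i.val = 0) ∨ (b = y ∧ i.val + 1 = n) :=
  Iff.rfl

theorem attachPath_inr_inr {i j : Fin n} :
    (attachPath n G x y).Adj (.inr i) (.inr j) ↔ i.val + 1 = j.val ∨ j.val + 1 = i.val :=
  Iff.rfl

/-- A graph that consists of a copy of `G` and a new path is isomorphic to `attachPath n G x y`. -/
def attachPathIso {W : Type v} {H : SimpleGraph W} (e : V ⊕ Fin n ≃ W)
    (h1 : ∀ a b, H.Adj (e (.inl a)) (e (.inl b)) ↔ G.Adj a b)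
    (h2 : ∀ a j, H.Adj (e (.inl a)) (e (.inr j)) ↔
      (a = x ∧ j.val = 0) ∨ (a = y ∧ j.val + 1 = n))
    (h3 : ∀ i j, H.Adj (e (.inr i)) (e (.inr j)) ↔ i.val + 1 = j.val ∨ j.val + 1 = i.val) :
    attachPath n G x y ≃g H where
  toEquiv := e
  map_rel_iff' := by
    rintro (a | i) (b | j)
    · exact h1 a b
    · exact h2 a j
    · rw [adj_comm]; exact h2 b i
    · exact h3 i j

/-- Attaching a path is compatible with isomorphisms. -/
def attachPathCongr {W : Type v} {H : SimpleGraph W} (φ : G ≃g H) (n : ℕ) (x y : V) :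
    attachPath n G x y ≃g attachPath n H (φ x) (φ y) :=
  attachPathIso (Equiv.sumCongr φ.toEquiv (Equiv.refl _)) (fun _ _ => φ.map_adj_iff)
    (fun a j => by
      show (φ a = φ x ∧ _) ∨ (φ a = φ y ∧ _) ↔ _
      rw [φ.injective.eq_iff, φ.injective.eq_iff]; rfl)
    (fun i j => Iff.rfl)

theorem attachPathIncl_injective : Function.Injective (attachPathIncl n G x y) := Sum.inl_injective

theorem deg_attachPath_inl [Finite V] (z : V) : deg (attachPath n G x y) (.inl z) = deg G z +
    {j : Fin n | (z = x ∧ j.val = 0) ∨ (z = y ∧ j.val + 1 = n)}.ncard := by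
  have : (attachPath n G x y).neighborSet (.inl z) = Sum.inl '' G.neighborSet z ∪
      Sum.inr '' {j : Fin n | (z = x ∧ j.val = 0) ∨ (z = y ∧ j.val + 1 = n)} := by
    ext (w | j)
    · simp [attachPath_inl_inl]
    · simp [attachPath_inl_inr]
  rw [deg, this, Set.ncard_union_eq ?_ (Set.toFinite _) (Set.toFinite _),
    Set.ncard_image_of_injective _ Sum.inl_injective,
    Set.ncard_image_of_injective _ Sum.inr_injective, deg]
  rw [Set.disjoint_left]
  rintro _ ⟨a, -, rfl⟩ ⟨b, -, h⟩
  cases h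

theorem deg_attachPath_of_ne [Finite V] {z : V} (hx : z ≠ x) (hy : z ≠ y) :
    deg (attachPath n G x y) (.inl z) = deg G z := by
  rw [deg_attachPath_inl]
  simp [hx, hy]

theorem deg_attachPath_left [Finite V] [NeZero n] (hxy : x ≠ y) :
    deg (attachPath n G x y) (.inl x) = deg G x + 1 := by
  rw [deg_attachPath_inl]
  have : {j : Fin n | (x = x ∧ j.val = 0) ∨ (x = y ∧ j.val + 1 = n)} = {0} := by
    ext j
    simp only [hxy, false_and, true_and, or_false, Set.mem_ofPred_eq, Set.mem_singleton_iff,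
      Fin.ext_iff, Fin.val_zero]
  rw [this, Set.ncard_singleton]

theorem deg_attachPath_right [Finite V] [NeZero n] (hxy : x ≠ y) :
    deg (attachPath n G x y) (.inl y) = deg G y + 1 := by
  rw [deg_attachPath_inl]
  have hn : n ≠ 0 := NeZero.ne n
  have : {j : Fin n | (y = x ∧ j.val = 0) ∨ (y = y ∧ j.val + 1 = n)} = {⟨n - 1, by omega⟩} := by
    ext j
    simp only [hxy.symm, false_and, true_and, false_or, Set.mem_ofPred_eq, Set.mem_singleton_iff,
      Fin.ext_iff]
    omega
  rw [this, Set.ncard_singleton]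

theorem deg_attachPath_inr (hxy : x ≠ y) (j : Fin n) :
    deg (attachPath n G x y) (.inr j) = 2 := by
  by_cases h0 : j.val = 0 <;> by_cases h1 : j.val + 1 = n
  · apply deg_eq_two_of_forall (a := .inl x) (b := .inl y) (by simpa using hxy)
    rintro (a | i)
    · simp [attachPath_inr_inl, h0, ← h1]
    · simp [attachPath_inr_inr]; omega
  · apply deg_eq_two_of_forall (a := .inl x) (b := .inr ⟨j.val + 1, by omega⟩) (by simp)
    rintro (a | i)
    · simp only [attachPath_inr_inl, h1, and_false, or_false, Sum.inl.injEq, reduceCtorEq]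
      exact and_iff_left h0
    · simp [attachPath_inr_inr, Fin.ext_iff]; omega
  · apply deg_eq_two_of_forall (a := .inl y) (b := .inr ⟨j.val - 1, by omega⟩) (by simp)
    rintro (a | i)
    · simp [attachPath_inr_inl, h0, h1]
    · simp [attachPath_inr_inr, Fin.ext_iff]; omega
  · apply deg_eq_two_of_forall (a := .inr ⟨j.val - 1, by omega⟩)
      (b := .inr ⟨j.val + 1, by omega⟩)
      (by rw [Ne, Sum.inr.injEq, Fin.mk.injEq]; omega)
    rintro (a | i)
    · simp [attachPath_inr_inl, h0, h1]
    · simp [attachPath_inr_inr, Fin.ext_iff]; omega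

/-- A labelled cycle that stays in the old part comes from a cycle of the old graph. -/
theorem Cyc.exists_eq_inl {k : ℕ} [NeZero k] {c : Fin k → V ⊕ Fin n}
    (h : Cyc (attachPath n G x y) c) (hc : ∀ i j, c i ≠ .inr j) :
    ∃ d : Fin k → V, Cyc G d ∧ c = fun i => .inl (d i) := by
  have : ∀ i, ∃ a, c i = .inl a := by
    intro i
    rcases hi : c i with a | j
    · exact ⟨a, rfl⟩
    · exact absurd hi (hc i j)
  choose d hd using this
  refine ⟨d, ⟨?_, ?_⟩, funext hd⟩
  · intro i j hij
    apply h.inj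
    rw [hd, hd, hij]
  · intro i
    have := h.adj i
    rwa [hd, hd] at this

theorem Cyc.exists_eq_map_of_inl {k : ℕ} [NeZero k] {c : Fin k → V ⊕ Fin n}
    (h : Cyc (attachPath n G x y) c) (hc : ∀ i j, c i ≠ .inr j) :
    ∃ (d : Fin k → V) (hd : Cyc G d), h.sub = hd.sub.map (attachPathIncl n G x y) := by
  obtain ⟨d, hd, rfl⟩ := h.exists_eq_inl hc
  exact ⟨d, hd, hd.sub_map _ attachPathIncl_injective⟩

/-- The inner vertices of the new path have degree two, so a cycle through one of them traverses the
whole path. The labelling puts the path at positions 0, ..., n - 1, with `x` just before and `y`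
just after; multiples of 1 express positions modulo k. -/
theorem Cyc.exists_path_of_inr {k : ℕ} [NeZero k] (hk : 3 ≤ k) (hn : 2 ≤ n)
    {c : Fin k → V ⊕ Fin n} (h : Cyc (attachPath n G x y) c) (hxy : x ≠ y) {i : Fin k} {j : Fin n}
    (hij : c i = .inr j) :
    ∃ (d : Fin k → V ⊕ Fin n) (hd : Cyc (attachPath n G x y) d), hd.sub = h.sub ∧
      d (-1) = .inl x ∧ (∀ (m : ℕ) (hm : m < n), d (m • 1) = .inr ⟨m, hm⟩) ∧ d (n • 1) = .inl y := by
  -- The cycle is followed back along the path from `j` to its first inner vertex.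
  have hmem : ∀ m (hm : m ≤ j.val), (.inr ⟨j.val - m, by omega⟩ : V ⊕ Fin n) ∈ h.sub.verts := by
    intro m
    induction m with
    | zero => intro _; exact ⟨i, hij⟩
    | succ m ih =>
      intro hm
      have := h.sub_adj_of_deg_eq_two hk (ih (by omega)) (deg_attachPath_inr hxy _)
        (w := .inr ⟨j.val - (m + 1), by omega⟩) (by rw [attachPath_inr_inr]; right; simp; omega)
      exact h.sub.edge_vert this.symm
  have h0 : (.inr ⟨0, by omega⟩ : V ⊕ Fin n) ∈ h.sub.verts := by simpa using hmem j.val le_rfl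
  have h01 := h.sub_adj_of_deg_eq_two hk h0 (deg_attachPath_inr hxy _) (w := .inr ⟨1, by omega⟩)
    (by rw [attachPath_inr_inr]; left; rfl)
  obtain ⟨d, hd, hsub, hd0, hd1⟩ := h.exists_relabel h01 0
  refine ⟨d, hd, hsub, ?_, ?_⟩
  · have := hd.sub_adj_of_deg_eq_two hk ⟨0, hd0⟩ (deg_attachPath_inr hxy _) (w := .inl x)
      (by rw [attachPath_inr_inl]; left; exact ⟨rfl, rfl⟩)
    rw [← hd0, hd.sub_adj_apply, hd1] at this
    rcases this with h | h
    · cases h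
    · rw [h, zero_sub]
  have hpath : ∀ (m : ℕ) (hm : m + 1 < n), d (m • 1) = .inr ⟨m, by omega⟩ ∧
      d ((m + 1) • 1) = .inr ⟨m + 1, hm⟩ := by
    intro m
    induction m with
    | zero => intro hm; exact ⟨by simpa using hd0, by simpa using hd1⟩
    | succ m ih =>
      intro hm
      obtain ⟨h1, h2⟩ := ih (by omega)
      refine ⟨h2, ?_⟩
      have := hd.sub_adj_of_deg_eq_two hk ⟨_, h2⟩ (deg_attachPath_inr hxy _)
        (w := .inr ⟨m + 1 + 1, hm⟩) (by rw [attachPath_inr_inr]; left; rfl)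
      rw [← h2, hd.sub_adj_apply] at this
      rcases this with h | h
      · rw [h, ← succ_nsmul]
      · have e : (m + 1) • (1 : Fin k) - 1 = m • 1 := by rw [succ_nsmul, add_sub_cancel_right]
        rw [e, h1, Sum.inr.injEq, Fin.mk.injEq] at h
        omega
  constructor
  · intro m hm
    by_cases hm' : m + 1 < n
    · exact (hpath m hm').1
    · obtain ⟨m, rfl⟩ : ∃ m', m = m' + 1 := ⟨m - 1, by omega⟩
      exact (hpath m (by omega)).2
  · obtain ⟨m, rfl⟩ : ∃ m', n = m' + 2 := ⟨n - 2, by omega⟩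
    obtain ⟨h1, h2⟩ := hpath m (by omega)
    have := hd.sub_adj_of_deg_eq_two hk ⟨_, h2⟩ (deg_attachPath_inr hxy _)
        (w := .inl y) (by rw [attachPath_inr_inl]; right; exact ⟨rfl, rfl⟩)
    rw [← h2, hd.sub_adj_apply] at this
    rcases this with h | h
    · rw [h, ← succ_nsmul]
    · have e : (m + 1) • (1 : Fin k) - 1 = m • 1 := by rw [succ_nsmul, add_sub_cancel_right]
      rw [e, h1] at h
      simp at h

theorem cyc_attachPath_four (hxy : G.Adj x y) :
    Cyc (attachPath 4 G x y) ![.inr 0, .inr 1, .inr 2, .inr 3, .inl y, .inl x] := by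
  constructor
  · intro i j
    have := hxy.ne
    fin_cases i <;> fin_cases j <;> simp [this, this.symm]
  · intro i
    fin_cases i
    · exact Or.inl rfl
    · exact Or.inl rfl
    · exact Or.inl rfl
    · exact Or.inr ⟨rfl, rfl⟩
    · exact hxy.symm
    · exact Or.inl ⟨rfl, rfl⟩

theorem cyc_attachPath_two (hxy : G.Adj x y) :
    Cyc (attachPath 2 G x y) ![.inr 0, .inr 1, .inl y, .inl x] := by
  constructor
  · intro i j
    have := hxy.ne
    fin_cases i <;> fin_cases j <;> simp [this, this.symm]
  · intro i
    fin_cases i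
    · exact Or.inl rfl
    · exact Or.inr ⟨rfl, rfl⟩
    · exact hxy.symm
    · exact Or.inl ⟨rfl, rfl⟩

theorem isCycle_map {k : ℕ} {W : Type v} {H : SimpleGraph W} (f : G →g H)
    (hf : Function.Injective f) {C : G.Subgraph} (hC : IsCycleOfLength G k C) :
    IsCycleOfLength H k (C.map f) := by
  obtain ⟨x, w, hw, hk, rfl⟩ := hC
  exact ⟨f x, w.map f, hw.map hf, by simpa using hk, by rw [Walk.toSubgraph_map]⟩

/-- A 6-cycle using the new path consists of its four inner vertices and `x`, `y`; no freedom is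
left. -/
theorem isCycleOfLength_six_attachPath_four (hxy : G.Adj x y)
    {C : (attachPath 4 G x y).Subgraph} : IsCycleOfLength (attachPath 4 G x y) 6 C ↔
      (∃ D, IsCycleOfLength G 6 D ∧ C = D.map (attachPathIncl 4 G x y)) ∨
        C = (cyc_attachPath_four hxy).sub := by
  constructor
  · intro hC
    obtain ⟨c, h, rfl⟩ := hC.exists_cyc
    by_cases hc : ∀ i j, c i ≠ .inr j
    · obtain ⟨d, hd, e⟩ := h.exists_eq_map_of_inl hc
      exact Or.inl ⟨_, hd.isCycleOfLength_six, e⟩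
    · push Not at hc
      obtain ⟨i, j, hij⟩ := hc
      obtain ⟨d, hd, hsub, h1, h2, h3⟩ := h.exists_path_of_inr (by decide) (by decide) hxy.ne hij
      right
      rw [← hsub]
      have : d = ![.inr 0, .inr 1, .inr 2, .inr 3, .inl y, .inl x] := by
        funext i
        fin_cases i
        · exact h2 0 (by decide)
        · exact h2 1 (by decide)
        · exact h2 2 (by decide)
        · exact h2 3 (by decide)
        · exact h3
        · exact h1
      subst this
      rfl
  · rintro (⟨D, hD, rfl⟩ | rfl)
    · exact isCycle_map _ attachPathIncl_injective hD
    · exact Cyc.isCycleOfLength_six _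

theorem isCycleOfLength_four_attachPath_four (hxy : G.Adj x y)
    {C : (attachPath 4 G x y).Subgraph} : IsCycleOfLength (attachPath 4 G x y) 4 C ↔
      ∃ D, IsCycleOfLength G 4 D ∧ C = D.map (attachPathIncl 4 G x y) := by
  constructor
  · intro hC
    obtain ⟨c, h, rfl⟩ := hC.exists_cyc
    by_cases hc : ∀ i j, c i ≠ .inr j
    · obtain ⟨d, hd, e⟩ := h.exists_eq_map_of_inl hc
      exact ⟨_, hd.isCycleOfLength_four, e⟩
    · push Not at hc
      obtain ⟨i, j, hij⟩ := hc
      obtain ⟨d, hd, hsub, h1, h2, h3⟩ := h.exists_path_of_inr (by decide) (by decide) hxy.ne hij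
      have := h2 3 (by decide)
      -- In a 4-cycle the last of four inner vertices would occupy the position of `x`.
      have e : 3 • (1 : Fin 4) = -1 := rfl
      rw [e, h1] at this
      cases this
  · rintro ⟨D, hD, rfl⟩
    exact isCycle_map _ attachPathIncl_injective hD

theorem isCycleOfLength_four_attachPath_two (hxy : G.Adj x y)
    {C : (attachPath 2 G x y).Subgraph} : IsCycleOfLength (attachPath 2 G x y) 4 C ↔
      (∃ D, IsCycleOfLength G 4 D ∧ C = D.map (attachPathIncl 2 G x y)) ∨
        C = (cyc_attachPath_two hxy).sub := by
  constructor
  · intro hC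
    obtain ⟨c, h, rfl⟩ := hC.exists_cyc
    by_cases hc : ∀ i j, c i ≠ .inr j
    · obtain ⟨d, hd, e⟩ := h.exists_eq_map_of_inl hc
      exact Or.inl ⟨_, hd.isCycleOfLength_four, e⟩
    · push Not at hc
      obtain ⟨i, j, hij⟩ := hc
      obtain ⟨d, hd, hsub, h1, h2, h3⟩ := h.exists_path_of_inr (by decide) (by decide) hxy.ne hij
      right
      rw [← hsub]
      have : d = ![.inr 0, .inr 1, .inl y, .inl x] := by
        funext i
        fin_cases i
        · exact h2 0 (by decide)
        · exact h2 1 (by decide)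
        · exact h3
        · exact h1
      subst this
      rfl
  · rintro (⟨D, hD, rfl⟩ | rfl)
    · exact isCycle_map _ attachPathIncl_injective hD
    · exact Cyc.isCycleOfLength_four _

/-- A 6-cycle through the new vertices of a quadrilateral would close up through an old path of
length three from `x` to `y` avoiding the edge `x y`; `hno` excludes it. -/
theorem isCycleOfLength_six_attachPath_two (hxy : G.Adj x y)
    (hno : ∀ a b, G.Adj x a → G.Adj a b → G.Adj b y → a = y ∨ b = x)
    {C : (attachPath 2 G x y).Subgraph} : IsCycleOfLength (attachPath 2 G x y) 6 C ↔
      ∃ D, IsCycleOfLength G 6 D ∧ C = D.map (attachPathIncl 2 G x y) := by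
  constructor
  · intro hC
    obtain ⟨c, h, rfl⟩ := hC.exists_cyc
    by_cases hc : ∀ i j, c i ≠ .inr j
    · obtain ⟨d, hd, e⟩ := h.exists_eq_map_of_inl hc
      exact ⟨_, hd.isCycleOfLength_six, e⟩
    · push Not at hc
      obtain ⟨i, j, hij⟩ := hc
      obtain ⟨d, hd, hsub, h1, h2, h3⟩ := h.exists_path_of_inr (by decide) (by decide) hxy.ne hij
      have h5 : d 5 = .inl x := h1
      have h2' : d 2 = .inl y := h3
      have h00 : d 0 = .inr 0 := h2 0 (by decide)
      have h11 : d 1 = .inr 1 := h2 1 (by decide)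
      have hold : ∀ i : Fin 6, i ≠ 0 → i ≠ 1 → ∃ a, d i = .inl a := by
        intro i hi0 hi1
        rcases hi : d i with a | j
        · exact ⟨a, rfl⟩
        · exfalso
          fin_cases j
          · exact hi0 (hd.inj (hi.trans h00.symm))
          · exact hi1 (hd.inj (hi.trans h11.symm))
      obtain ⟨a, ha⟩ := hold 4 (by decide) (by decide)
      obtain ⟨b, hb⟩ := hold 3 (by decide) (by decide)
      have e1 := hd.adj 4
      have e2 := hd.adj 3
      have e3 := hd.adj 2
      simp only [Fin.reduceAdd, h5, ha, hb, h2', attachPath_inl_inl] at e1 e2 e3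
      rcases hno a b e1.symm e2.symm e3.symm with rfl | rfl
      · exact absurd (hd.inj (ha.trans h2'.symm)) (by decide)
      · exact absurd (hd.inj (hb.trans h5.symm)) (by decide)
  · rintro ⟨D, hD, rfl⟩
    exact isCycle_map _ attachPathIncl_injective hD

end AttachPath

/-! ### Images of subgraphs under injective homomorphisms -/

theorem edgeSet_inter_nonempty {V : Type u} {G : SimpleGraph V} {C D : G.Subgraph} :
    (C.edgeSet ∩ D.edgeSet).Nonempty ↔ ∃ a b, C.Adj a b ∧ D.Adj a b := by
  constructor
  · rintro ⟨e, h1, h2⟩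
    induction e with
    | _ a b => exact ⟨a, b, h1, h2⟩
  · rintro ⟨a, b, h1, h2⟩
    exact ⟨s(a, b), h1, h2⟩

section Map

variable {V : Type u} {W : Type v} {G : SimpleGraph V} {H : SimpleGraph W} (f : G →g H)
  (hf : Function.Injective f)
include hf

theorem map_adj_apply {C : G.Subgraph} {a b : V} : (C.map f).Adj (f a) (f b) ↔ C.Adj a b := by
  rw [Subgraph.map_adj]
  constructor
  · rintro ⟨a', b', h, h1, h2⟩
    rwa [hf h1, hf h2] at h
  · intro h; exact ⟨a, b, h, rfl, rfl⟩

theorem mem_map_verts {C : G.Subgraph} {a : V} : f a ∈ (C.map f).verts ↔ a ∈ C.verts := by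
  rw [Subgraph.map_verts]
  exact hf.mem_set_image

theorem subgraph_map_injective : Function.Injective (Subgraph.map f) := by
  intro C D h
  ext a b
  · rw [← mem_map_verts f hf, h, mem_map_verts f hf]
  · rw [← map_adj_apply f hf, h, map_adj_apply f hf]

theorem map_common_edge {C D : G.Subgraph} :
    (∃ a b, (C.map f).Adj a b ∧ (D.map f).Adj a b) ↔ ∃ a b, C.Adj a b ∧ D.Adj a b := by
  constructor
  · rintro ⟨_, _, ⟨a, b, h, rfl, rfl⟩, h2⟩
    exact ⟨a, b, h, (map_adj_apply f hf).1 h2⟩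
  · rintro ⟨a, b, h1, h2⟩
    exact ⟨f a, f b, (map_adj_apply f hf).2 h1, (map_adj_apply f hf).2 h2⟩

end Map

/-! ### Invariants preserved by attaching a face -/

/-- The properties of catacondensed benzenoid graphs and phenylenes which are preserved when a
new face is attached along an edge with both ends of degree two. -/
structure Nice {V : Type u} (G : SimpleGraph V) : Prop where
  finite : Finite V
  deg_eq : ∀ z, deg G z = 2 ∨ deg G z = 3
  unique_face : ∀ z C D, IsInnerFace G C → IsInnerFace G D → z ∈ C.verts → z ∈ D.verts →
    deg G z = 2 → C = D
  two_mul_numAdjacentFaces : ∀ C, IsInnerFace G C →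
    2 * numAdjacentFaces G C = {z | z ∈ C.verts ∧ deg G z = 3}.ncard
  exists_deg_three : ∀ C, IsInnerFace G C → ∀ z ∈ C.verts, deg G z = 3 →
    ∃ w, C.Adj z w ∧ deg G w = 3
  no_chord : ∀ c : Fin 6 → V, Cyc G c → ¬ G.Adj (c 0) (c 3)

theorem numAdjacentFaces_eq {V : Type u} {G : SimpleGraph V} {C : G.Subgraph} :
    numAdjacentFaces G C =
      {D : G.Subgraph | IsInnerFace G D ∧ D ≠ C ∧ ∃ a b, C.Adj a b ∧ D.Adj a b}.ncard := by
  simp only [numAdjacentFaces, edgeSet_inter_nonempty]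

section Attach

variable {V : Type u} {G : SimpleGraph V} {n : ℕ} [NeZero n] {x y : V}

/-- `N` is the face of `attachPath n G x y` that does not come from `G`. -/
structure IsNewFace (n : ℕ) [NeZero n] (G : SimpleGraph V) (x y : V)
    (N : (attachPath n G x y).Subgraph) : Prop where
  adj : G.Adj x y
  face_iff : ∀ C, IsInnerFace (attachPath n G x y) C ↔
    (∃ D, IsInnerFace G D ∧ C = D.map (attachPathIncl n G x y)) ∨ C = N
  inl_mem : ∀ z, .inl z ∈ N.verts ↔ z = x ∨ z = y
  inr_mem : ∀ j, .inr j ∈ N.verts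
  new_adj : N.Adj (.inl x) (.inl y)
  no_chord : ∀ c : Fin 6 → V ⊕ Fin n, Cyc (attachPath n G x y) c →
    (∃ d, Cyc G d ∧ c = fun i => .inl (d i)) ∨ ¬ (attachPath n G x y).Adj (c 0) (c 3)

theorem IsNewFace.inl_inl {N : (attachPath n G x y).Subgraph} (hN : IsNewFace n G x y N)
    {a b : V} (h : N.Adj (.inl a) (.inl b)) : a = x ∧ b = y ∨ a = y ∧ b = x := by
  have h1 := (hN.inl_mem a).1 (N.edge_vert h)
  have h2 := (hN.inl_mem b).1 (N.edge_vert h.symm)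
  have h3 : a ≠ b := fun e => h.ne (by rw [e])
  rcases h1 with rfl | rfl <;> rcases h2 with rfl | rfl <;> tauto

theorem IsNewFace.ne_map {N : (attachPath n G x y).Subgraph} (hN : IsNewFace n G x y N)
    (C : G.Subgraph) : N ≠ C.map (attachPathIncl n G x y) := by
  intro h
  have h1 := hN.inr_mem 0
  rw [h, Subgraph.map_verts] at h1
  obtain ⟨a, -, h2⟩ := h1
  cases h2

theorem IsNewFace.face {N : (attachPath n G x y).Subgraph} (hN : IsNewFace n G x y N) :
    IsInnerFace (attachPath n G x y) N := (hN.face_iff N).2 (Or.inr rfl)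

theorem deg_attachPath_inl_eq_three [Finite V] (hxy : x ≠ y) (hx : deg G x = 2) (hy : deg G y = 2)
    {z : V} : deg (attachPath n G x y) (.inl z) = 3 ↔ deg G z = 3 ∨ z = x ∨ z = y := by
  by_cases h1 : z = x
  · subst h1
    rw [deg_attachPath_left hxy]; simp [hx]
  by_cases h2 : z = y
  · subst h2
    rw [deg_attachPath_right hxy]; simp [hy]
  rw [deg_attachPath_of_ne h1 h2]; simp [h1, h2]

/-- Since `x` and `y` have degree two, `C₀` is the only old face containing either. Attaching raises
exactly these two degrees to three and gives `C₀` exactly one new adjacent face, so twice the number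
of adjacent faces and the number of vertices of degree three grow together; every other old face is
unaffected. -/
theorem IsNewFace.nice {N : (attachPath n G x y).Subgraph} (hN : IsNewFace n G x y N)
    (hG : Nice G) (hx : deg G x = 2) (hy : deg G y = 2) {C₀ : G.Subgraph}
    (hC₀ : IsInnerFace G C₀) (hxy : C₀.Adj x y) : Nice (attachPath n G x y) := by
  have hfin := hG.finite
  have hne := hN.adj.ne
  have hinj : Function.Injective (attachPathIncl n G x y) := attachPathIncl_injective
  have hxC : x ∈ C₀.verts := C₀.edge_vert hxy
  have hyC : y ∈ C₀.verts := C₀.edge_vert hxy.symm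
  have huniq : ∀ D, IsInnerFace G D → x ∈ D.verts ∨ y ∈ D.verts → D = C₀ := by
    rintro D hD (h | h)
    · exact hG.unique_face x D C₀ hD hC₀ h hxC hx
    · exact hG.unique_face y D C₀ hD hC₀ h hyC hy
  have hdeg3 : ∀ z, deg (attachPath n G x y) (.inl z) = 3 ↔ deg G z = 3 ∨ z = x ∨ z = y :=
    fun z => deg_attachPath_inl_eq_three hne hx hy
  have hinr : ∀ j, deg (attachPath n G x y) (.inr j) ≠ 3 := fun j => by
    rw [deg_attachPath_inr hne]; decide
  refine ⟨inferInstance, ?_, ?_, ?_, ?_, ?_⟩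
  · rintro (z | j)
    · by_cases h1 : z = x
      · right; rw [hdeg3]; tauto
      · by_cases h2 : z = y
        · right; rw [hdeg3]; tauto
        · rw [deg_attachPath_of_ne h1 h2]; exact hG.deg_eq z
    · left; exact deg_attachPath_inr hne j
  · intro z C D hC hD hzC hzD hz
    rcases (hN.face_iff C).1 hC with ⟨C, hC', rfl⟩ | rfl <;>
      rcases (hN.face_iff D).1 hD with ⟨D, hD', rfl⟩ | rfl
    · obtain ⟨a, haC, rfl⟩ := hzC
      have haD := (mem_map_verts _ hinj).1 hzD
      rw [hG.unique_face a C D hC' hD' haC haD]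
      have h3 := hdeg3 a
      have hz' : deg (attachPath n G x y) (.inl a) = 2 := hz
      rw [hz'] at h3
      rcases hG.deg_eq a with h | h
      · exact h
      · exact absurd (h3.2 (Or.inl h)) (by decide)
    · obtain ⟨a, haC, rfl⟩ := hzC
      have h3 := (hdeg3 a).2 (Or.inr ((hN.inl_mem a).1 hzD))
      have hz' : deg (attachPath n G x y) (.inl a) = 2 := hz
      omega
    · obtain ⟨a, haC, rfl⟩ := hzD
      have h3 := (hdeg3 a).2 (Or.inr ((hN.inl_mem a).1 hzC))
      have hz' : deg (attachPath n G x y) (.inl a) = 2 := hz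
      omega
    · rfl
  · intro C hC
    rw [numAdjacentFaces_eq]
    rcases (hN.face_iff C).1 hC with ⟨C, hC', rfl⟩ | rfl
    · have hcount := hG.two_mul_numAdjacentFaces C hC'
      rw [numAdjacentFaces_eq] at hcount
      have hR : {z | z ∈ (C.map (attachPathIncl n G x y)).verts ∧
          deg (attachPath n G x y) z = 3} =
          attachPathIncl n G x y '' {z | z ∈ C.verts ∧ (deg G z = 3 ∨ z = x ∨ z = y)} := by
        ext z
        constructor
        · rintro ⟨⟨a, ha, rfl⟩, h⟩
          exact ⟨a, ⟨ha, (hdeg3 a).1 h⟩, rfl⟩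
        · rintro ⟨a, ⟨ha, h⟩, rfl⟩
          exact ⟨⟨a, ha, rfl⟩, (hdeg3 a).2 h⟩
      rw [hR, Set.ncard_image_of_injective _ hinj]
      -- Only for `C₀` does the new face `N` join the adjacent faces, along with two new vertices of
      -- degree three.
      by_cases hCC : C = C₀
      · have hL : {D | IsInnerFace (attachPath n G x y) D ∧
            D ≠ C.map (attachPathIncl n G x y) ∧
            ∃ a b, (C.map (attachPathIncl n G x y)).Adj a b ∧ D.Adj a b} =
            insert N (Subgraph.map (attachPathIncl n G x y) ''
              {D | IsInnerFace G D ∧ D ≠ C ∧ ∃ a b, C.Adj a b ∧ D.Adj a b}) := by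
          ext D
          constructor
          · rintro ⟨h1, h2, h3⟩
            rcases (hN.face_iff D).1 h1 with ⟨D, hD, rfl⟩ | rfl
            · exact Or.inr ⟨D, ⟨hD, fun e => h2 (by rw [e]), (map_common_edge _ hinj).1 h3⟩, rfl⟩
            · exact Or.inl rfl
          · rintro (rfl | ⟨D, ⟨hD, h1, h2⟩, rfl⟩)
            · exact ⟨hN.face, hN.ne_map _, _, _,
                (map_adj_apply _ hinj).2 (hCC ▸ hxy), hN.new_adj⟩
            · exact ⟨(hN.face_iff _).2 (Or.inl ⟨D, hD, rfl⟩),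
                fun e => h1 (subgraph_map_injective _ hinj e), (map_common_edge _ hinj).2 h2⟩
        have hnot : N ∉ (Subgraph.map (attachPathIncl n G x y) ''
              {D | IsInnerFace G D ∧ D ≠ C ∧ ∃ a b, C.Adj a b ∧ D.Adj a b}) := by
          rintro ⟨D, -, h⟩
          exact hN.ne_map D h.symm
        rw [hL, Set.ncard_insert_of_notMem hnot (Set.toFinite _),
          Set.ncard_image_of_injective _ (subgraph_map_injective _ hinj)]
        have hset : {z | z ∈ C.verts ∧ (deg G z = 3 ∨ z = x ∨ z = y)} =
            insert x (insert y {z | z ∈ C.verts ∧ deg G z = 3}) := by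
          ext z
          simp only [Set.mem_ofPred_eq, Set.mem_insert_iff]
          constructor
          · tauto
          · rintro (rfl | rfl | h)
            · exact ⟨hCC ▸ hxC, by tauto⟩
            · exact ⟨hCC ▸ hyC, by tauto⟩
            · tauto
        rw [hset, Set.ncard_insert_of_notMem _ (Set.toFinite _),
          Set.ncard_insert_of_notMem _ (Set.toFinite _)]
        · omega
        · rintro ⟨-, h⟩; omega
        · rintro (h | ⟨-, h⟩)
          · exact hne h
          · omega
      · have hxn : x ∉ C.verts := fun h => hCC (huniq C hC' (Or.inl h))
        have hyn : y ∉ C.verts := fun h => hCC (huniq C hC' (Or.inr h))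
        have hL : {D | IsInnerFace (attachPath n G x y) D ∧
            D ≠ C.map (attachPathIncl n G x y) ∧
            ∃ a b, (C.map (attachPathIncl n G x y)).Adj a b ∧ D.Adj a b} =
            Subgraph.map (attachPathIncl n G x y) ''
              {D | IsInnerFace G D ∧ D ≠ C ∧ ∃ a b, C.Adj a b ∧ D.Adj a b} := by
          ext D
          constructor
          · rintro ⟨h1, h2, h3⟩
            rcases (hN.face_iff D).1 h1 with ⟨D, hD, rfl⟩ | rfl
            · exact ⟨D, ⟨hD, fun e => h2 (by rw [e]), (map_common_edge _ hinj).1 h3⟩, rfl⟩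
            · obtain ⟨_, _, ⟨a, b, h4, rfl, rfl⟩, h5⟩ := h3
              exfalso
              rcases hN.inl_inl h5 with ⟨rfl, rfl⟩ | ⟨rfl, rfl⟩
              · exact hxn (C.edge_vert h4)
              · exact hyn (C.edge_vert h4)
          · rintro ⟨D, ⟨hD, h1, h2⟩, rfl⟩
            exact ⟨(hN.face_iff _).2 (Or.inl ⟨D, hD, rfl⟩),
                fun e => h1 (subgraph_map_injective _ hinj e), (map_common_edge _ hinj).2 h2⟩
        rw [hL, Set.ncard_image_of_injective _ (subgraph_map_injective _ hinj), hcount]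
        congr 1
        ext z
        simp only [Set.mem_ofPred_eq]
        constructor
        · tauto
        · rintro ⟨h1, h | rfl | rfl⟩
          · exact ⟨h1, h⟩
          · exact absurd h1 hxn
          · exact absurd h1 hyn
    -- For the new face itself: it is adjacent to `C₀` alone, and its vertices of degree three are
    -- `x` and `y`.
    · have hL : {D | IsInnerFace (attachPath n G x y) D ∧ D ≠ C ∧ ∃ a b, C.Adj a b ∧ D.Adj a b} =
          {C₀.map (attachPathIncl n G x y)} := by
        ext D
        constructor
        · rintro ⟨h1, h2, a, b, h3, h4⟩
          rcases (hN.face_iff D).1 h1 with ⟨D, hD, rfl⟩ | rfl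
          · obtain ⟨a, b, h5, rfl, rfl⟩ := h4
            rw [Set.mem_singleton_iff, huniq D hD]
            rcases hN.inl_inl h3 with ⟨rfl, rfl⟩ | ⟨rfl, rfl⟩
            · exact Or.inl (D.edge_vert h5)
            · exact Or.inr (D.edge_vert h5)
          · exact absurd rfl h2
        · rintro rfl
          exact ⟨(hN.face_iff _).2 (Or.inl ⟨C₀, hC₀, rfl⟩), (hN.ne_map _).symm, _, _, hN.new_adj,
            (map_adj_apply _ hinj).2 hxy⟩
      have hR : {z | z ∈ C.verts ∧ deg (attachPath n G x y) z = 3} = {.inl x, .inl y} := by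
        ext (z | j)
        · simp only [Set.mem_ofPred_eq, hN.inl_mem, hdeg3, Set.mem_insert_iff, Sum.inl.injEq,
            Set.mem_singleton_iff]
          tauto
        · simp [hinr]
      rw [hL, hR, Set.ncard_singleton, Set.ncard_pair (by simpa using hne)]
  · intro C hC z hzC hz
    rcases (hN.face_iff C).1 hC with ⟨C, hC', rfl⟩ | rfl
    · obtain ⟨z, hzC, rfl⟩ := hzC
      rcases (hdeg3 z).1 hz with h | rfl | rfl
      · obtain ⟨w, h1, h2⟩ := hG.exists_deg_three C hC' z hzC h
        exact ⟨_, (map_adj_apply _ hinj).2 h1, (hdeg3 w).2 (Or.inl h2)⟩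
      · rw [huniq C hC' (Or.inl hzC)]
        exact ⟨_, (map_adj_apply _ hinj).2 hxy, (hdeg3 y).2 (by tauto)⟩
      · rw [huniq C hC' (Or.inr hzC)]
        exact ⟨_, (map_adj_apply _ hinj).2 hxy.symm, (hdeg3 x).2 (by tauto)⟩
    · rcases z with z | j
      · rcases (hN.inl_mem z).1 hzC with rfl | rfl
        · exact ⟨_, hN.new_adj, (hdeg3 y).2 (by tauto)⟩
        · exact ⟨_, hN.new_adj.symm, (hdeg3 x).2 (by tauto)⟩
      · exact absurd hz (hinr j)
  · intro c hc
    rcases hN.no_chord c hc with ⟨d, hd, rfl⟩ | h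
    · exact hG.no_chord d hd
    · exact h

theorem isNewFace_four (hxy : G.Adj x y) :
    IsNewFace 4 G x y (cyc_attachPath_four hxy).sub where
  adj := hxy
  face_iff C := by
    simp only [IsInnerFace, isCycleOfLength_six_attachPath_four hxy,
      isCycleOfLength_four_attachPath_four hxy, or_and_right, exists_or]
    exact or_right_comm
  inl_mem z := by
    rw [Cyc.mem_verts, exists_fin_six]
    simp [eq_comm, or_comm]
  inr_mem j := by
    rw [Cyc.mem_verts, exists_fin_six]
    fin_cases j <;> simp
  new_adj := ((cyc_attachPath_four hxy).sub_adj_succ 4).symm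
  no_chord c hc := by
    rcases (isCycleOfLength_six_attachPath_four hxy).1 hc.isCycleOfLength_six with
      ⟨D, hD, h⟩ | h
    · left
      apply hc.exists_eq_inl
      intro i j hij
      have h1 := hc.apply_mem i
      rw [h, hij] at h1
      obtain ⟨a, -, h2⟩ := h1
      cases h2
    · right
      intro hadj
      -- The new hexagon is an induced subgraph, so opposite vertices cannot be adjacent.
      have hind : ∀ a ∈ (cyc_attachPath_four hxy).sub.verts,
          ∀ b ∈ (cyc_attachPath_four hxy).sub.verts, (attachPath 4 G x y).Adj a b →
          (cyc_attachPath_four hxy).sub.Adj a b := by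
        rintro _ ⟨i, rfl⟩ _ ⟨j, rfl⟩ h
        rw [Cyc.sub_adj_apply_apply]
        have := hxy.ne
        fin_cases i <;> fin_cases j <;>
          simp [attachPath_inl_inr, attachPath_inr_inl, attachPath_inr_inr, this, this.symm] at h ⊢
        rfl
      have := hind _ (h ▸ hc.apply_mem 0) _ (h ▸ hc.apply_mem 3) hadj
      rw [← h, hc.sub_adj_apply_apply] at this
      exact absurd this (by decide)

theorem isNewFace_two (hxy : G.Adj x y)
    (hno : ∀ a b, G.Adj x a → G.Adj a b → G.Adj b y → a = y ∨ b = x) :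
    IsNewFace 2 G x y (cyc_attachPath_two hxy).sub where
  adj := hxy
  face_iff C := by
    simp only [IsInnerFace, isCycleOfLength_six_attachPath_two hxy hno,
      isCycleOfLength_four_attachPath_two hxy, or_and_right, exists_or]
    exact or_assoc.symm
  inl_mem z := by
    rw [Cyc.mem_verts, exists_fin_four]
    simp [eq_comm, or_comm]
  inr_mem j := by
    rw [Cyc.mem_verts, exists_fin_four]
    fin_cases j <;> simp
  new_adj := ((cyc_attachPath_two hxy).sub_adj_succ 2).symm
  no_chord c hc := by
    left
    obtain ⟨D, hD, h⟩ := (isCycleOfLength_six_attachPath_two hxy hno).1 hc.isCycleOfLength_six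
    apply hc.exists_eq_inl
    intro i j hij
    have h1 := hc.apply_mem i
    rw [h, hij] at h1
    obtain ⟨a, -, h2⟩ := h1
    cases h2

end Attach

/-! ### The gain in the Wiener polarity index -/

section Polarity

variable {V : Type u} {G : SimpleGraph V}

/-- Replaces distances by statements about adjacency, which can be decided case by case in an
attached graph. -/
theorem dist_eq_three_iff {a b : V} : G.dist a b = 3 ↔ a ≠ b ∧ ¬ G.Adj a b ∧
    (∀ c, G.Adj a c → ¬ G.Adj c b) ∧ ∃ c d, G.Adj a c ∧ G.Adj c d ∧ G.Adj d b := by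
  constructor
  · intro h
    refine ⟨?_, ?_, ?_, ?_⟩
    · rintro rfl; simp at h
    · intro h1; rw [dist_eq_one_iff_adj.2 h1] at h; omega
    · intro c h1 h2
      have := dist_le (.cons h1 (.cons h2 .nil))
      rw [h] at this
      simp at this
    · have hr : G.Reachable a b := Reachable.of_dist_ne_zero (by omega)
      obtain ⟨w, hw⟩ := hr.exists_walk_length_eq_dist
      rw [h] at hw
      match w, hw with
      | .cons h1 (.cons h2 (.cons h3 .nil)), _ => exact ⟨_, _, h1, h2, h3⟩
  · rintro ⟨h1, h2, h3, c, d, h4, h5, h6⟩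
    have hle := dist_le (.cons h4 (.cons h5 (.cons h6 .nil)))
    simp only [Walk.length_cons, Walk.length_nil] at hle
    have hr : G.Reachable a b := ⟨.cons h4 (.cons h5 (.cons h6 .nil))⟩
    have h0 : G.dist a b ≠ 0 := fun h => h1 (hr.dist_eq_zero_iff.1 h)
    have h1' : G.dist a b ≠ 1 := fun h => h2 (dist_eq_one_iff_adj.1 h)
    have h2' : G.dist a b ≠ 2 := by
      intro h
      obtain ⟨w, hw⟩ := hr.exists_walk_length_eq_dist
      rw [h] at hw
      match w, hw with
      | .cons h1 (.cons h2 .nil), _ => exact h3 _ h1 h2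
    omega

open Classical in
theorem two_mul_wienerPolarity [Fintype V] :
    2 * wienerPolarity G = ∑ a, ∑ b, if G.dist a b = 3 then 1 else 0 := by
  -- The pairs at distance three are the edges of `H`, so the handshake lemma turns them into
  -- ordered pairs.
  let H : SimpleGraph V :=
    { Adj := fun a b => G.dist a b = 3
      symm := ⟨fun a b h => by rw [dist_comm]; exact h⟩
      loopless := ⟨fun a h => by simp at h⟩ }
  have h1 : {s : Sym2 V | ∃ a b : V, s = s(a, b) ∧ G.dist a b = 3} = H.edgeSet := by
    ext e
    induction e with
    | _ a b =>
      rw [mem_edgeSet]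
      constructor
      · rintro ⟨c, d, h, h'⟩
        rw [Sym2.eq_iff] at h
        rcases h with ⟨rfl, rfl⟩ | ⟨rfl, rfl⟩
        · exact h'
        · exact (dist_comm).trans h'
      · intro h; exact ⟨a, b, rfl, h⟩
  rw [wienerPolarity, h1, ← coe_edgeFinset, Set.ncard_coe_finset, ← sum_degrees_eq_twice_card_edges]
  refine Finset.sum_congr rfl fun a _ => ?_
  rw [Finset.sum_boole, Nat.cast_id, ← card_neighborFinset_eq_degree]
  congr 1
  ext b
  simp [H]

/-- The number of vertices at distance two from `x`. -/
noncomputable def secondDeg (G : SimpleGraph V) (x : V) : ℕ :=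
  {a | a ≠ x ∧ ¬ G.Adj x a ∧ ∃ c, G.Adj x c ∧ G.Adj c a}.ncard

theorem exists_fin_two {P : Fin 2 → Prop} : (∃ i, P i) ↔ P 0 ∨ P 1 := by
  simp [Fin.exists_fin_succ]

variable {x y : V}

/-- The new path only offers a longer connection between `x` and `y`, which are already adjacent;
old distances do not change. -/
theorem dist_attachPath_four_inl_inl (hxy : G.Adj x y) (a b : V) :
    (attachPath 4 G x y).dist (.inl a) (.inl b) = 3 ↔ G.dist a b = 3 := by
  simp only [dist_eq_three_iff, Sum.exists, Sum.forall, exists_fin_four, attachPath_inl_inl,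
    attachPath_inl_inr, attachPath_inr_inl, attachPath_inr_inr, Ne, Sum.inl.injEq,
    Fin.forall_fin_succ]
  have := hxy.symm
  have := hxy.ne
  simp
  grind

/-- The new vertex 0 hangs on `x`, and the way around through `y` is never shorter, since `x` and
`y` are adjacent. So distance three from vertex 0 means distance two from `x`; by the same
reasoning, distance three from vertex 1 means being a neighbour of `x`. -/
theorem dist_attachPath_four_inl_zero (hxy : G.Adj x y) (a : V) :
    (attachPath 4 G x y).dist (.inl a) (.inr 0) = 3 ↔
      a ≠ x ∧ ¬ G.Adj x a ∧ ∃ c, G.Adj x c ∧ G.Adj c a := by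
  simp only [dist_eq_three_iff, Sum.exists, Sum.forall, exists_fin_four, attachPath_inl_inl,
    attachPath_inl_inr, attachPath_inr_inl, attachPath_inr_inr, Ne, Fin.forall_fin_succ]
  have := hxy.symm
  have h0 : ∀ a b, G.Adj a b → G.Adj b a := fun _ _ h => h.symm
  have h1 : ∀ a, ¬ G.Adj a a := fun _ => G.irrefl
  simp
  grind

theorem dist_attachPath_four_inl_one (hxy : G.Adj x y) (a : V) :
    (attachPath 4 G x y).dist (.inl a) (.inr 1) = 3 ↔ G.Adj x a := by
  simp only [dist_eq_three_iff, Sum.exists, Sum.forall, exists_fin_four, attachPath_inl_inl,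
    attachPath_inl_inr, attachPath_inr_inl, attachPath_inr_inr, Ne, Fin.forall_fin_succ]
  have := hxy.symm
  have h0 : ∀ a b, G.Adj a b → G.Adj b a := fun _ _ h => h.symm
  have h1 : ∀ a, ¬ G.Adj a a := fun _ => G.irrefl
  simp
  grind

theorem dist_attachPath_four_inl_two (hxy : G.Adj x y) (a : V) :
    (attachPath 4 G x y).dist (.inl a) (.inr 2) = 3 ↔ G.Adj y a := by
  simp only [dist_eq_three_iff, Sum.exists, Sum.forall, exists_fin_four, attachPath_inl_inl,
    attachPath_inl_inr, attachPath_inr_inl, attachPath_inr_inr, Ne, Fin.forall_fin_succ]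
  have := hxy.symm
  have h0 : ∀ a b, G.Adj a b → G.Adj b a := fun _ _ h => h.symm
  have h1 : ∀ a, ¬ G.Adj a a := fun _ => G.irrefl
  simp
  grind

theorem dist_attachPath_four_inl_last (hxy : G.Adj x y) (a : V) :
    (attachPath 4 G x y).dist (.inl a) (.inr 3) = 3 ↔
      a ≠ y ∧ ¬ G.Adj y a ∧ ∃ c, G.Adj y c ∧ G.Adj c a := by
  simp only [dist_eq_three_iff, Sum.exists, Sum.forall, exists_fin_four, attachPath_inl_inl,
    attachPath_inl_inr, attachPath_inr_inl, attachPath_inr_inr, Ne, Fin.forall_fin_succ]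
  have := hxy.symm
  have h0 : ∀ a b, G.Adj a b → G.Adj b a := fun _ _ h => h.symm
  have h1 : ∀ a, ¬ G.Adj a a := fun _ => G.irrefl
  simp
  grind

theorem dist_attachPath_four_inr_inr (hxy : G.Adj x y) (i j : Fin 4) :
    (attachPath 4 G x y).dist (.inr i) (.inr j) = 3 ↔ (i = 0 ∧ j = 3) ∨ (i = 3 ∧ j = 0) := by
  simp only [dist_eq_three_iff, Sum.exists, Sum.forall, exists_fin_four, attachPath_inl_inl,
    attachPath_inl_inr, attachPath_inr_inl, attachPath_inr_inr, Ne, Fin.forall_fin_succ]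
  have := hxy.symm
  have := hxy.ne
  fin_cases i <;> fin_cases j <;> simp <;> grind

theorem dist_attachPath_two_inl_inl (hxy : G.Adj x y) (a b : V) :
    (attachPath 2 G x y).dist (.inl a) (.inl b) = 3 ↔ G.dist a b = 3 := by
  simp only [dist_eq_three_iff, Sum.exists, Sum.forall, exists_fin_two, attachPath_inl_inl,
    attachPath_inl_inr, attachPath_inr_inl, attachPath_inr_inr, Ne, Sum.inl.injEq,
    Fin.forall_fin_succ]
  have := hxy.symm
  have := hxy.ne
  simp
  grind

theorem dist_attachPath_two_inl_zero (hxy : G.Adj x y) (a : V) :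
    (attachPath 2 G x y).dist (.inl a) (.inr 0) = 3 ↔
      a ≠ x ∧ ¬ G.Adj x a ∧ ∃ c, G.Adj x c ∧ G.Adj c a := by
  simp only [dist_eq_three_iff, Sum.exists, Sum.forall, exists_fin_two, attachPath_inl_inl,
    attachPath_inl_inr, attachPath_inr_inl, attachPath_inr_inr, Ne, Fin.forall_fin_succ]
  have := hxy.symm
  have h0 : ∀ a b, G.Adj a b → G.Adj b a := fun _ _ h => h.symm
  have h1 : ∀ a, ¬ G.Adj a a := fun _ => G.irrefl
  simp
  grind

theorem dist_attachPath_two_inl_last (hxy : G.Adj x y) (a : V) :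
    (attachPath 2 G x y).dist (.inl a) (.inr 1) = 3 ↔
      a ≠ y ∧ ¬ G.Adj y a ∧ ∃ c, G.Adj y c ∧ G.Adj c a := by
  simp only [dist_eq_three_iff, Sum.exists, Sum.forall, exists_fin_two, attachPath_inl_inl,
    attachPath_inl_inr, attachPath_inr_inl, attachPath_inr_inr, Ne, Fin.forall_fin_succ]
  have := hxy.symm
  have h0 : ∀ a b, G.Adj a b → G.Adj b a := fun _ _ h => h.symm
  have h1 : ∀ a, ¬ G.Adj a a := fun _ => G.irrefl
  simp
  grind

theorem dist_attachPath_two_inr_inr (hxy : G.Adj x y) (i j : Fin 2) :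
    (attachPath 2 G x y).dist (.inr i) (.inr j) = 3 ↔ False := by
  simp only [dist_eq_three_iff, Sum.exists, Sum.forall, exists_fin_two, attachPath_inl_inl,
    attachPath_inl_inr, attachPath_inr_inl, attachPath_inr_inr, Ne, Fin.forall_fin_succ]
  have := hxy.symm
  have := hxy.ne
  fin_cases i <;> fin_cases j <;> simp

-- The ends of the new path are at distance three from each other, which gives the 1. The two middle
-- vertices contribute the degrees of `x` and `y`, and the two end vertices contribute their second
-- degrees.
open Classical in
theorem wienerPolarity_attachPath_four [Finite V] (hxy : G.Adj x y) :
    wienerPolarity (attachPath 4 G x y) =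
      wienerPolarity G + 1 + deg G x + deg G y + secondDeg G x + secondDeg G y := by
  have := Fintype.ofFinite V
  have h1 := two_mul_wienerPolarity (G := attachPath 4 G x y)
  have h2 := two_mul_wienerPolarity (G := G)
  have h3 : ∀ (P : V → Prop) [DecidablePred P], ∑ a, (if P a then 1 else 0) = {a | P a}.ncard := by
    intro P _
    rw [Finset.sum_boole, Nat.cast_id, ← Set.ncard_coe_finset]
    congr 1
    ext; simp
  have h4 : ∀ a i, (attachPath 4 G x y).dist (.inr i) (.inl a) =
      (attachPath 4 G x y).dist (.inl a) (.inr i) := fun a i => dist_comm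
  simp only [h3] at h2
  have e1 : deg G x = {a | G.Adj x a}.ncard := rfl
  have e2 : deg G y = {a | G.Adj y a}.ncard := rfl
  simp only [Fintype.sum_sum_type, Finset.sum_add_distrib, Fin.sum_univ_four, h4,
    dist_attachPath_four_inl_inl hxy, dist_attachPath_four_inl_zero hxy,
    dist_attachPath_four_inl_one hxy, dist_attachPath_four_inl_two hxy,
    dist_attachPath_four_inl_last hxy, dist_attachPath_four_inr_inr hxy, h3] at h1
  simp only [secondDeg, e1, e2, Ne]
  simp at h1
  omega

open Classical in
theorem wienerPolarity_attachPath_two [Finite V] (hxy : G.Adj x y) :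
    wienerPolarity (attachPath 2 G x y) =
      wienerPolarity G + secondDeg G x + secondDeg G y := by
  have := Fintype.ofFinite V
  have h1 := two_mul_wienerPolarity (G := attachPath 2 G x y)
  have h2 := two_mul_wienerPolarity (G := G)
  have h3 : ∀ (P : V → Prop) [DecidablePred P], ∑ a, (if P a then 1 else 0) = {a | P a}.ncard := by
    intro P _
    rw [Finset.sum_boole, Nat.cast_id, ← Set.ncard_coe_finset]
    congr 1
    ext; simp
  have h4 : ∀ a i, (attachPath 2 G x y).dist (.inr i) (.inl a) =
      (attachPath 2 G x y).dist (.inl a) (.inr i) := fun a i => dist_comm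
  simp only [h3] at h2
  simp only [Fintype.sum_sum_type, Finset.sum_add_distrib, Fin.sum_univ_two, h4,
    dist_attachPath_two_inl_inl hxy, dist_attachPath_two_inl_zero hxy,
    dist_attachPath_two_inl_last hxy, dist_attachPath_two_inr_inr hxy, h3] at h1
  simp only [secondDeg, Ne]
  simp at h1
  omega

/-- The vertices at distance two from the old ends of a new quadrilateral. -/
theorem secondDeg_attachPath_two_zero (hxy : G.Adj x y) :
    secondDeg (attachPath 2 G x y) (.inr 0) = deg G x := by
  rw [secondDeg, deg, ← Set.ncard_image_of_injective (G.neighborSet x) Sum.inl_injective]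
  congr 1
  ext (a | j)
  · simp only [Set.mem_ofPred_eq, Sum.exists, exists_fin_two, attachPath_inl_inl,
      attachPath_inr_inl, attachPath_inr_inr, Ne, Set.mem_image,
      mem_neighborSet]
    have := hxy.ne
    simp
    grind [G.irrefl]
  · have := hxy.ne
    fin_cases j <;> simp [attachPath_inl_inr, attachPath_inr_inl, attachPath_inr_inr]

theorem secondDeg_attachPath_two_one (hxy : G.Adj x y) :
    secondDeg (attachPath 2 G x y) (.inr 1) = deg G y := by
  rw [secondDeg, deg, ← Set.ncard_image_of_injective (G.neighborSet y) Sum.inl_injective]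
  congr 1
  ext (a | j)
  · simp only [Set.mem_ofPred_eq, Sum.exists, exists_fin_two, attachPath_inl_inl,
      attachPath_inr_inl, attachPath_inr_inr, Ne, Set.mem_image,
      mem_neighborSet]
    have := hxy.ne
    have := hxy.symm
    simp
    grind [G.irrefl]
  · have := hxy.ne
    fin_cases j <;> simp [attachPath_inl_inr, attachPath_inr_inl, attachPath_inr_inr]

/-- The vertices at distance two from an end of a free edge of a hexagon. -/
theorem secondDeg_eq_deg {a b c d : V} (hG : deg G b = 2) (hG' : deg G c = 2) (hab : G.Adj a b)
    (hbc : G.Adj b c) (hcd : G.Adj c d) (hac : a ≠ c) (hbd : b ≠ d) (had : a ≠ d)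
    (hadj : ¬ G.Adj a d) (hfin : Finite V) : secondDeg G b = deg G a := by
  have hb := adj_iff_of_deg_eq_two hG hab.symm hbc hac
  have hc := adj_iff_of_deg_eq_two hG' hbc.symm hcd hbd
  -- Second neighbours of `b` are reached through `a` or through `c`: all neighbours of `a` except
  -- `b`, and the single vertex `d`. One is lost and one gained, which leaves the degree of `a`.
  have h1 : {w | w ≠ b ∧ ¬ G.Adj b w ∧ ∃ u, G.Adj b u ∧ G.Adj u w} =
      insert d (G.neighborSet a \ {b}) := by
    ext w
    simp only [Set.mem_ofPred_eq, hb, exists_eq_or_imp, exists_eq_left, hc, Set.mem_insert_iff,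
      Set.mem_sdiff, mem_neighborSet, Set.mem_singleton_iff, not_or]
    have := G.ne_of_adj hcd
    have hca : ¬ G.Adj a c := fun h => by
      have := (hc a).1 h.symm
      rcases this with h | h
      · exact G.irrefl (h ▸ hab)
      · exact had h
    constructor
    · rintro ⟨h1, -, h2 | h2 | h2⟩
      · exact Or.inr ⟨h2, h1⟩
      · exact absurd h2 h1
      · exact Or.inl h2
    · rintro (rfl | ⟨h1, h2⟩)
      · exact ⟨hbd.symm, ⟨had.symm, this.symm⟩, by tauto⟩
      · exact ⟨h2, ⟨h1.ne', fun h => hca (h ▸ h1)⟩, Or.inl h1⟩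
  rw [secondDeg, h1, Set.ncard_insert_of_notMem (fun h => hadj h.1) (Set.toFinite _),
    Set.ncard_sdiff_singleton_add_one (show b ∈ G.neighborSet a from hab) (Set.toFinite _), deg]

end Polarity

/-! ### Invariance under isomorphism -/

section Iso

variable {V : Type u} {W : Type v} {G : SimpleGraph V} {H : SimpleGraph W}

theorem isCycle_map_iso_iff (φ : G ≃g H) {k : ℕ} {C : G.Subgraph} :
    IsCycleOfLength H k (C.map φ.toHom) ↔ IsCycleOfLength G k C := by
  constructor
  · intro h
    have h1 := isCycle_map φ.symm.toHom φ.symm.injective h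
    rw [← Subgraph.map_comp] at h1
    have : φ.symm.toHom.comp φ.toHom = Hom.id := by ext a; simp
    rwa [this, Subgraph.map_id] at h1
  · exact isCycle_map _ φ.injective

theorem exists_eq_map_iso (φ : G ≃g H) (C : H.Subgraph) : ∃ D : G.Subgraph, C = D.map φ.toHom := by
  refine ⟨C.map φ.symm.toHom, ?_⟩
  rw [← Subgraph.map_comp]
  have : φ.toHom.comp φ.symm.toHom = Hom.id := by ext a; simp
  rw [this, Subgraph.map_id]

theorem isInnerFace_map_iso_iff (φ : G ≃g H) {C : G.Subgraph} :
    IsInnerFace H (C.map φ.toHom) ↔ IsInnerFace G C :=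
  or_congr (isCycle_map_iso_iff φ) (isCycle_map_iso_iff φ)

theorem numHexagons_iso (φ : G ≃g H) : numHexagons H = numHexagons G := by
  have : {C : H.Subgraph | IsCycleOfLength H 6 C} =
      Subgraph.map φ.toHom '' {C | IsCycleOfLength G 6 C} := by
    ext C
    constructor
    · intro h
      obtain ⟨D, rfl⟩ := exists_eq_map_iso φ C
      exact ⟨D, (isCycle_map_iso_iff φ).1 h, rfl⟩
    · rintro ⟨D, h, rfl⟩
      exact (isCycle_map_iso_iff φ).2 h
  rw [numHexagons, this,
    Set.ncard_image_of_injective _ (subgraph_map_injective φ.toHom φ.injective), numHexagons]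

theorem numAdjacentFaces_iso (φ : G ≃g H) (C : G.Subgraph) :
    numAdjacentFaces H (C.map φ.toHom) = numAdjacentFaces G C := by
  have hinj : Function.Injective φ.toHom := φ.injective
  have : {D : H.Subgraph | IsInnerFace H D ∧ D ≠ C.map φ.toHom ∧
      ∃ a b, (C.map φ.toHom).Adj a b ∧ D.Adj a b} = Subgraph.map φ.toHom ''
        {D | IsInnerFace G D ∧ D ≠ C ∧ ∃ a b, C.Adj a b ∧ D.Adj a b} := by
    ext D
    obtain ⟨D, rfl⟩ := exists_eq_map_iso φ D
    rw [(subgraph_map_injective φ.toHom hinj).mem_set_image]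
    simp only [Set.mem_ofPred_eq, isInnerFace_map_iso_iff, map_common_edge φ.toHom hinj, Ne,
      (subgraph_map_injective φ.toHom hinj).eq_iff]
  rw [numAdjacentFaces_eq, this,
    Set.ncard_image_of_injective _ (subgraph_map_injective φ.toHom hinj), numAdjacentFaces_eq]

theorem dist_eq_three_iso (φ : G ≃g H) {a b : V} (h : G.dist a b = 3) :
    H.dist (φ a) (φ b) = 3 := by
  rw [dist_eq_three_iff] at h ⊢
  obtain ⟨h1, h2, h3, c, d, h4, h5, h6⟩ := h
  refine ⟨fun h => h1 (φ.injective h), fun h => h2 (φ.map_adj_iff.1 h), fun c h4 h5 => ?_,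
    φ c, φ d, φ.map_adj_iff.2 h4, φ.map_adj_iff.2 h5, φ.map_adj_iff.2 h6⟩
  obtain ⟨c, rfl⟩ := φ.surjective c
  exact h3 c (φ.map_adj_iff.1 h4) (φ.map_adj_iff.1 h5)

theorem wienerPolarity_iso (φ : G ≃g H) : wienerPolarity H = wienerPolarity G := by
  have : {s : Sym2 W | ∃ a b, s = s(a, b) ∧ H.dist a b = 3} =
      Sym2.map φ '' {s : Sym2 V | ∃ a b, s = s(a, b) ∧ G.dist a b = 3} := by
    ext s
    constructor
    · rintro ⟨a, b, rfl, h⟩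
      exact ⟨s(φ.symm a, φ.symm b), ⟨_, _, rfl, dist_eq_three_iso φ.symm h⟩, by simp⟩
    · rintro ⟨_, ⟨a, b, rfl, h⟩, rfl⟩
      exact ⟨φ a, φ b, rfl, dist_eq_three_iso φ h⟩
  rw [wienerPolarity, this, Set.ncard_image_of_injective _ (Sym2.map.injective φ.injective),
    wienerPolarity]

theorem Nice.iso (hG : Nice G) (φ : G ≃g H) : Nice H := by
  have hinj : Function.Injective φ.toHom := φ.injective
  have hfin := hG.finite
  refine ⟨Finite.of_equiv V φ.toEquiv, ?_, ?_, ?_, ?_, ?_⟩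
  · intro z
    obtain ⟨z, rfl⟩ := φ.surjective z
    rw [deg_iso]; exact hG.deg_eq z
  · intro z C D
    obtain ⟨C, rfl⟩ := exists_eq_map_iso φ C
    obtain ⟨D, rfl⟩ := exists_eq_map_iso φ D
    obtain ⟨z, rfl⟩ := φ.surjective z
    rw [isInnerFace_map_iso_iff, isInnerFace_map_iso_iff, deg_iso]
    intro hC hD hzC hzD hz
    rw [hG.unique_face z C D hC hD ((mem_map_verts φ.toHom hinj).1 hzC)
      ((mem_map_verts φ.toHom hinj).1 hzD) hz]
  · intro C
    obtain ⟨C, rfl⟩ := exists_eq_map_iso φ C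
    rw [isInnerFace_map_iso_iff, numAdjacentFaces_iso]
    intro hC
    rw [hG.two_mul_numAdjacentFaces C hC, ← Set.ncard_image_of_injective _ φ.injective]
    congr 1
    ext z
    obtain ⟨z, rfl⟩ := φ.surjective z
    rw [φ.injective.mem_set_image, Set.mem_ofPred_eq, Set.mem_ofPred_eq, deg_iso]
    exact and_congr_left' (mem_map_verts φ.toHom hinj).symm
  · intro C
    obtain ⟨C, rfl⟩ := exists_eq_map_iso φ C
    rw [isInnerFace_map_iso_iff]
    rintro hC _ ⟨z, hz, rfl⟩ h
    obtain ⟨w, h1, h2⟩ := hG.exists_deg_three C hC z hz (by rw [← deg_iso φ]; exact h)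
    exact ⟨φ w, (map_adj_apply φ.toHom hinj).2 h1, by rw [deg_iso]; exact h2⟩
  · intro c hc h
    exact hG.no_chord _ (hc.map φ.symm.toHom φ.symm.injective) (φ.symm.map_adj_iff.2 h)

end Iso

/-! ### Attaching a hexagon, with or without a quadrilateral -/

section Attach

/-- The vertices of the graph obtained by attaching a hexagon, directly or with a quadrilateral
in between. -/
abbrev AttV : Bool → Type u → Type u
  | false, V => V ⊕ Fin 4
  | true, V => (V ⊕ Fin 2) ⊕ Fin 4

/-- Attach a hexagon along the edge `x y`, with a quadrilateral in between if `q` is true. -/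
def att {V : Type u} : ∀ (q : Bool) (_ : SimpleGraph V) (_ _ : V), SimpleGraph (AttV q V)
  | false, G, x, y => attachHex G x y
  | true, G, x, y => attachQuadHex G x y

/-- The inclusion of the old graph. -/
def attIncl {V : Type u} : ∀ (q : Bool) (G : SimpleGraph V) (x y : V), G →g att q G x y
  | false, G, x, y => attachHexIncl G x y
  | true, G, x, y => attachQuadHexIncl G x y

variable {V : Type u} {G : SimpleGraph V} {q : Bool} {x y : V}

theorem attIncl_injective : Function.Injective (attIncl q G x y) := by
  cases q
  · exact Sum.inl_injective
  · exact Sum.inl_injective.comp Sum.inl_injective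

/-- Attaching a hexagon is compatible with isomorphisms. -/
def attCongr {W : Type v} {H : SimpleGraph W} (φ : G ≃g H) :
    ∀ (q : Bool) (x y : V), att q G x y ≃g att q H (φ x) (φ y)
  | false, x, y => attachPathCongr φ 4 x y
  | true, x, y => attachPathCongr (attachPathCongr φ 2 x y) 4 (.inr 0) (.inr 1)

theorem Nice.not_adj (hG : Nice G) {c : Fin 6 → V} (hc : Cyc G c) (i : Fin 6) :
    ¬ G.Adj (c i) (c (i + 3)) := by
  have := hG.no_chord _ (hc.rotate i)
  rwa [zero_add, add_comm 3] at this

theorem IsFreeEdge.exists_cyc {C : G.Subgraph} (hC : IsCycleOfLength G 6 C)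
    (h : IsFreeEdge G C x y) : ∃ (c : Fin 6 → V) (hc : Cyc G c), hc.sub = C ∧ c 2 = x ∧ c 3 = y :=
  hC.exists_cyc_of_adj h.1 2

/-- As `x` and `y` have degree two, a path of length three avoiding their edge must leave through
their other neighbours on the hexagon. These are opposite vertices, and hexagons have no such
chords. -/
theorem Nice.no_short_path (hG : Nice G) {C : G.Subgraph} (hC : IsCycleOfLength G 6 C)
    (h : IsFreeEdge G C x y) (a b : V) (h1 : G.Adj x a) (h2 : G.Adj a b) (h3 : G.Adj b y) :
    a = y ∨ b = x := by
  obtain ⟨c, hc, rfl, rfl, rfl⟩ := h.exists_cyc hC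
  have e2 := adj_iff_of_deg_eq_two h.2.1 (hc.adj 1).symm (hc.adj 2) (hc.inj.ne (by decide))
  have e3 := adj_iff_of_deg_eq_two h.2.2 (hc.adj 2).symm (hc.adj 3) (hc.inj.ne (by decide))
  rcases (e2 a).1 h1 with rfl | rfl
  · rcases (e3 b).1 h3.symm with rfl | rfl
    · exact Or.inr rfl
    · exact absurd h2 (hG.not_adj hc 1)
  · exact Or.inl rfl

theorem Nice.att (hG : Nice G) {C : G.Subgraph} (hC : IsCycleOfLength G 6 C)
    (h : IsFreeEdge G C x y) (q : Bool) : Nice (att q G x y) := by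
  have hxy := h.1.adj_sub
  cases q
  · exact (isNewFace_four hxy).nice hG h.2.1 h.2.2 (Or.inl hC) h.1
  · have hN := isNewFace_two hxy (hG.no_short_path hC h)
    have h2 := hN.nice hG h.2.1 h.2.2 (Or.inl hC) h.1
    exact (isNewFace_four (G := attachPath 2 G x y) (x := .inr 0) (y := .inr 1)
      (by rw [attachPath_inr_inr]; left; rfl)).nice h2 (deg_attachPath_inr hxy.ne _)
      (deg_attachPath_inr hxy.ne _) hN.face ((cyc_attachPath_two hxy).sub_adj_succ 0)

theorem deg_att_eq_three_iff [Finite V] (hxy : x ≠ y) (hx : deg G x = 2) (hy : deg G y = 2)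
    {z : V} : deg (att q G x y) (attIncl q G x y z) = 3 ↔ deg G z = 3 ∨ z = x ∨ z = y := by
  cases q
  · exact deg_attachPath_inl_eq_three hxy hx hy
  · have : deg (Benzenoid.att true G x y) (attIncl true G x y z) =
        deg (attachPath 2 G x y) (.inl z) := deg_attachPath_of_ne Sum.inl_ne_inr Sum.inl_ne_inr
    rw [this]
    exact deg_attachPath_inl_eq_three hxy hx hy

theorem numHexagons_attachPath_four [Finite V] (hxy : G.Adj x y) :
    numHexagons (attachPath 4 G x y) = numHexagons G + 1 := by
  have : {C | IsCycleOfLength (attachPath 4 G x y) 6 C} = insert (cyc_attachPath_four hxy).sub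
      (Subgraph.map (attachPathIncl 4 G x y) '' {C | IsCycleOfLength G 6 C}) := by
    ext C
    rw [Set.mem_ofPred_eq, isCycleOfLength_six_attachPath_four hxy, Set.mem_insert_iff, or_comm]
    simp only [Set.mem_image, Set.mem_ofPred_eq, eq_comm]
  rw [numHexagons, this, Set.ncard_insert_of_notMem _ (Set.toFinite _),
    Set.ncard_image_of_injective _ (subgraph_map_injective _ attachPathIncl_injective), numHexagons]
  rintro ⟨D, -, h⟩
  exact (isNewFace_four hxy).ne_map D h.symm

theorem Nice.numHexagons_att (hG : Nice G) {C : G.Subgraph} (hC : IsCycleOfLength G 6 C)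
    (h : IsFreeEdge G C x y) (q : Bool) :
    numHexagons (Benzenoid.att q G x y) = numHexagons G + 1 := by
  have := hG.finite
  have hxy := h.1.adj_sub
  cases q
  · exact numHexagons_attachPath_four hxy
  · have h1 : numHexagons (attachPath 2 G x y) = numHexagons G := by
      have : {C | IsCycleOfLength (attachPath 2 G x y) 6 C} =
          Subgraph.map (attachPathIncl 2 G x y) '' {C | IsCycleOfLength G 6 C} := by
        ext C
        rw [Set.mem_ofPred_eq, isCycleOfLength_six_attachPath_two hxy (hG.no_short_path hC h)]
        simp only [Set.mem_image, Set.mem_ofPred_eq, eq_comm]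
      rw [numHexagons, this,
        Set.ncard_image_of_injective _ (subgraph_map_injective _ attachPathIncl_injective),
        numHexagons]
    rw [← h1]
    exact numHexagons_attachPath_four (by rw [attachPath_inr_inr]; left; rfl)

/-- The number of pairs at distance three that a new hexagon contributes, apart from the degrees
of the neighbours of the edge to which it is attached. -/
def attGain : Bool → ℕ
  -- For a hexagon alone, 5 = 1 + 2 + 2 with both ends of degree two. With a quadrilateral the
  -- hexagon hangs on two new vertices of degree two, whose second degrees are the old degrees 2 and
  -- 2 of the ends; hence 9 = 5 + 4.
  | false => 5
  | true => 9

theorem wienerPolarity_att_of_deg [Finite V] (hxy : G.Adj x y) (hx : deg G x = 2)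
    (hy : deg G y = 2) {m : ℕ} (hm : secondDeg G x + secondDeg G y = m) :
    wienerPolarity (att q G x y) = wienerPolarity G + attGain q + m := by
  cases q
  · show wienerPolarity (attachPath 4 G x y) = _
    rw [wienerPolarity_attachPath_four hxy, attGain]
    omega
  · show wienerPolarity (attachPath 4 (attachPath 2 G x y) (.inr 0) (.inr 1)) = _
    rw [wienerPolarity_attachPath_four (by rw [attachPath_inr_inr]; left; rfl),
      wienerPolarity_attachPath_two hxy, secondDeg_attachPath_two_zero hxy,
      secondDeg_attachPath_two_one hxy, deg_attachPath_inr hxy.ne, deg_attachPath_inr hxy.ne,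
      attGain]
    omega

/-- By `secondDeg_eq_deg` the second degree of each end of a free edge is the degree of its other
neighbour on the hexagon. So the gain of an attachment is read off from the two flanking vertices.
-/
theorem Nice.secondDeg_add (hG : Nice G) {c : Fin 6 → V} (hc : Cyc G c) {i : Fin 6}
    (hx : deg G (c i) = 2) (hy : deg G (c (i + 1)) = 2) :
    secondDeg G (c i) + secondDeg G (c (i + 1)) = deg G (c (i - 1)) + deg G (c (i + 2)) := by
  have hfin := hG.finite
  have h1 := (hc.adj (i - 1))
  have h2 := (hc.adj (i + 1))
  have e1 : i - 1 + 1 = i := by abel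
  have e2 : i + 1 + 1 = i + 2 := by rw [add_assoc]; rfl
  have e3 : i - 1 + 3 = i + 2 := by rw [sub_add_eq_add_sub, add_sub_assoc]; rfl
  rw [e1] at h1
  rw [e2] at h2
  have hch := hG.not_adj hc (i - 1)
  rw [e3] at hch
  have n1 : c (i - 1) ≠ c (i + 1) := hc.inj.ne (by clear * -; revert i; decide)
  have n2 : c i ≠ c (i + 2) := hc.inj.ne (by clear * -; revert i; decide)
  have n3 : c (i - 1) ≠ c (i + 2) := hc.inj.ne (by clear * -; revert i; decide)
  rw [secondDeg_eq_deg hx hy h1 (hc.adj i) h2 n1 n2 n3 hch hfin,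
    secondDeg_eq_deg hy hx h2.symm (hc.adj i).symm h1.symm n2.symm n1.symm n3.symm
      (fun h => hch h.symm) hfin]

end Attach

/-- The 6-cycle. -/
abbrev hexagonGraph : SimpleGraph (Fin 2 ⊕ Fin 4) := attachPath 4 (⊤ : SimpleGraph (Fin 2)) 0 1

/-- The graph with two hexagons, sharing an edge or separated by a quadrilateral. -/
abbrev twoHexagonGraph (q : Bool) : SimpleGraph (AttV q (Fin 2 ⊕ Fin 4)) :=
  att q hexagonGraph (.inl 0) (.inl 1)

/-! ### The three growth steps -/

section Extensions

variable {V W : Type u} (q : Bool)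

/-- Extension 1, for both classes of graphs. -/
def ExtensionOne (G₀ : SimpleGraph V) (G : SimpleGraph W) : Prop :=
  ∃ (C : G₀.Subgraph) (x y z t : V), IsTerminal G₀ C ∧
    IsFreeEdge G₀ C x y ∧ IsFreeEdge G₀ C z t ∧ Disjoint ({x, y} : Set V) {z, t} ∧
    IsBranched (att q (att q G₀ x y) (attIncl q G₀ x y z) (attIncl q G₀ x y t))
      (C.map ((attIncl q (att q G₀ x y) (attIncl q G₀ x y z) (attIncl q G₀ x y t)).comp
        (attIncl q G₀ x y))) ∧
    Nonempty (att q (att q G₀ x y) (attIncl q G₀ x y z) (attIncl q G₀ x y t) ≃g G)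

/-- Extension 2, for both classes of graphs. -/
def ExtensionTwo (G₀ : SimpleGraph V) (G : SimpleGraph W) : Prop :=
  ∃ (C : G₀.Subgraph) (x y : V), IsTerminal G₀ C ∧ IsFreeEdge G₀ C x y ∧
    IsAngular (att q G₀ x y) (C.map (attIncl q G₀ x y)) ∧ Nonempty (att q G₀ x y ≃g G)

/-- Attach one new hexagon to a terminal hexagon, which does not become angular. -/
def LinearExtension (G₀ : SimpleGraph V) (G : SimpleGraph W) : Prop :=
  ∃ (C : G₀.Subgraph) (x y : V), IsTerminal G₀ C ∧ IsFreeEdge G₀ C x y ∧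
    ¬ IsAngular (att q G₀ x y) (C.map (attIncl q G₀ x y)) ∧ Nonempty (att q G₀ x y ≃g G)

end Extensions

/-- `Grown q l a b G`: the graph `G` arises from the graph with two hexagons by `l` linear
extensions, `a` extensions 2 and `b` extensions 1. -/
inductive Grown (q : Bool) : ℕ → ℕ → ℕ → ∀ {V : Type u}, SimpleGraph V → Prop
  | base {V : Type u} (G : SimpleGraph V) : Nonempty (twoHexagonGraph q ≃g G) → Grown q 0 0 0 G
  | linear {l a b : ℕ} {V W : Type u} (G₀ : SimpleGraph V) (G : SimpleGraph W) :
      Grown q l a b G₀ → LinearExtension q G₀ G → Grown q (l + 1) a b G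
  | extensionTwo {l a b : ℕ} {V W : Type u} (G₀ : SimpleGraph V) (G : SimpleGraph W) :
      Grown q l a b G₀ → ExtensionTwo q G₀ G → Grown q l (a + 1) b G
  | extensionOne {l a b : ℕ} {V W : Type u} (G₀ : SimpleGraph V) (G : SimpleGraph W) :
      Grown q l a b G₀ → ExtensionOne q G₀ G → Grown q l a (b + 1) G

theorem Grown.iso {q : Bool} {l a b : ℕ} {V W : Type u} {G : SimpleGraph V} {H : SimpleGraph W}
    (h : Grown q l a b G) (φ : G ≃g H) : Grown q l a b H := by
  cases h with
  | base _ h => exact .base _ ⟨h.some.trans φ⟩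
  | linear G₀ _ h1 h2 =>
    obtain ⟨C, x, y, h3, h4, h5, ⟨e⟩⟩ := h2
    exact .linear G₀ _ h1 ⟨C, x, y, h3, h4, h5, ⟨e.trans φ⟩⟩
  | extensionTwo G₀ _ h1 h2 =>
    obtain ⟨C, x, y, h3, h4, h5, ⟨e⟩⟩ := h2
    exact .extensionTwo G₀ _ h1 ⟨C, x, y, h3, h4, h5, ⟨e.trans φ⟩⟩
  | extensionOne G₀ _ h1 h2 =>
    obtain ⟨C, x, y, z, t, h3, h4, h5, h6, h7, ⟨e⟩⟩ := h2
    exact .extensionOne G₀ _ h1 ⟨C, x, y, z, t, h3, h4, h5, h6, h7, ⟨e.trans φ⟩⟩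

/-! ### Terminal, angular and branched hexagons in terms of labels -/

section Labels

variable {V : Type u} {G : SimpleGraph V}

theorem Cyc.ncard_deg_three {k : ℕ} [NeZero k] {c : Fin k → V} (hc : Cyc G c) (m : ℕ) :
    {z | z ∈ hc.sub.verts ∧ deg G z = m}.ncard = {i | deg G (c i) = m}.ncard := by
  rw [← Set.ncard_image_of_injective _ hc.inj]
  congr 1
  ext z
  constructor
  · rintro ⟨⟨i, rfl⟩, h⟩; exact ⟨i, h, rfl⟩
  · rintro ⟨i, h, rfl⟩; exact ⟨⟨i, rfl⟩, h⟩

theorem Nice.deg_eq_two_iff (hG : Nice G) (z : V) : deg G z = 2 ↔ ¬ deg G z = 3 := by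
  rcases hG.deg_eq z with h | h <;> omega

/-- In a terminal hexagon the two vertices of degree three are consecutive. -/
theorem Nice.isTerminal_iff (hG : Nice G) {c : Fin 6 → V} (hc : Cyc G c) :
    IsTerminal G hc.sub ↔ ∃ j, ∀ i, deg G (c i) = 3 ↔ i = j ∨ i = j + 1 := by
  have hface : IsInnerFace G hc.sub := Or.inl hc.isCycleOfLength_six
  have hcount := hG.two_mul_numAdjacentFaces _ hface
  rw [hc.ncard_deg_three] at hcount
  constructor
  · rintro ⟨-, h1⟩
    rw [h1] at hcount
    obtain ⟨i, j, hij, hset⟩ := Set.ncard_eq_two.1 hcount.symm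
    have hmem : ∀ k, deg G (c k) = 3 ↔ k = i ∨ k = j := by
      intro k
      have : k ∈ {k | deg G (c k) = 3} ↔ k ∈ ({i, j} : Set (Fin 6)) := by rw [hset]
      exact this
    -- A vertex of degree three has a neighbour of degree three on the face, which can only be the
    -- other of the two.
    obtain ⟨w, h2, h3⟩ := hG.exists_deg_three _ hface (c i) ⟨i, rfl⟩ ((hmem i).2 (Or.inl rfl))
    rcases hc.sub_adj_apply.1 h2 with rfl | rfl
    · refine ⟨i, fun k => ?_⟩
      rcases (hmem _).1 h3 with h | h
      · exact absurd h (by clear * -; revert i; decide)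
      · rw [hmem, h]
    · refine ⟨j, fun k => ?_⟩
      rcases (hmem _).1 h3 with h | h
      · exact absurd h (by clear * -; revert i; decide)
      · rw [hmem, ← h, sub_add_cancel, or_comm]
  · rintro ⟨j, hj⟩
    refine ⟨hc.isCycleOfLength_six, ?_⟩
    have : {i | deg G (c i) = 3} = {j, j + 1} := by ext i; exact hj i
    rw [this, Set.ncard_pair (by clear * -; revert j; decide)] at hcount
    omega

/-- Adjacent vertices of degree two on the hexagon are consecutive, since a cycle uses both edges at
a vertex of degree two. -/
theorem Nice.isAngular_iff (hG : Nice G) {c : Fin 6 → V} (hc : Cyc G c) :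
    IsAngular G hc.sub ↔ ∃ j, ∀ i, deg G (c i) = 2 ↔ i = j ∨ i = j + 1 := by
  have hface : IsInnerFace G hc.sub := Or.inl hc.isCycleOfLength_six
  constructor
  · rintro ⟨-, h1, x, y, hxy, hadj⟩
    have hx : x ∈ {z | z ∈ hc.sub.verts ∧ deg G z = 2} := by rw [hxy]; exact Or.inl rfl
    have hy : y ∈ {z | z ∈ hc.sub.verts ∧ deg G z = 2} := by rw [hxy]; exact Or.inr rfl
    have h2 := hc.sub_adj_of_deg_eq_two (by decide) hx.1 hx.2 hadj
    have hmem : ∀ i, deg G (c i) = 2 ↔ c i = x ∨ c i = y := by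
      intro i
      have : c i ∈ {z | z ∈ hc.sub.verts ∧ deg G z = 2} ↔ c i ∈ ({x, y} : Set V) := by rw [hxy]
      exact ⟨fun h => this.1 ⟨⟨i, rfl⟩, h⟩, fun h => (this.2 h).2⟩
    obtain ⟨j, ⟨rfl, rfl⟩ | ⟨rfl, rfl⟩⟩ := h2
    · exact ⟨j, fun i => by rw [hmem, hc.inj.eq_iff, hc.inj.eq_iff]⟩
    · exact ⟨j, fun i => by rw [hmem, hc.inj.eq_iff, hc.inj.eq_iff, or_comm]⟩
  · rintro ⟨j, hj⟩
    refine ⟨hc.isCycleOfLength_six, ?_, c j, c (j + 1), ?_, hc.adj j⟩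
    · have hcount := hG.two_mul_numAdjacentFaces _ hface
      rw [hc.ncard_deg_three] at hcount
      have : {i | deg G (c i) = 3} = ({j, j + 1} : Set (Fin 6))ᶜ := by
        ext i
        have h1 := hj i
        rw [hG.deg_eq_two_iff] at h1
        simp only [Set.mem_ofPred_eq, Set.mem_compl_iff, Set.mem_insert_iff,
          Set.mem_singleton_iff]
        tauto
      have h2 := Set.ncard_add_ncard_compl ({j, j + 1} : Set (Fin 6))
      rw [← this, Set.ncard_pair (by clear * -; revert j; decide), Nat.card_eq_fintype_card,
        Fintype.card_fin] at h2
      omega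
    · ext z
      constructor
      · rintro ⟨⟨i, rfl⟩, h⟩
        rcases (hj i).1 h with rfl | rfl
        · exact Or.inl rfl
        · exact Or.inr rfl
      · rintro (rfl | rfl)
        · exact ⟨⟨_, rfl⟩, (hj _).2 (Or.inl rfl)⟩
        · exact ⟨⟨_, rfl⟩, (hj _).2 (Or.inr rfl)⟩

theorem Nice.isBranched (hG : Nice G) {c : Fin 6 → V} (hc : Cyc G c)
    (h : ∀ i, deg G (c i) = 3) : IsBranched G hc.sub := by
  refine ⟨hc.isCycleOfLength_six, ?_⟩
  have hcount := hG.two_mul_numAdjacentFaces _ (Or.inl hc.isCycleOfLength_six)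
  rw [hc.ncard_deg_three] at hcount
  have : {i | deg G (c i) = 3} = Set.univ := by ext i; simp [h]
  rw [this, Set.ncard_univ, Nat.card_eq_fintype_card, Fintype.card_fin] at hcount
  omega

variable {q : Bool}

theorem Nice.wienerPolarity_att (hG : Nice G) {c : Fin 6 → V} (hc : Cyc G c) {i : Fin 6} {x y : V}
    (hx : deg G (c i) = 2) (hy : deg G (c (i + 1)) = 2)
    (h : x = c i ∧ y = c (i + 1) ∨ y = c i ∧ x = c (i + 1)) :
    wienerPolarity (Benzenoid.att q G x y) =
      wienerPolarity G + attGain q + (deg G (c (i - 1)) + deg G (c (i + 2))) := by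
  have := hG.finite
  have hs := hG.secondDeg_add hc hx hy
  rcases h with ⟨rfl, rfl⟩ | ⟨rfl, rfl⟩
  · exact wienerPolarity_att_of_deg (hc.adj i) hx hy hs
  · exact wienerPolarity_att_of_deg (hc.adj i).symm hy hx (by rw [add_comm, hs])

/-- A labelling of a terminal hexagon with respect to one of its free edges. -/
theorem Nice.exists_labels (hG : Nice G) {C : G.Subgraph} {x y : V} (hC : IsTerminal G C)
    (hxy : IsFreeEdge G C x y) : ∃ (c : Fin 6 → V) (hc : Cyc G c) (j : Fin 6), hc.sub = C ∧
      c 2 = x ∧ c 3 = y ∧ (∀ i, deg G (c i) = 3 ↔ i = j ∨ i = j + 1) ∧ (j = 4 ∨ j = 5 ∨ j = 0) := by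
  obtain ⟨c, hc, rfl, rfl, rfl⟩ := hxy.exists_cyc hC.1
  obtain ⟨j, hj⟩ := (hG.isTerminal_iff hc).1 hC
  refine ⟨c, hc, j, rfl, rfl, rfl, hj, ?_⟩
  -- The edge with ends of degree three avoids positions 2 and 3. The value j = 5 is the opposite
  -- edge; 4 and 0 are the two other possibilities.
  have h2 := (hG.deg_eq_two_iff _).1 hxy.2.1
  have h3 := (hG.deg_eq_two_iff _).1 hxy.2.2
  rw [hj] at h2 h3
  clear * - h2 h3
  revert j
  decide

theorem Nice.deg_att_cyc (hG : Nice G) {c : Fin 6 → V} (hc : Cyc G c) {i : Fin 6} {x y : V}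
    (hx : deg G (c i) = 2) (hy : deg G (c (i + 1)) = 2)
    (h : x = c i ∧ y = c (i + 1) ∨ y = c i ∧ x = c (i + 1)) (k : Fin 6) :
    deg (Benzenoid.att q G x y) (attIncl q G x y (c k)) = 3 ↔
      deg G (c k) = 3 ∨ k = i ∨ k = i + 1 := by
  have := hG.finite
  rcases h with ⟨rfl, rfl⟩ | ⟨rfl, rfl⟩
  · rw [deg_att_eq_three_iff (hc.adj i).ne hx hy, hc.inj.eq_iff, hc.inj.eq_iff]
  · rw [deg_att_eq_three_iff (hc.adj i).ne' hy hx, hc.inj.eq_iff, hc.inj.eq_iff, or_comm (a := k = i)]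

theorem Nice.deg_att_two_three (hG : Nice G) {c : Fin 6 → V} (hc : Cyc G c)
    (h2 : deg G (c 2) = 2) (h3 : deg G (c 3) = 2) (k : Fin 6) :
    deg (Benzenoid.att q G (c 2) (c 3)) (attIncl q G (c 2) (c 3) (c k)) = 3 ↔
      deg G (c k) = 3 ∨ k = 2 ∨ k = 3 :=
  hG.deg_att_cyc hc (i := 2) h2 h3 (Or.inl ⟨rfl, rfl⟩) k

theorem Nice.wienerPolarity_att_two_three (hG : Nice G) {c : Fin 6 → V} (hc : Cyc G c)
    (h2 : deg G (c 2) = 2) (h3 : deg G (c 3) = 2) :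
    wienerPolarity (Benzenoid.att q G (c 2) (c 3)) =
      wienerPolarity G + attGain q + (deg G (c 1) + deg G (c 4)) :=
  hG.wienerPolarity_att hc (i := 2) h2 h3 (Or.inl ⟨rfl, rfl⟩)

theorem Cyc.attIncl {c : Fin 6 → V} (hc : Cyc G c) (q : Bool) (x y : V) :
    Cyc (att q G x y) (fun i => Benzenoid.attIncl q G x y (c i)) :=
  hc.map _ attIncl_injective

/-- Whether the hexagon becomes angular depends on the position of the free edge. -/
theorem Nice.isAngular_att_iff (hG : Nice G) {c : Fin 6 → V} (hc : Cyc G c) {j : Fin 6}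
    (hdeg : ∀ i, deg G (c i) = 3 ↔ i = j ∨ i = j + 1) (hj : j = 4 ∨ j = 5 ∨ j = 0) :
    IsAngular (Benzenoid.att q G (c 2) (c 3)) (hc.sub.map (Benzenoid.attIncl q G (c 2) (c 3))) ↔
      j ≠ 5 := by
  have h2 : deg G (c 2) = 2 := by
    rw [hG.deg_eq_two_iff, hdeg]; clear * - hj; revert j; decide
  have h3 : deg G (c 3) = 2 := by
    rw [hG.deg_eq_two_iff, hdeg]; clear * - hj; revert j; decide
  have hfree : IsFreeEdge G hc.sub (c 2) (c 3) := ⟨hc.sub_adj_succ 2, h2, h3⟩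
  have hG' := hG.att hc.isCycleOfLength_six hfree q
  have hc' := hc.attIncl q (c 2) (c 3)
  have hd := hG.deg_att_two_three (q := q) hc h2 h3
  have e : hc'.sub = hc.sub.map (Benzenoid.attIncl q G (c 2) (c 3)) :=
    hc.sub_map _ attIncl_injective
  rw [← e, hG'.isAngular_iff hc']
  simp only [hG'.deg_eq_two_iff, hd, hdeg]
  clear * - hj
  revert j
  decide

end Labels

/-! ### The base hexagon and the counting formula -/

theorem deg_top_fin_two (a : Fin 2) : deg (⊤ : SimpleGraph (Fin 2)) a = 1 := by
  have : (⊤ : SimpleGraph (Fin 2)).neighborSet a = {a + 1} := by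
    ext w
    simp only [mem_neighborSet, top_adj, Set.mem_singleton_iff]
    revert a w; decide
  rw [deg, this, Set.ncard_singleton]

theorem hexagonGraph_deg (z : Fin 2 ⊕ Fin 4) : deg hexagonGraph z = 2 := by
  have hxy : (⊤ : SimpleGraph (Fin 2)).Adj 0 1 := by simp
  rcases z with z | j
  · fin_cases z
    · exact (deg_attachPath_left hxy.ne).trans (by rw [deg_top_fin_two])
    · exact (deg_attachPath_right hxy.ne).trans (by rw [deg_top_fin_two])
  · exact deg_attachPath_inr hxy.ne j

/-- The hexagon is attached to a single edge, which has too few vertices to contain a face; so the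
new face is the only one. -/
theorem hexagonGraph_nice : Nice hexagonGraph := by
  have hxy : (⊤ : SimpleGraph (Fin 2)).Adj 0 1 := by simp
  have hN := isNewFace_four hxy
  have hface : ∀ C, IsInnerFace hexagonGraph C → C = (cyc_attachPath_four hxy).sub := by
    intro C hC
    rcases (hN.face_iff C).1 hC with ⟨D, hD, -⟩ | h
    · exfalso
      rcases hD with hD | hD <;> obtain ⟨c, hc, -⟩ := hD.exists_cyc <;>
        exact absurd (Fintype.card_le_of_injective c hc.inj) (by decide)
    · exact h
  have hdeg := hexagonGraph_deg
  refine ⟨inferInstance, fun z => Or.inl (hdeg z), ?_, ?_, ?_, ?_⟩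
  · intro z C D hC hD _ _ _
    rw [hface C hC, hface D hD]
  · intro C hC
    rw [numAdjacentFaces_eq]
    have h1 : {D | IsInnerFace hexagonGraph D ∧ D ≠ C ∧ ∃ a b, C.Adj a b ∧ D.Adj a b} = ∅ := by
      ext D
      simp only [Set.mem_ofPred_eq, Set.mem_empty_iff_false, iff_false]
      rintro ⟨h1, h2, -⟩
      exact h2 ((hface D h1).trans (hface C hC).symm)
    have h2 : {z | z ∈ C.verts ∧ deg hexagonGraph z = 3} = ∅ := by
      ext z
      simp [hdeg]
    rw [h1, h2, Set.ncard_empty, Set.ncard_empty]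
  · intro C _ z _ h
    rw [hdeg] at h
    omega
  · intro c hc
    rcases hN.no_chord c hc with ⟨d, hd, -⟩ | h
    · exact absurd (Fintype.card_le_of_injective d hd.inj) (by decide)
    · exact h

theorem hexagonGraph_numHexagons : numHexagons hexagonGraph = 1 := by
  have hxy : (⊤ : SimpleGraph (Fin 2)).Adj 0 1 := by simp
  rw [numHexagons_attachPath_four hxy]
  have : {C | IsCycleOfLength (⊤ : SimpleGraph (Fin 2)) 6 C} = ∅ := by
    ext C
    simp only [Set.mem_ofPred_eq, Set.mem_empty_iff_false, iff_false]
    intro hC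
    obtain ⟨c, hc, -⟩ := hC.exists_cyc
    exact absurd (Fintype.card_le_of_injective c hc.inj) (by decide)
  rw [numHexagons, this, Set.ncard_empty]

theorem hexagonGraph_wienerPolarity : wienerPolarity hexagonGraph = 3 := by
  have hxy : (⊤ : SimpleGraph (Fin 2)).Adj 0 1 := by simp
  have h1 : ∀ a b : Fin 2, a ≠ b → (⊤ : SimpleGraph (Fin 2)).Adj a b := fun a b h => h
  have h2 : wienerPolarity (⊤ : SimpleGraph (Fin 2)) = 0 := by
    have : {s : Sym2 (Fin 2) | ∃ a b, s = s(a, b) ∧ (⊤ : SimpleGraph (Fin 2)).dist a b = 3} =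
        ∅ := by
      ext s
      simp only [Set.mem_ofPred_eq, Set.mem_empty_iff_false, iff_false]
      rintro ⟨a, b, -, h⟩
      exact (dist_eq_three_iff.1 h).2.1 (h1 _ _ (dist_eq_three_iff.1 h).1)
    rw [wienerPolarity, this, Set.ncard_empty]
  have h3 : ∀ x, secondDeg (⊤ : SimpleGraph (Fin 2)) x = 0 := by
    intro x
    rw [secondDeg, Set.ncard_eq_zero]
    ext a
    simp only [Set.mem_ofPred_eq, Set.mem_empty_iff_false, iff_false, top_adj]
    tauto
  rw [wienerPolarity_attachPath_four hxy, h2, h3, h3, deg_top_fin_two, deg_top_fin_two]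

theorem hexagonGraph_isFreeEdge : ∃ c : Fin 6 → Fin 2 ⊕ Fin 4, Cyc hexagonGraph c ∧
    c 2 = .inl 0 ∧ c 3 = .inl 1 := by
  have hxy : (⊤ : SimpleGraph (Fin 2)).Adj 0 1 := by simp
  obtain ⟨c, hc, -, h1, h2⟩ := (cyc_attachPath_four hxy).exists_relabel
    ((cyc_attachPath_four hxy).sub_adj_succ 4).symm 2
  exact ⟨c, hc, h1, h2⟩

/-- The index starts at 3 for one hexagon. The second hexagon is attached where both flanking
vertices have degree two, exactly as in a linear step, which accounts for the factor `1 + l`. -/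
theorem Grown.spec {q : Bool} {l a b : ℕ} {V : Type u} {G : SimpleGraph V}
    (h : Grown q l a b G) : Nice G ∧ numHexagons G = 2 + l + a + 2 * b ∧
      wienerPolarity G = 3 + (attGain q + 4) * (1 + l) + (attGain q + 5) * a +
        (2 * attGain q + 11) * b := by
  induction h with
  | base G h =>
    obtain ⟨φ⟩ := h
    obtain ⟨c, hc, h2, h3⟩ := hexagonGraph_isFreeEdge
    have hfree : IsFreeEdge hexagonGraph hc.sub (.inl 0) (.inl 1) :=
      ⟨h2 ▸ h3 ▸ hc.sub_adj_succ 2, hexagonGraph_deg _, hexagonGraph_deg _⟩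
    refine ⟨(hexagonGraph_nice.att hc.isCycleOfLength_six hfree q).iso φ, ?_, ?_⟩
    · rw [numHexagons_iso φ, hexagonGraph_nice.numHexagons_att hc.isCycleOfLength_six hfree,
        hexagonGraph_numHexagons]
    · rw [wienerPolarity_iso φ, hexagonGraph_nice.wienerPolarity_att hc (i := 2)
        (hexagonGraph_deg _) (hexagonGraph_deg _) (Or.inl ⟨h2.symm, h3.symm⟩),
        hexagonGraph_wienerPolarity, hexagonGraph_deg, hexagonGraph_deg]
      ring
  | linear G₀ G _ h ih =>
    obtain ⟨hG, hnum, hW⟩ := ih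
    obtain ⟨C, x, y, hC, hxy, hang, ⟨φ⟩⟩ := h
    obtain ⟨c, hc, j, rfl, rfl, rfl, hdeg, hj⟩ := hG.exists_labels hC hxy
    rw [hG.isAngular_att_iff hc hdeg hj, not_not] at hang
    subst hang
    refine ⟨(hG.att hC.1 hxy q).iso φ, ?_, ?_⟩
    · rw [numHexagons_iso φ, hG.numHexagons_att hC.1 hxy, hnum]; ring
    · have e1 : deg G₀ (c 1) = 2 := by rw [hG.deg_eq_two_iff, hdeg]; decide
      have e2 : deg G₀ (c 4) = 2 := by rw [hG.deg_eq_two_iff, hdeg]; decide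
      rw [wienerPolarity_iso φ, hG.wienerPolarity_att_two_three hc hxy.2.1 hxy.2.2, hW, e1, e2]
      ring
  | extensionTwo G₀ G _ h ih =>
    obtain ⟨hG, hnum, hW⟩ := ih
    obtain ⟨C, x, y, hC, hxy, hang, ⟨φ⟩⟩ := h
    obtain ⟨c, hc, j, rfl, rfl, rfl, hdeg, hj⟩ := hG.exists_labels hC hxy
    rw [hG.isAngular_att_iff hc hdeg hj] at hang
    refine ⟨(hG.att hC.1 hxy q).iso φ, ?_, ?_⟩
    · rw [numHexagons_iso φ, hG.numHexagons_att hC.1 hxy, hnum]; ring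
    -- In the angular position one flanking vertex lies on the edge shared with the old neighbour
    -- and has degree three; the other has degree two.
    · have e : deg G₀ (c 1) + deg G₀ (c 4) = 5 := by
        rcases hj with rfl | rfl | rfl
        · rw [(hG.deg_eq_two_iff (c 1)).2 (by rw [hdeg]; decide),
            (hdeg 4).2 (by decide)]
        · exact absurd rfl hang
        · rw [(hG.deg_eq_two_iff (c 4)).2 (by rw [hdeg]; decide),
            (hdeg 1).2 (by decide)]
      rw [wienerPolarity_iso φ, hG.wienerPolarity_att_two_three hc hxy.2.1 hxy.2.2, hW, e]
      ring
  | extensionOne G₀ G _ h ih =>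
    obtain ⟨hG, hnum, hW⟩ := ih
    obtain ⟨C, x, y, z, t, hC, hxy, hzt, hdisj, -, ⟨φ⟩⟩ := h
    obtain ⟨c, hc, j, rfl, rfl, rfl, hdeg, hj⟩ := hG.exists_labels hC hxy
    have hG1 := hG.att hC.1 hxy q
    have hc1 := hc.attIncl q (c 2) (c 3)
    have hd1 := hG.deg_att_two_three (q := q) hc hxy.2.1 hxy.2.2
    have hsub : hc1.sub = hc.sub.map (attIncl q G₀ (c 2) (c 3)) := hc.sub_map _ attIncl_injective
    obtain ⟨⟨k, hk⟩, hz2, ht2⟩ := hzt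
    have hk23 : ¬ (k = 2 ∨ k = 3) ∧ ¬ (k + 1 = 2 ∨ k + 1 = 3) := by
      rw [Set.disjoint_left] at hdisj
      have hz := hdisj (a := z)
      have ht := hdisj (a := t)
      constructor
      · rintro (rfl | rfl) <;> rcases hk with ⟨rfl, rfl⟩ | ⟨rfl, rfl⟩ <;> simp_all
      · intro h
        have : c (k + 1) = c 2 ∨ c (k + 1) = c 3 := by
          rcases h with h | h <;> rw [h] <;> simp
        rcases hk with ⟨rfl, rfl⟩ | ⟨rfl, rfl⟩ <;> rcases this with h | h <;> simp_all
    have hk2 : deg G₀ (c k) = 2 ∧ deg G₀ (c (k + 1)) = 2 := by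
      rcases hk with ⟨rfl, rfl⟩ | ⟨rfl, rfl⟩
      · exact ⟨hz2, ht2⟩
      · exact ⟨ht2, hz2⟩
    have hk3 := hk2
    rw [hG.deg_eq_two_iff, hG.deg_eq_two_iff, hdeg, hdeg] at hk3
    -- Three disjoint edges of a hexagon alternate. In particular j = 5 is impossible: it leaves
    -- only the nonconsecutive positions 1 and 4.
    have hkj : j = 4 ∧ k = 0 ∨ j = 0 ∧ k = 4 := by
      clear * - hk23 hk3 hj
      revert j k; decide
    have hk' : attIncl q G₀ (c 2) (c 3) z = attIncl q G₀ (c 2) (c 3) (c k) ∧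
          attIncl q G₀ (c 2) (c 3) t = attIncl q G₀ (c 2) (c 3) (c (k + 1)) ∨
        attIncl q G₀ (c 2) (c 3) t = attIncl q G₀ (c 2) (c 3) (c k) ∧
          attIncl q G₀ (c 2) (c 3) z = attIncl q G₀ (c 2) (c 3) (c (k + 1)) := by
      rcases hk with ⟨rfl, rfl⟩ | ⟨rfl, rfl⟩
      · exact Or.inl ⟨rfl, rfl⟩
      · exact Or.inr ⟨rfl, rfl⟩
    have hd2 : deg (att q G₀ (c 2) (c 3)) (attIncl q G₀ (c 2) (c 3) (c k)) = 2 := by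
      rw [hG1.deg_eq_two_iff, hd1, hdeg]; clear * - hkj; revert j k; decide
    have hd3 : deg (att q G₀ (c 2) (c 3)) (attIncl q G₀ (c 2) (c 3) (c (k + 1))) = 2 := by
      rw [hG1.deg_eq_two_iff, hd1, hdeg]; clear * - hkj; revert j k; decide
    have hfree : IsFreeEdge (att q G₀ (c 2) (c 3)) hc1.sub (attIncl q G₀ (c 2) (c 3) z)
        (attIncl q G₀ (c 2) (c 3) t) := by
      rcases hk with ⟨rfl, rfl⟩ | ⟨rfl, rfl⟩
      · exact ⟨hc1.sub_adj_succ k, hd2, hd3⟩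
      · exact ⟨(hc1.sub_adj_succ k).symm, hd3, hd2⟩
    have hG2 := hG1.att hc1.isCycleOfLength_six hfree q
    refine ⟨hG2.iso φ, ?_, ?_⟩
    · rw [numHexagons_iso φ, hG1.numHexagons_att hc1.isCycleOfLength_six hfree,
        hG.numHexagons_att hC.1 hxy, hnum]
      ring
    · have e : deg G₀ (c 1) + deg G₀ (c 4) = 5 := by
        rcases hkj with ⟨rfl, rfl⟩ | ⟨rfl, rfl⟩
        · rw [(hG.deg_eq_two_iff (c 1)).2 (by rw [hdeg]; decide),
            (hdeg 4).2 (by decide)]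
        · rw [(hG.deg_eq_two_iff (c 4)).2 (by rw [hdeg]; decide),
            (hdeg 1).2 (by decide)]
      -- After the first attachment both vertices flanking the second free edge have degree three,
      -- so the second hexagon gains one more than the first.
      have e1 : deg (att q G₀ (c 2) (c 3)) (attIncl q G₀ (c 2) (c 3) (c (k - 1))) = 3 := by
        rw [hd1, hdeg]; clear * - hkj; revert j k; decide
      have e2 : deg (att q G₀ (c 2) (c 3)) (attIncl q G₀ (c 2) (c 3) (c (k + 2))) = 3 := by
        rw [hd1, hdeg]; clear * - hkj; revert j k; decide
      rw [wienerPolarity_iso φ, hG1.wienerPolarity_att hc1 (i := k) hd2 hd3 hk', e1, e2,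
        hG.wienerPolarity_att_two_three hc hxy.2.1 hxy.2.2, hW, e]
      ring

/-! ### Parts of a graph spanned by a set of hexagons -/

section Part

variable {V : Type u} {G : SimpleGraph V}

/-- The union of a set of subgraphs. -/
def unionGraph (T : Set G.Subgraph) : SimpleGraph {x : V // ∃ C ∈ T, x ∈ C.verts} where
  Adj a b := ∃ C ∈ T, C.Adj a.1 b.1
  symm := ⟨by
    rintro a b ⟨C, hC, h⟩
    exact ⟨C, hC, h.symm⟩⟩
  loopless := ⟨by
    rintro a ⟨C, hC, h⟩
    exact h.ne rfl⟩

/-- The disjoint union of a set of subgraphs, where the copies of a vertex are joined. -/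
def splitGraph (T : Set G.Subgraph) :
    SimpleGraph {p : V × G.Subgraph // p.2 ∈ T ∧ p.1 ∈ p.2.verts} where
  Adj p q := (p.1.2 = q.1.2 ∧ p.1.2.Adj p.1.1 q.1.1) ∨ (p.1.1 = q.1.1 ∧ p.1.2 ≠ q.1.2)
  symm := ⟨by
    rintro p q (⟨h1, h2⟩ | ⟨h1, h2⟩)
    · exact Or.inl ⟨h1.symm, by rw [← h1]; exact h2.symm⟩
    · exact Or.inr ⟨h1.symm, h2.symm⟩⟩
  loopless := ⟨by
    rintro p (⟨-, h⟩ | ⟨-, h⟩)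
    · exact h.ne rfl
    · exact h rfl⟩

/-- The vertices of `part q T`. -/
abbrev PartV : ∀ (_ : Bool) (_ : Set G.Subgraph), Type u
  | false, T => {x : V // ∃ C ∈ T, x ∈ C.verts}
  | true, T => {p : V × G.Subgraph // p.2 ∈ T ∧ p.1 ∈ p.2.verts}

/-- The part of `G` formed by the hexagons in `T`, with quadrilaterals inserted if `q` is true. -/
def part : ∀ (q : Bool) (T : Set G.Subgraph), SimpleGraph (PartV q T)
  | false, T => unionGraph T
  | true, T => splitGraph T

/-- The copy of the vertex `z` in the subgraph `C`. -/
def vtx : ∀ (q : Bool) {T : Set G.Subgraph} {C : G.Subgraph} (_ : C ∈ T) {z : V}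
    (_ : z ∈ C.verts), PartV q T
  | false, _, C, hC, z, hz => ⟨z, C, hC, hz⟩
  | true, _, C, hC, z, hz => ⟨(z, C), hC, hz⟩

variable {q : Bool} {T : Set G.Subgraph}

theorem vtx_cyc {c : Fin 6 → V} (hc : Cyc G c) (hC : hc.sub ∈ T) :
    Cyc (part q T) (fun i => vtx q hC (hc.apply_mem i)) := by
  cases q
  · exact ⟨fun i j h => hc.inj (congrArg Subtype.val h), fun i => ⟨_, hC, hc.sub_adj_succ i⟩⟩
  · exact ⟨fun i j h => hc.inj (congrArg (fun p => p.1.1) h),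
      fun i => Or.inl ⟨rfl, hc.sub_adj_succ i⟩⟩

theorem deg_vtx_of_unique {c : Fin 6 → V} (hc : Cyc G c) (hC : hc.sub ∈ T) (i : Fin 6)
    (h : ∀ D ∈ T, c i ∈ D.verts → D = hc.sub) :
    deg (part q T) (vtx q hC (hc.apply_mem i)) = 2 := by
  have hK := vtx_cyc (q := q) hc hC
  have hne : i + 1 ≠ i - 1 := by clear * -; revert i; decide
  refine deg_eq_two_of_forall (a := vtx q hC (hc.apply_mem (i + 1)))
    (b := vtx q hC (hc.apply_mem (i - 1))) (hK.inj.ne hne) fun w => ?_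
  have hadj : (part q T).Adj (vtx q hC (hc.apply_mem i)) (vtx q hC (hc.apply_mem (i - 1))) := by
    have := hK.adj (i - 1)
    simp only [sub_add_cancel] at this
    exact this.symm
  constructor
  · cases q
    · rintro ⟨D, hD, h1⟩
      obtain rfl := h D hD h1.fst_mem
      rcases hc.sub_adj_apply.1 h1 with h2 | h2
      · exact Or.inl (Subtype.ext h2)
      · exact Or.inr (Subtype.ext h2)
    · rintro (⟨h1, h2⟩ | ⟨h1, h2⟩)
      · rcases hc.sub_adj_apply.1 h2 with h3 | h3
        · exact Or.inl (Subtype.ext (Prod.ext h3 h1.symm))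
        · exact Or.inr (Subtype.ext (Prod.ext h3 h1.symm))
      · refine absurd (h _ w.2.1 ?_).symm h2
        have := w.2.2
        rwa [← h1] at this
  · rintro (rfl | rfl)
    · exact hK.adj i
    · exact hadj

/-- Any two graphs that consist of a single 6-cycle are isomorphic, compatibly with labellings. -/
theorem Cyc.exists_iso {W : Type v} {H : SimpleGraph W} {c : Fin 6 → V} {d : Fin 6 → W}
    (hc : Cyc G c) (hd : Cyc H d) (hcs : Function.Surjective c) (hds : Function.Surjective d)
    (h1 : ∀ z, deg G z = 2) (h2 : ∀ z, deg H z = 2) : ∃ φ : G ≃g H, ∀ i, φ (c i) = d i := by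
  have adjc : ∀ i j, G.Adj (c i) (c j) ↔ j = i + 1 ∨ j = i - 1 := fun i j =>
    ⟨fun h => hc.sub_adj_apply_apply.1 (hc.sub_adj_of_deg_eq_two (by decide) ⟨i, rfl⟩ (h1 _) h),
      fun h => (hc.sub_adj_apply_apply.2 h).adj_sub⟩
  have adjd : ∀ i j, H.Adj (d i) (d j) ↔ j = i + 1 ∨ j = i - 1 := fun i j =>
    ⟨fun h => hd.sub_adj_apply_apply.1 (hd.sub_adj_of_deg_eq_two (by decide) ⟨i, rfl⟩ (h2 _) h),
      fun h => (hd.sub_adj_apply_apply.2 h).adj_sub⟩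
  let e := Equiv.ofBijective c ⟨hc.inj, hcs⟩
  let f := Equiv.ofBijective d ⟨hd.inj, hds⟩
  refine ⟨⟨e.symm.trans f, ?_⟩, fun i => ?_⟩
  · intro a b
    obtain ⟨i, rfl⟩ := hcs a
    obtain ⟨j, rfl⟩ := hcs b
    have he : ∀ i, e.symm (c i) = i := fun i => e.symm_apply_apply i
    simp only [Equiv.trans_apply, he]
    exact (adjd i j).trans (adjc i j).symm
  · exact congrArg f (e.symm_apply_apply i)

theorem part_singleton_iso {c : Fin 6 → V} (hc : Cyc G c) :
    ∃ φ : hexagonGraph ≃g part q {hc.sub},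
      φ (.inl 0) = vtx q (Set.mem_singleton hc.sub) (hc.apply_mem 2) ∧
      φ (.inl 1) = vtx q (Set.mem_singleton hc.sub) (hc.apply_mem 3) := by
  obtain ⟨d, hd, h2, h3⟩ := hexagonGraph_isFreeEdge
  have hds : Function.Surjective d :=
    ((Fintype.bijective_iff_injective_and_card d).2 ⟨hd.inj, by decide⟩).2
  have hK := vtx_cyc (q := q) hc (Set.mem_singleton hc.sub)
  have hKs : Function.Surjective
      (fun i => vtx q (Set.mem_singleton hc.sub) (hc.apply_mem i)) := by
    cases q
    · rintro ⟨z, D, rfl, i, rfl⟩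
      exact ⟨i, rfl⟩
    · rintro ⟨⟨z, D⟩, h1, h⟩
      obtain rfl : D = hc.sub := h1
      obtain ⟨i, h2⟩ := h
      exact ⟨i, Subtype.ext (Prod.ext h2 rfl)⟩
  obtain ⟨φ, hφ⟩ := hd.exists_iso hK hds hKs hexagonGraph_deg (fun z => by
    obtain ⟨i, rfl⟩ := hKs z
    exact deg_vtx_of_unique hc _ i fun D hD _ => hD)
  refine ⟨φ, ?_, ?_⟩
  · rw [← h2]; exact hφ 2
  · rw [← h3]; exact hφ 3

end Part

namespace HexSystem

variable {V : Type u} {G : SimpleGraph V} (S : HexSystem G) {q : Bool} {T : Set G.Subgraph}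

include S

/-- Besides its two edges in `C`, the vertex has one more: without quadrilaterals, the edge of `D`
at `z` that is not shared with `C`; with quadrilaterals, the edge to the copy of `z` in `D`. No
third hexagon contains `z`. -/
theorem deg_vtx_of_exists (hT : ∀ E ∈ T, IsCycleOfLength G 6 E) {C D : G.Subgraph} (hC : C ∈ T)
    (hD : D ∈ T) (hne : D ≠ C) {z : V} (hz : z ∈ C.verts) (hzD : z ∈ D.verts) :
    deg (part q T) (vtx q hC hz) = 3 := by
  obtain ⟨a, h1, h2⟩ := S.exists_common_adj (hT C hC) (hT D hD) hne.symm hz hzD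
  have hthree : ∀ E ∈ T, z ∈ E.verts → E = C ∨ E = D := by
    intro E hE hzE
    rcases S.eq_or_eq_or_eq (hT C hC) (hT D hD) (hT E hE) hz hzD hzE with h | h | h
    · exact absurd h.symm hne
    · exact Or.inl h.symm
    · exact Or.inr h.symm
  have hnb : ∀ {E : G.Subgraph}, IsCycleOfLength G 6 E → E.Adj z a →
      ∃ b, b ≠ a ∧ ∀ w, E.Adj z w ↔ w = a ∨ w = b := by
    intro E hE h
    obtain ⟨e, he, rfl, rfl, rfl⟩ := hE.exists_cyc_of_adj h 0
    exact ⟨e (0 - 1), he.inj.ne (by decide), fun w => he.sub_adj_apply⟩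
  obtain ⟨b, hb, h3⟩ := hnb (hT C hC) h1
  obtain ⟨d, hd, h4⟩ := hnb (hT D hD) h2
  have hCb : C.Adj z b := (h3 b).2 (Or.inr rfl)
  have hDd : D.Adj z d := (h4 d).2 (Or.inr rfl)
  cases q
  · have hbd : b ≠ d := by
      rintro rfl
      rcases S.inter_subset (hT C hC) (hT D hD) hne.symm h1.ne hz hzD h1.snd_mem h2.snd_mem
        hCb.snd_mem hDd.snd_mem with h | h
      · exact hCb.ne h.symm
      · exact hb h
    refine deg_eq_three_of_forall (a := ⟨a, C, hC, h1.snd_mem⟩) (b := ⟨b, C, hC, hCb.snd_mem⟩)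
      (c := ⟨d, D, hD, hDd.snd_mem⟩) (fun h => hb (congrArg Subtype.val h).symm)
      (fun h => hd (congrArg Subtype.val h).symm) (fun h => hbd (congrArg Subtype.val h))
      fun w => ⟨?_, ?_⟩
    · rintro ⟨E, hE, h5⟩
      rcases hthree E hE h5.fst_mem with rfl | rfl
      · rcases (h3 _).1 h5 with h | h
        · exact Or.inl (Subtype.ext h)
        · exact Or.inr (Or.inl (Subtype.ext h))
      · rcases (h4 _).1 h5 with h | h
        · exact Or.inl (Subtype.ext h)
        · exact Or.inr (Or.inr (Subtype.ext h))
    · rintro (rfl | rfl | rfl)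
      · exact ⟨C, hC, h1⟩
      · exact ⟨C, hC, hCb⟩
      · exact ⟨D, hD, hDd⟩
  · refine deg_eq_three_of_forall (a := ⟨(a, C), hC, h1.snd_mem⟩)
      (b := ⟨(b, C), hC, hCb.snd_mem⟩) (c := ⟨(z, D), hD, hzD⟩)
      (fun h => hb (congrArg (fun p => p.1.1) h).symm)
      (fun h => hne (congrArg (fun p => p.1.2) h).symm)
      (fun h => hne (congrArg (fun p => p.1.2) h).symm) fun w => ⟨?_, ?_⟩
    · rintro (⟨h5, h6⟩ | ⟨h5, h6⟩)
      · rcases (h3 _).1 h6 with h | h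
        · exact Or.inl (Subtype.ext (Prod.ext h h5.symm))
        · exact Or.inr (Or.inl (Subtype.ext (Prod.ext h h5.symm)))
      · have h7 := w.2.2
        rw [← h5] at h7
        rcases hthree _ w.2.1 h7 with h | h
        · exact absurd h.symm h6
        · exact Or.inr (Or.inr (Subtype.ext (Prod.ext h5.symm h)))
    · rintro (rfl | rfl | rfl)
      · exact Or.inl ⟨rfl, h1⟩
      · exact Or.inl ⟨rfl, hCb⟩
      · exact Or.inr ⟨rfl, hne.symm⟩

omit S in
/-- Adding a hexagon that shares exactly one edge with the part formed by `T`. -/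
theorem exists_part_insert_iso {C : G.Subgraph} (hC : C ∈ T) {d : Fin 6 → V} (hd : Cyc G d)
    (hdT : hd.sub ∉ T) {x y : V} (hx : d 0 = x) (hy : d 5 = y) (hadj : C.Adj x y)
    (hinter : ∀ E ∈ T, ∀ w ∈ E.verts, w ∈ hd.sub.verts → E = C ∧ (w = x ∨ w = y)) :
    ∃ φ : att q (part q T) (vtx q hC hadj.fst_mem) (vtx q hC hadj.snd_mem) ≃g
        part q (insert hd.sub T),
      ∀ E (hE : E ∈ T) z (hz : z ∈ E.verts),
        φ 
          (attIncl q (part q T) (vtx q hC hadj.fst_mem) (vtx q hC hadj.snd_mem) (vtx q hE hz)) = vtx q (Set.mem_insert_of_mem _ hE) hz := by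
  subst hx hy
  -- `j.castSucc.succ` is position j + 1, so `d 1`, ..., `d 4` are new, while `d 0` and `d 5` are
  -- the ends of the shared edge.
  have hnew : ∀ E ∈ T, ∀ j : Fin 4, d j.castSucc.succ ∉ E.verts := by
    intro E hE j h
    rcases (hinter E hE _ h ⟨_, rfl⟩).2 with h | h
    · exact absurd (hd.inj h) (by clear * -; revert j; decide)
    · exact absurd (hd.inj h) (by clear * -; revert j; decide)
  have hindex : ∀ i : Fin 6, i = 0 ∨ i = 5 ∨ ∃ j : Fin 4, i = j.castSucc.succ := by decide
  cases q
  · let f : PartV false T ⊕ Fin 4 → PartV false (insert hd.sub T) :=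
      Sum.elim (fun p => ⟨p.1, p.2.imp fun E h => ⟨Or.inr h.1, h.2⟩⟩)
        (fun j => ⟨d j.castSucc.succ, hd.sub, Or.inl rfl, _, rfl⟩)
    have hf : Function.Bijective f := by
      constructor
      · rintro (⟨a, E, hE, ha⟩ | i) (⟨b, F, hF, hb⟩ | j) h
        · exact congrArg Sum.inl (Subtype.ext (congrArg (fun p => p.1) h))
        · obtain rfl : a = d j.castSucc.succ := congrArg Subtype.val h
          exact absurd ha (hnew E hE j)
        · obtain rfl : d i.castSucc.succ = b := congrArg Subtype.val h
          exact absurd hb (hnew F hF i)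
        · have := hd.inj (congrArg Subtype.val h)
          refine congrArg Sum.inr ?_
          clear * - this
          revert i j; decide
      · rintro ⟨z, E, rfl | hE, hz⟩
        · obtain ⟨i, rfl⟩ := hz
          rcases hindex i with rfl | rfl | ⟨j, rfl⟩
          · exact ⟨.inl ⟨d 0, C, hC, hadj.fst_mem⟩, rfl⟩
          · exact ⟨.inl ⟨d 5, C, hC, hadj.snd_mem⟩, rfl⟩
          · exact ⟨.inr j, rfl⟩
        · exact ⟨.inl ⟨z, E, hE, hz⟩, rfl⟩
    refine ⟨attachPathIso (Equiv.ofBijective f hf) ?_ ?_ ?_, fun E hE z hz => rfl⟩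
    · rintro ⟨a, E, hE, ha⟩ ⟨b, F, hF, hb⟩
      constructor
      · rintro ⟨D, rfl | hD, h⟩
        · have h1 := (hinter E hE a ha h.fst_mem).2
          have h2 := (hinter F hF b hb h.snd_mem).2
          have hne : a ≠ b := h.ne
          refine ⟨C, hC, ?_⟩
          rcases h1 with rfl | rfl <;> rcases h2 with rfl | rfl
          · exact absurd rfl hne
          · exact hadj
          · exact hadj.symm
          · exact absurd rfl hne
        · exact ⟨D, hD, h⟩
      · rintro ⟨D, hD, h⟩
        exact ⟨D, Or.inr hD, h⟩
    · rintro ⟨a, E, hE, ha⟩ j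
      rw [Subtype.ext_iff, Subtype.ext_iff]
      change (∃ D ∈ insert hd.sub T, D.Adj a (d j.castSucc.succ)) ↔
        (a = d 0 ∧ _) ∨ (a = d 5 ∧ _)
      constructor
      · rintro ⟨D, rfl | hD, h⟩
        · rcases (hinter E hE a ha h.fst_mem).2 with rfl | rfl <;>
          · rw [hd.sub_adj_apply_apply] at h
            simp only [hd.inj.eq_iff]
            clear * - h
            revert j; decide
        · exact absurd h.snd_mem (hnew D hD j)
      · intro h
        refine ⟨_, Or.inl rfl, ?_⟩
        rcases h with ⟨rfl, h⟩ | ⟨rfl, h⟩ <;>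
        · rw [hd.sub_adj_apply_apply]
          clear * - h
          revert j; decide
    · intro i j
      change (∃ D ∈ insert hd.sub T, D.Adj (d i.castSucc.succ) (d j.castSucc.succ)) ↔ _
      have : (∃ D ∈ insert hd.sub T, D.Adj (d i.castSucc.succ) (d j.castSucc.succ)) ↔
          hd.sub.Adj (d i.castSucc.succ) (d j.castSucc.succ) := by
        constructor
        · rintro ⟨D, rfl | hD, h⟩
          · exact h
          · exact absurd h.snd_mem (hnew D hD j)
        · exact fun h => ⟨_, Or.inl rfl, h⟩
      rw [this, hd.sub_adj_apply_apply]
      clear * -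
      revert i j; decide
  -- With quadrilaterals all six vertices of the new hexagon are new copies. Those of `d 0` and `d
  -- 5` are the two new corners of the quadrilateral, and the other four form the attached path.
  · let f : (PartV true T ⊕ Fin 2) ⊕ Fin 4 → PartV true (insert hd.sub T) :=
      Sum.elim (Sum.elim (fun p => ⟨p.1, Or.inr p.2.1, p.2.2⟩)
          (fun j => ⟨(d (if j = 0 then 0 else 5), hd.sub), Or.inl rfl, _, rfl⟩))
        (fun j => ⟨(d j.castSucc.succ, hd.sub), Or.inl rfl, _, rfl⟩)
    have hsep : ∀ p : PartV true T, p.1.2 ≠ hd.sub := fun p h => hdT (h ▸ p.2.1)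
    have hf : Function.Bijective f := by
      constructor
      · rintro ((p | i) | i) ((p' | j) | j) h
        · exact congrArg (Sum.inl ∘ Sum.inl) (Subtype.ext (congrArg (fun p => p.1) h))
        · exact absurd (congrArg (fun p => p.1.2) h) (hsep p)
        · exact absurd (congrArg (fun p => p.1.2) h) (hsep p)
        · exact absurd (congrArg (fun p => p.1.2) h).symm (hsep p')
        · have := hd.inj (congrArg (fun p => p.1.1) h)
          refine congrArg (Sum.inl ∘ Sum.inr) ?_
          clear * - this
          revert i j; decide
        · have := hd.inj (congrArg (fun p => p.1.1) h)
          exfalso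
          clear * - this
          revert i j; decide
        · exact absurd (congrArg (fun p => p.1.2) h).symm (hsep p')
        · have := hd.inj (congrArg (fun p => p.1.1) h)
          exfalso
          clear * - this
          revert i j; decide
        · have := hd.inj (congrArg (fun p => p.1.1) h)
          refine congrArg Sum.inr ?_
          clear * - this
          revert i j; decide
      · rintro ⟨⟨z, E⟩, hE, hz⟩
        rcases hE with hE | hE
        · obtain rfl : E = hd.sub := hE
          obtain ⟨i, hi⟩ := hz
          rcases hindex i with rfl | rfl | ⟨j, rfl⟩
          · exact ⟨.inl (.inr 0), Subtype.ext (Prod.ext hi rfl)⟩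
          · exact ⟨.inl (.inr 1), Subtype.ext (Prod.ext hi rfl)⟩
          · exact ⟨.inr j, Subtype.ext (Prod.ext hi rfl)⟩
        · exact ⟨.inl (.inl ⟨(z, E), hE, hz⟩), rfl⟩
    have hquad : ∀ (p : PartV true T) (i : Fin 6) (w : PartV true (insert hd.sub T)),
        w.1 = (d i, hd.sub) → ((part true (insert hd.sub T)).Adj (f (.inl (.inl p))) w ↔
          p = vtx true hC hadj.fst_mem ∧ i = 0 ∨ p = vtx true hC hadj.snd_mem ∧ i = 5) := by
      rintro ⟨⟨a, E⟩, hE, ha⟩ i ⟨w, hw⟩ h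
      obtain rfl : w = (d i, hd.sub) := h
      have hED : E ≠ hd.sub := fun h => hdT (h ▸ hE)
      constructor
      · rintro (⟨h1, -⟩ | ⟨h1, -⟩)
        · exact absurd h1 hED
        · obtain rfl : a = d i := h1
          obtain ⟨rfl, h2⟩ := hinter E hE _ ha ⟨i, rfl⟩
          rcases h2 with h2 | h2
          · obtain rfl := hd.inj h2
            exact Or.inl ⟨rfl, rfl⟩
          · obtain rfl := hd.inj h2
            exact Or.inr ⟨rfl, rfl⟩
      · rintro (⟨h1, rfl⟩ | ⟨h1, rfl⟩)
        · have h2 : (a, E) = (d 0, C) := congrArg Subtype.val h1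
          exact Or.inr ⟨(Prod.ext_iff.1 h2).1, hED⟩
        · have h2 : (a, E) = (d 5, C) := congrArg Subtype.val h1
          exact Or.inr ⟨(Prod.ext_iff.1 h2).1, hED⟩
    have hinner : ∀ (i j : Fin 6) (v w : PartV true (insert hd.sub T)),
        v.1 = (d i, hd.sub) → w.1 = (d j, hd.sub) →
        ((part true (insert hd.sub T)).Adj v w ↔ j = i + 1 ∨ j = i - 1) := by
      rintro i j ⟨v, hv⟩ ⟨w, hw⟩ h1 h2
      obtain rfl : v = (d i, hd.sub) := h1
      obtain rfl : w = (d j, hd.sub) := h2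
      rw [← hd.sub_adj_apply_apply]
      constructor
      · rintro (⟨-, h⟩ | ⟨-, h⟩)
        · exact h
        · exact absurd rfl h
      · exact fun h => Or.inl ⟨rfl, h⟩
    refine ⟨attachPathIso (Equiv.ofBijective f hf) ?_ ?_ ?_, fun E hE z hz => rfl⟩
    · rintro (a | i) (b | j)
      · exact Iff.rfl
      · refine (hquad a _ _ rfl).trans ?_
        rw [attachPath_inl_inr]
        clear * -
        revert j
        simp
      · rw [adj_comm, (attachPath 2 _ _ _).adj_comm]
        refine (hquad b _ _ rfl).trans ?_
        rw [attachPath_inl_inr]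
        clear * -
        revert i
        simp
      · refine (hinner _ _ _ _ rfl rfl).trans ?_
        rw [attachPath_inr_inr]
        clear * -
        revert i j; decide
    · rintro (a | i) j
      · refine (hquad a _ _ rfl).trans ?_
        have h5 : j.castSucc.succ ≠ 5 := by clear * -; revert j; decide
        simp [h5]
      · refine (hinner _ _ _ _ rfl rfl).trans ?_
        rw [Sum.inr.injEq, Sum.inr.injEq]
        clear * -
        revert i j; decide
    · intro i j
      refine (hinner _ _ _ _ rfl rfl).trans ?_
      clear * -
      revert i j; decide

theorem nonempty_part_iso_false (hT : T = {C | IsCycleOfLength G 6 C}) :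
    Nonempty (part false T ≃g G) := by
  subst hT
  refine ⟨⟨Equiv.ofBijective Subtype.val ⟨Subtype.val_injective, fun z => ?_⟩, ?_⟩⟩
  · obtain ⟨C, hC, hz⟩ := S.exists_hexagon_of_vertex z
    exact ⟨⟨z, C, hC, hz⟩, rfl⟩
  · intro a b
    constructor
    · intro h
      obtain ⟨C, hC, h⟩ := S.exists_hexagon_of_adj h
      exact ⟨C, hC, h⟩
    · rintro ⟨C, hC, h⟩
      exact h.adj_sub

omit S in
theorem nonempty_part_iso_true (hT : T = {C | IsCycleOfLength G 6 C}) :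
    Nonempty (part true T ≃g insertQuadrilaterals G) := by
  subst hT
  exact ⟨⟨Equiv.refl _, Iff.rfl⟩⟩

end HexSystem

/-- The shared edge and the two attachment edges are disjoint and cover the hexagon, so all six
vertices end with degree three. -/
theorem Nice.isBranched_att {V : Type u} {G : SimpleGraph V} {q : Bool} (hG : Nice G)
    {c : Fin 6 → V} (hc : Cyc G c) {j k : Fin 6}
    (hdeg : ∀ i, deg G (c i) = 3 ↔ i = j ∨ i = j + 1) (hjk : j = 4 ∧ k = 0 ∨ j = 0 ∧ k = 4) :
    IsBranched (Benzenoid.att q (Benzenoid.att q G (c 2) (c 3))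
        (attIncl q G (c 2) (c 3) (c k)) (attIncl q G (c 2) (c 3) (c (k + 1))))
      (hc.sub.map ((attIncl q (Benzenoid.att q G (c 2) (c 3)) (attIncl q G (c 2) (c 3) (c k))
        (attIncl q G (c 2) (c 3) (c (k + 1)))).comp (attIncl q G (c 2) (c 3)))) := by
  have h2 : deg G (c 2) = 2 := by
    rw [hG.deg_eq_two_iff, hdeg]; clear * - hjk; revert j k; decide
  have h3 : deg G (c 3) = 2 := by
    rw [hG.deg_eq_two_iff, hdeg]; clear * - hjk; revert j k; decide
  have hG1 : Nice (Benzenoid.att q G (c 2) (c 3)) :=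
    hG.att hc.isCycleOfLength_six ⟨hc.sub_adj_succ 2, h2, h3⟩ q
  have hc1 := hc.attIncl q (c 2) (c 3)
  have hd1 := hG.deg_att_two_three (q := q) hc h2 h3
  have hd2 : deg (Benzenoid.att q G (c 2) (c 3)) (attIncl q G (c 2) (c 3) (c k)) = 2 := by
    rw [hG1.deg_eq_two_iff, hd1, hdeg]; clear * - hjk; revert j k; decide
  have hd3 : deg (Benzenoid.att q G (c 2) (c 3)) (attIncl q G (c 2) (c 3) (c (k + 1))) = 2 := by
    rw [hG1.deg_eq_two_iff, hd1, hdeg]; clear * - hjk; revert j k; decide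
  have hG2 := hG1.att hc1.isCycleOfLength_six ⟨hc1.sub_adj_succ k, hd2, hd3⟩ q
  have hinj : Function.Injective ((attIncl q (Benzenoid.att q G (c 2) (c 3))
      (attIncl q G (c 2) (c 3) (c k)) (attIncl q G (c 2) (c 3) (c (k + 1)))).comp
        (attIncl q G (c 2) (c 3))) := attIncl_injective.comp attIncl_injective
  rw [← hc.sub_map _ hinj]
  refine hG2.isBranched _ fun i => ?_
  refine (hG1.deg_att_cyc hc1 hd2 hd3 (Or.inl ⟨rfl, rfl⟩) i).2 ?_
  rw [hd1, hdeg]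
  clear * - hjk
  revert i j k
  decide

/-! ### Growing the whole graph from two hexagons -/

section Stage

variable {V : Type u} {G : SimpleGraph V}

/-- Two different subgraphs with a common vertex. -/
def Touch (C D : G.Subgraph) : Prop := C ≠ D ∧ ∃ z, z ∈ C.verts ∧ z ∈ D.verts

/-- Either all hexagons touching `C` are in `T`, or exactly one of them. -/
def Saturated (T : Set G.Subgraph) (C : G.Subgraph) : Prop :=
  (∀ D, IsCycleOfLength G 6 D → Touch C D → D ∈ T) ∨
    ∃ E ∈ T, Touch C E ∧ ∀ F ∈ T, Touch C F → F = E

/-- A part of `G` that arises from two hexagons by extensions, and can be extended further. -/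
structure Stage (q : Bool) (T : Set G.Subgraph) (l a b : ℕ) : Prop where
  hexagon : ∀ E ∈ T, IsCycleOfLength G 6 E
  linked : HexSystem.Linked T
  saturated : ∀ C ∈ T, Saturated T C
  grown : Grown q l a b (part q T)
  ncard : T.ncard = 2 + l + a + 2 * b

namespace HexSystem

variable (S : HexSystem G) {q : Bool} {T : Set G.Subgraph}

theorem linked_singleton (C : G.Subgraph) : Linked {C} := by
  rintro s hs E rfl a ha F rfl b hb
  exact hs _ rfl a ha b hb

theorem Linked.insert (hL : Linked T) {C D : G.Subgraph} (hC : C ∈ T) {z : V} (h1 : z ∈ C.verts)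
    (h2 : z ∈ D.verts) : Linked (insert D T) := by
  intro s hs
  have h3 := hL s fun E hE => hs E (Or.inr hE)
  have h4 : ∀ E ∈ Insert.insert D T, ∀ a ∈ E.verts, s a = s z := by
    rintro E (rfl | hE) a ha
    · exact hs _ (Or.inl rfl) a ha z h2
    · exact h3 E hE a ha C hC z h1
  intro E hE a ha F hF b hb
  rw [h4 E hE a ha, h4 F hF b hb]

include S

theorem exists_index {c : Fin 6 → V} (hc : Cyc G c) {E : G.Subgraph} (hE : IsCycleOfLength G 6 E)
    (h : Touch hc.sub E) : ∃ j, ∀ i, c i ∈ E.verts ↔ i = j ∨ i = j + 1 := by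
  obtain ⟨hne, z, h1, h2⟩ := h
  obtain ⟨x, y, hx, hy, hxy⟩ := S.exists_inter_eq hc.isCycleOfLength_six hE hne h1 h2
  obtain ⟨j, ⟨rfl, rfl⟩ | ⟨rfl, rfl⟩⟩ := hx
  · refine ⟨j, fun i => ⟨fun h => ?_, ?_⟩⟩
    · exact (hxy _ ⟨i, rfl⟩ h).imp (fun h => hc.inj h) (fun h => hc.inj h)
    · rintro (rfl | rfl)
      exacts [hy.fst_mem, hy.snd_mem]
  · refine ⟨j, fun i => ⟨fun h => ?_, ?_⟩⟩
    · exact (hxy _ ⟨i, rfl⟩ h).symm.imp (fun h => hc.inj h) (fun h => hc.inj h)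
    · rintro (rfl | rfl)
      exacts [hy.snd_mem, hy.fst_mem]

/-- If no outside hexagon touched `T`, the vertices covered by `T` would be closed under adjacency,
as every edge lies in a hexagon. By connectedness they would be all vertices, including those of
`D`. -/
theorem exists_touch (hT : ∀ E ∈ T, IsCycleOfLength G 6 E) (hne : T.Nonempty) {D : G.Subgraph}
    (hD : IsCycleOfLength G 6 D) (hDT : D ∉ T) :
    ∃ C ∈ T, ∃ D ∉ T, IsCycleOfLength G 6 D ∧ Touch C D := by
  by_contra! hc
  have hkey : ∀ a b, G.Adj a b → (∃ C ∈ T, a ∈ C.verts) → ∃ C ∈ T, b ∈ C.verts := by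
    rintro a b hab ⟨C, hC, ha⟩
    obtain ⟨E, hE, h⟩ := S.exists_hexagon_of_adj hab
    by_cases hET : E ∈ T
    · exact ⟨E, hET, h.snd_mem⟩
    · exact absurd ⟨fun h => hET (h ▸ hC), a, ha, h.fst_mem⟩ (hc C hC E hET hE)
  obtain ⟨C, hC⟩ := hne
  obtain ⟨c, hcc, rfl⟩ := (hT C hC).exists_cyc
  obtain ⟨d, hd, rfl⟩ := hD.exists_cyc
  have h1 := const_of_adj S.connected (fun a => ∃ C ∈ T, a ∈ C.verts)
    (fun a b hab => propext ⟨hkey a b hab, hkey b a hab.symm⟩) (c 0) (d 0)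
  obtain ⟨E, hE, hz⟩ : ∃ C ∈ T, d 0 ∈ C.verts := h1 ▸ ⟨_, hC, 0, rfl⟩
  exact hc E hE _ hDT hD ⟨fun h => hDT (h ▸ hE), d 0, hz, 0, rfl⟩

/-- The new hexagon meets `T` only in the ends of `x y`, and these already lie in `C` and `D`; a
third hexagon there is excluded. So `D` touches no member of `T` but `C`. -/
theorem inter_insert (hT : ∀ E ∈ T, IsCycleOfLength G 6 E) (hL : Linked T) {C D : G.Subgraph}
    (hC : C ∈ T) (hD : IsCycleOfLength G 6 D) (hDT : D ∉ T) {x y : V} (hCxy : C.Adj x y)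
    (hDxy : D.Adj x y) {E : G.Subgraph} (hE : E ∈ T) {w : V} (h1 : w ∈ E.verts)
    (h2 : w ∈ D.verts) : E = C ∧ (w = x ∨ w = y) := by
  have h := S.inter_subset_of_linked hT hL hC hD hDT hCxy hDxy hE h1 h2
  refine ⟨?_, h⟩
  have hw : w ∈ C.verts := by
    rcases h with rfl | rfl
    exacts [hCxy.fst_mem, hCxy.snd_mem]
  rcases S.eq_or_eq_or_eq (hT E hE) (hT C hC) hD h1 hw h2 with h | rfl | rfl
  · exact h
  · exact absurd hE hDT
  · exact absurd hC hDT

/-- Since `D` touches only `C`, it has a single neighbour in the enlarged set, and no hexagon other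
than `C` gains a neighbour. Only `C` is left to be treated. -/
theorem saturated_insert (hT : ∀ E ∈ T, IsCycleOfLength G 6 E) (hL : Linked T) {C D : G.Subgraph}
    (hC : C ∈ T) (hD : IsCycleOfLength G 6 D) (hDT : D ∉ T) {x y : V} (hCxy : C.Adj x y)
    (hDxy : D.Adj x y) : Saturated (insert D T) D ∧
      ∀ F ∈ T, F ≠ C → Saturated T F → Saturated (insert D T) F := by
  have hinter := fun E hE w => S.inter_insert hT hL hC hD hDT hCxy hDxy (E := E) hE (w := w)
  constructor
  · refine Or.inr ⟨C, Or.inr hC, ⟨fun h => hDT (h ▸ hC), x, hDxy.fst_mem, hCxy.fst_mem⟩, ?_⟩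
    rintro F (rfl | hF) ⟨hne, z, h1, h2⟩
    · exact absurd rfl hne
    · exact (hinter F hF z h2 h1).1
  · rintro F hF hFC (h | ⟨E, hE, h1, h2⟩)
    · exact Or.inl fun E hE h3 => Or.inr (h E hE h3)
    · refine Or.inr ⟨E, Or.inr hE, h1, ?_⟩
      rintro H (rfl | hH) h3
      · obtain ⟨-, z, h4, h5⟩ := h3
        exact absurd (hinter F hF z h4 h5).1 hFC
      · exact h2 H hH h3

theorem exists_part_insert_iso_of_cyc (hT : ∀ E ∈ T, IsCycleOfLength G 6 E) (hL : Linked T)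
    {c : Fin 6 → V} (hc : Cyc G c) (hC : hc.sub ∈ T) {D : G.Subgraph}
    (hD : IsCycleOfLength G 6 D) (hDT : D ∉ T) (k : Fin 6) (hDk : D.Adj (c k) (c (k + 1))) :
    ∃ φ : att q (part q T) (vtx q hC (hc.apply_mem k)) (vtx q hC (hc.apply_mem (k + 1))) ≃g
        part q (insert D T),
      ∀ E (hE : E ∈ T) z (hz : z ∈ E.verts), φ (attIncl q (part q T)
          (vtx q hC (hc.apply_mem k)) (vtx q hC (hc.apply_mem (k + 1))) (vtx q hE hz)) =
        vtx q (Set.mem_insert_of_mem _ hE) hz := by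
  have hinter := fun E hE w =>
    S.inter_insert hT hL hC hD hDT (hc.sub_adj_succ k) hDk (E := E) hE (w := w)
  obtain ⟨d, hd, rfl, h5, h0⟩ := hD.exists_cyc_of_adj hDk.symm 5
  exact exists_part_insert_iso hC hd hDT h0 h5 (hc.sub_adj_succ k) hinter

theorem exists_stage (h : 2 ≤ numHexagons G) : ∃ T : Set G.Subgraph, Stage q T 0 0 0 := by
  have := S.finite
  obtain ⟨C, D₀, hC, hD₀, hne⟩ := (Set.one_lt_ncard_iff (Set.toFinite _)).1 h
  have hC : IsCycleOfLength G 6 C := hC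
  have hT : ∀ E ∈ ({C} : Set G.Subgraph), IsCycleOfLength G 6 E := by rintro E rfl; exact hC
  obtain ⟨_, rfl, D, hDT, hD, hCD⟩ := S.exists_touch hT ⟨C, rfl⟩ hD₀ (fun h => hne h.symm)
  obtain ⟨hne, z, h1, h2⟩ := id hCD
  obtain ⟨x, y, hCxy, hDxy, -⟩ := S.exists_inter_eq hC hD hne h1 h2
  obtain ⟨c, hc, rfl, rfl, rfl⟩ := hC.exists_cyc_of_adj hCxy 2
  have hL := linked_singleton hc.sub
  refine ⟨insert D {hc.sub}, ?_, hL.insert rfl h1 h2, ?_, ?_, ?_⟩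
  · rintro E (rfl | hE)
    · exact hD
    · exact hT E hE
  · rintro E (rfl | rfl)
    · exact (S.saturated_insert hT hL rfl hD hDT hCxy hDxy).1
    · refine Or.inr ⟨D, Or.inl rfl, hCD, ?_⟩
      rintro F (rfl | rfl) h
      · rfl
      · exact absurd rfl h.1
  · obtain ⟨φ, hφ2, hφ3⟩ := part_singleton_iso (q := q) hc
    obtain ⟨ψ, -⟩ := S.exists_part_insert_iso_of_cyc (q := q) hT hL hc rfl hD hDT 2 hDxy
    have χ := attCongr φ q (.inl 0) (.inl 1)
    rw [hφ2, hφ3] at χ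
    exact .base _ ⟨χ.trans ψ⟩
  · rw [Set.ncard_pair hne.symm]

/-- A hexagon with a missing neighbour has exactly one present neighbour, so it is terminal in the
part. All its missing neighbours, at most two, are added in one step, which makes it complete and
restores saturation. -/
theorem Stage.exists_larger {l a b : ℕ} (hS : Stage q T l a b) {D₀ : G.Subgraph}
    (hD₀ : IsCycleOfLength G 6 D₀) (hDT₀ : D₀ ∉ T) :
    ∃ T' l' a' b', T ⊂ T' ∧ Stage q T' l' a' b' := by
  have := S.finite
  obtain ⟨hT, hL, hsat, hgrown, hcard⟩ := hS
  have hTne : T.Nonempty := Set.nonempty_of_ncard_ne_zero (by omega)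
  obtain ⟨C, hC, D, hDT, hD, hCD⟩ := S.exists_touch hT hTne hD₀ hDT₀
  obtain ⟨E, hE, hCE, hEuniq⟩ := (hsat C hC).resolve_left fun h => hDT (h D hD hCD)
  obtain ⟨hne, z, h1, h2⟩ := id hCD
  obtain ⟨x, y, hCxy, hDxy, -⟩ := S.exists_inter_eq (hT C hC) hD hne h1 h2
  obtain ⟨c, hc, rfl, rfl, rfl⟩ := (hT C hC).exists_cyc_of_adj hCxy 2
  have hCh := hc.isCycleOfLength_six
  -- Different hexagons touching `C` share disjoint edges with it, because no vertex lies in three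
  -- hexagons.
  have htriple : ∀ {E F : G.Subgraph}, IsCycleOfLength G 6 E → IsCycleOfLength G 6 F →
      Touch hc.sub E → Touch hc.sub F → E ≠ F → ∀ i, ¬ (c i ∈ E.verts ∧ c i ∈ F.verts) := by
    rintro E F hE hF ⟨h1, -⟩ ⟨h2, -⟩ h3 i ⟨h4, h5⟩
    rcases S.eq_or_eq_or_eq hCh hE hF ⟨i, rfl⟩ h4 h5 with h | h | h
    exacts [h1 h, h2 h, h3 h]
  have hDi : ∀ {F : G.Subgraph}, IsCycleOfLength G 6 F → Touch hc.sub F → F ≠ D →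
      ∃ k, (∀ i, c i ∈ F.verts ↔ i = k ∨ i = k + 1) ∧ (k = 4 ∨ k = 5 ∨ k = 0) := by
    intro F hF hCF hFD
    obtain ⟨k, hk⟩ := S.exists_index hc hF hCF
    have h4 := htriple hF hD hCF hCD hFD 2
    have h5 := htriple hF hD hCF hCD hFD 3
    refine ⟨k, hk, ?_⟩
    have h6 : ¬ (2 = k ∨ 2 = k + 1) := fun h => h4 ⟨(hk 2).2 h, hDxy.fst_mem⟩
    have h7 : ¬ (3 = k ∨ 3 = k + 1) := fun h => h5 ⟨(hk 3).2 h, hDxy.snd_mem⟩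
    clear * - h6 h7
    revert k; decide
  have hED : E ≠ D := fun h => hDT (h ▸ hE)
  obtain ⟨j, hj, hj'⟩ := hDi (hT E hE) hCE hED
  have hK := vtx_cyc (q := q) hc hC
  have hNice := hgrown.spec.1
  have hdeg : ∀ i, deg (part q T) (vtx q hC (hc.apply_mem i)) = 3 ↔ i = j ∨ i = j + 1 := by
    intro i
    rw [← hj]
    constructor
    · intro h3
      by_contra h
      rw [deg_vtx_of_unique hc hC i] at h3
      · omega
      · intro F hF hiF
        by_contra hFC
        obtain rfl := hEuniq F hF ⟨fun h => hFC h.symm, c i, ⟨i, rfl⟩, hiF⟩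
        exact h hiF
    · intro h
      exact S.deg_vtx_of_exists hT hC hE hCE.1.symm _ h
  have hterm : IsTerminal (part q T) hK.sub := (hNice.isTerminal_iff hK).2 ⟨j, hdeg⟩
  have hfree : ∀ k, (k ≠ j ∧ k ≠ j + 1) → (k + 1 ≠ j ∧ k + 1 ≠ j + 1) → IsFreeEdge (part q T)
      hK.sub (vtx q hC (hc.apply_mem k)) (vtx q hC (hc.apply_mem (k + 1))) := by
    intro k h3 h4
    refine ⟨hK.sub_adj_succ k, ?_, ?_⟩
    · rw [hNice.deg_eq_two_iff, hdeg]; tauto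
    · rw [hNice.deg_eq_two_iff, hdeg]; tauto
  have hfree2 := hfree 2 (by clear * - hj'; revert j; decide) (by clear * - hj'; revert j; decide)
  obtain ⟨φ, hφ⟩ := S.exists_part_insert_iso_of_cyc (q := q) hT hL hc hC hD hDT 2 hDxy
  have hT1 : ∀ E ∈ insert D T, IsCycleOfLength G 6 E := by
    rintro E (rfl | hE)
    · exact hD
    · exact hT E hE
  have hL1 : Linked (insert D T) := hL.insert hC h1 h2
  obtain ⟨hsatD, hsat1⟩ := S.saturated_insert hT hL hC hD hDT hCxy hDxy
  have hcard1 : (insert D T).ncard = T.ncard + 1 := Set.ncard_insert_of_notMem hDT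
  -- A further missing neighbour calls for Extension 1. Otherwise `D` is attached alone, and the
  -- step is linear or Extension 2 according to the position of the shared edges.
  by_cases hmore : ∃ F, IsCycleOfLength G 6 F ∧ Touch hc.sub F ∧ F ∉ insert D T
  · obtain ⟨F, hF, hCF, hFT⟩ := hmore
    have hFD : F ≠ D := fun h => hFT (Or.inl h)
    have hFE : F ≠ E := fun h => hFT (Or.inr (h ▸ hE))
    obtain ⟨k, hk, hk'⟩ := hDi hF hCF hFD
    have hjk : j = 4 ∧ k = 0 ∨ j = 0 ∧ k = 4 := by
      have h4 : ∀ i, ¬ ((i = k ∨ i = k + 1) ∧ (i = j ∨ i = j + 1)) := by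
        intro i
        rw [← hk, ← hj]
        exact htriple hF (hT E hE) hCF hCE hFE i
      have h5 := h4 j
      have h6 := h4 (j + 1)
      clear * - h5 h6 hj' hk'
      revert j k; decide
    have hFk : F.Adj (c k) (c (k + 1)) :=
      (S.adj_of_mem_of_mem hCh hF hCF.1 (hc.inj.ne (by clear * -; revert k; decide)) ⟨k, rfl⟩
        ((hk k).2 (Or.inl rfl)) ⟨k + 1, rfl⟩ ((hk _).2 (Or.inr rfl))).2
    have hC1 : hc.sub ∈ insert D T := Or.inr hC
    obtain ⟨ψ, -⟩ := S.exists_part_insert_iso_of_cyc (q := q) hT1 hL1 hc hC1 hF hFT k hFk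
    obtain ⟨hsatF, hsat2⟩ := S.saturated_insert hT1 hL1 hC1 hF hFT (hc.sub_adj_succ k) hFk
    refine ⟨insert F (insert D T), l, a, b + 1,
      ⟨fun E hE => Or.inr (Or.inr hE), fun h => hDT (h (Or.inr (Or.inl rfl)))⟩, ?_, ?_, ?_, ?_, ?_⟩
    · rintro E (rfl | hE)
      · exact hF
      · exact hT1 E hE
    · exact hL1.insert hC1 ⟨k, rfl⟩ hFk.fst_mem
    · intro H hH
      by_cases hHC : H = hc.sub
      · subst hHC
        -- A hexagon does not have four pairwise disjoint edges, so no neighbour of `C` is missing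
        -- any more.
        refine Or.inl fun I hI hCI => ?_
        by_contra hIT
        have hIF : I ≠ F := fun h => hIT (Or.inl h)
        have hID : I ≠ D := fun h => hIT (Or.inr (Or.inl h))
        have hIE : I ≠ E := fun h => hIT (Or.inr (Or.inr (h ▸ hE)))
        obtain ⟨m, hm, hm'⟩ := hDi hI hCI hID
        have h4 : ∀ i, ¬ ((i = m ∨ i = m + 1) ∧ (i = j ∨ i = j + 1)) := by
          intro i
          rw [← hm, ← hj]
          exact htriple hI (hT E hE) hCI hCE hIE i
        have h5 : ∀ i, ¬ ((i = m ∨ i = m + 1) ∧ (i = k ∨ i = k + 1)) := by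
          intro i
          rw [← hm, ← hk]
          exact htriple hI hF hCI hCF hIF i
        have h6 := h4 j
        have h7 := h4 (j + 1)
        have h8 := h5 k
        clear * - h6 h7 h8 hm' hjk
        rcases hjk with ⟨rfl, rfl⟩ | ⟨rfl, rfl⟩ <;> rcases hm' with rfl | rfl | rfl <;>
          first
          | exact h6 (by decide)
          | exact h7 (by decide)
          | exact h8 (by decide)
      · rcases hH with rfl | rfl | hH
        · exact hsatF
        · exact hsat2 _ (Or.inl rfl) hHC hsatD
        · exact hsat2 _ (Or.inr hH) hHC (hsat1 _ hH hHC (hsat _ hH))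
    · have χ := attCongr φ q (attIncl q (part q T) (vtx q hC (hc.apply_mem 2))
        (vtx q hC (hc.apply_mem 3)) (vtx q hC (hc.apply_mem k))) (attIncl q (part q T)
          (vtx q hC (hc.apply_mem 2)) (vtx q hC (hc.apply_mem 3)) (vtx q hC (hc.apply_mem (k + 1))))
      have e : ∀ i, φ (attIncl q (part q T) (vtx q hC (hc.apply_mem 2))
          (vtx q hC (hc.apply_mem 3)) (vtx q hC (hc.apply_mem i))) =
          vtx q hC1 (hc.apply_mem i) := fun i => hφ _ hC _ (hc.apply_mem i)
      rw [e, e] at χ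
      refine .extensionOne _ _ hgrown ⟨hK.sub, vtx q hC (hc.apply_mem 2),
        vtx q hC (hc.apply_mem 3), vtx q hC (hc.apply_mem k), vtx q hC (hc.apply_mem (k + 1)),
        hterm, hfree2, hfree k ?_ ?_, ?_, hNice.isBranched_att hK hdeg hjk, ⟨χ.trans ψ⟩⟩
      · clear * - hjk; revert j k; decide
      · clear * - hjk; revert j k; decide
      · have h4 : ∀ i j : Fin 6, vtx q hC (hc.apply_mem i) = vtx q hC (hc.apply_mem j) → i = j :=
          fun i j h => hK.inj h
        rw [Set.disjoint_left]
        rintro _ (rfl | rfl) (h | h) <;> replace h := h4 _ _ h <;> clear * - hjk h <;>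
          revert j k <;> decide
    · rw [Set.ncard_insert_of_notMem hFT, hcard1, hcard]
      ring
  · push Not at hmore
    have hsat' : ∀ H ∈ insert D T, Saturated (insert D T) H := by
      intro H hH
      by_cases hHC : H = hc.sub
      · subst hHC
        exact Or.inl fun I hI hCI => hmore I hI hCI
      · rcases hH with rfl | hH
        · exact hsatD
        · exact hsat1 _ hH hHC (hsat _ hH)
    have hss : T ⊂ insert D T := Set.ssubset_insert hDT
    -- j = 5 means that old and new neighbour sit on opposite edges of `C`.
    by_cases hang : j = 5
    · refine ⟨insert D T, l + 1, a, b, hss, hT1, hL1, hsat', ?_, by omega⟩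
      exact .linear _ _ hgrown ⟨hK.sub, _, _, hterm, hfree2,
        fun h => (hNice.isAngular_att_iff hK hdeg hj').1 h hang, ⟨φ⟩⟩
    · refine ⟨insert D T, l, a + 1, b, hss, hT1, hL1, hsat', ?_, by omega⟩
      exact .extensionTwo _ _ hgrown ⟨hK.sub, _, _, hterm, hfree2,
        (hNice.isAngular_att_iff hK hdeg hj').2 hang, ⟨φ⟩⟩

/-- A maximal stage exists by finiteness, and by `Stage.exists_larger` it misses no hexagon. -/
theorem exists_stage_eq (h : 2 ≤ numHexagons G) (q : Bool) :
    ∃ l a b, Stage q {C : G.Subgraph | IsCycleOfLength G 6 C} l a b := by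
  have := S.finite
  obtain ⟨T₀, h₀⟩ := S.exists_stage (q := q) h
  obtain ⟨T, ⟨⟨l, a, b, hS⟩, hmax⟩⟩ := (Set.toFinite {T : Set G.Subgraph |
    ∃ l a b, Stage q T l a b}).exists_maximal ⟨T₀, 0, 0, 0, h₀⟩
  have hT : T = {C : G.Subgraph | IsCycleOfLength G 6 C} := by
    refine Set.Subset.antisymm hS.hexagon fun D hD => ?_
    by_contra hDT
    obtain ⟨T', l', a', b', hss, hS'⟩ := Stage.exists_larger S hS hD hDT
    exact hss.2 (hmax ⟨l', a', b', hS'⟩ hss.1)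
  exact ⟨l, a, b, hT ▸ hS⟩

theorem exists_grown_false (h : 2 ≤ numHexagons G) :
    ∃ l a b, numHexagons G = 2 + l + a + 2 * b ∧ Grown false l a b G := by
  obtain ⟨l, a, b, hS⟩ := S.exists_stage_eq h false
  obtain ⟨φ⟩ := S.nonempty_part_iso_false rfl
  exact ⟨l, a, b, hS.ncard, hS.grown.iso φ⟩

theorem exists_grown_true (h : 2 ≤ numHexagons G) :
    ∃ l a b, numHexagons G = 2 + l + a + 2 * b ∧ Grown true l a b (insertQuadrilaterals G) := by
  obtain ⟨l, a, b, hS⟩ := S.exists_stage_eq h true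
  obtain ⟨φ⟩ := nonempty_part_iso_true (G := G) rfl
  exact ⟨l, a, b, hS.ncard, hS.grown.iso φ⟩

end HexSystem

end Stage

/-! ### Transporting plane embeddings along isomorphisms -/

section Transport

variable {V : Type u} {W : Type v} {G : SimpleGraph V} {H : SimpleGraph W}

/-- The bijection between the darts of isomorphic graphs. -/
def dartEquiv (φ : G ≃g H) : G.Dart ≃ H.Dart where
  toFun := φ.toHom.mapDart
  invFun := φ.symm.toHom.mapDart
  left_inv d := by
    ext <;> simp
  right_inv d := by
    ext <;> simp

theorem dartEquiv_fst (φ : G ≃g H) (d : G.Dart) : (dartEquiv φ d).fst = φ d.fst := rfl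

theorem permCongr_dartRev (φ : G ≃g H) : (dartEquiv φ).permCongr (dartRev G) = dartRev H := by
  ext d : 1
  obtain ⟨d, rfl⟩ := (dartEquiv φ).surjective d
  rw [Equiv.permCongr_apply, Equiv.symm_apply_apply]
  rfl

theorem sameCycle_permCongr {α : Type u} {β : Type v} (e : α ≃ β) (f : Equiv.Perm α) (x y : α) :
    (e.permCongr f).SameCycle (e x) (e y) ↔ f.SameCycle x y := by
  have h : ∀ n : ℤ, (e.permCongr f) ^ n = e.permCongr (f ^ n) := fun n =>
    (map_zpow e.permCongrHom f n).symm
  simp only [Equiv.Perm.SameCycle, h, Equiv.permCongr_apply, Equiv.symm_apply_apply,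
    e.apply_eq_iff_eq]

theorem faceStep_permCongr (φ : G ≃g H) (rot : Equiv.Perm G.Dart) :
    (dartEquiv φ).permCongr rot * dartRev H = (dartEquiv φ).permCongr (rot * dartRev G) := by
  rw [← permCongr_dartRev φ]
  exact (map_mul (dartEquiv φ).permCongrHom rot (dartRev G)).symm

/-- The bijection between the faces of isomorphic plane graphs. -/
def rotFaceEquiv (φ : G ≃g H) (rot : Equiv.Perm G.Dart) :
    RotFace G rot ≃ RotFace H ((dartEquiv φ).permCongr rot) :=
  Quotient.congr (dartEquiv φ) fun d e => by
    show (rot * dartRev G).SameCycle d e ↔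
      ((dartEquiv φ).permCongr rot * dartRev H).SameCycle _ _
    rw [faceStep_permCongr, sameCycle_permCongr]

/-- The image of a plane graph under an isomorphism. -/
def PlaneMap.map (M : PlaneMap G) (φ : G ≃g H) : PlaneMap H where
  rot := (dartEquiv φ).permCongr M.rot
  rot_sameCycle d e := by
    obtain ⟨d, rfl⟩ := (dartEquiv φ).surjective d
    obtain ⟨e, rfl⟩ := (dartEquiv φ).surjective e
    rw [sameCycle_permCongr, M.rot_sameCycle, dartEquiv_fst, dartEquiv_fst, φ.injective.eq_iff]
  connected := φ.connected_iff.1 M.connected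
  euler := by
    rw [← Nat.card_congr φ.toEquiv, ← Nat.card_congr (rotFaceEquiv φ M.rot),
      ← Nat.card_congr φ.mapEdgeSet, M.euler]
  outer := rotFaceEquiv φ M.rot M.outer

theorem PlaneMap.faceDarts_map (M : PlaneMap G) (φ : G ≃g H) (f : RotFace G M.rot) :
    (M.map φ).faceDarts (rotFaceEquiv φ M.rot f) = dartEquiv φ '' M.faceDarts f := by
  ext d
  obtain ⟨d, rfl⟩ := (dartEquiv φ).surjective d
  rw [(dartEquiv φ).injective.mem_set_image]
  show rotFaceEquiv φ M.rot (Quotient.mk _ d) = rotFaceEquiv φ M.rot f ↔ _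
  exact (rotFaceEquiv φ M.rot).apply_eq_iff_eq

theorem IsTwoConnected.iso (h : IsTwoConnected G) (φ : G ≃g H) : IsTwoConnected H where
  three_le_card := by
    rw [← Nat.card_congr φ.toEquiv]
    exact h.three_le_card
  connected := φ.connected_iff.1 h.connected
  no_cut_vertex x := by
    let e : {y | y ≠ φ.symm x} ≃ {y | y ≠ x} := φ.toEquiv.subtypeEquiv fun a => by
      show a ≠ φ.symm x ↔ φ a ≠ x
      rw [Ne, Ne, ← φ.injective.eq_iff, φ.apply_symm_apply]
    let ψ : G.induce {y | y ≠ φ.symm x} ≃g H.induce {y | y ≠ x} := ⟨e, φ.map_adj_iff⟩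
    exact ψ.connected_iff.1 (h.no_cut_vertex (φ.symm x))

theorem IsBenzenoid.iso {M : PlaneMap G} (h : IsBenzenoid G M) (φ : G ≃g H) :
    IsBenzenoid H (M.map φ) where
  twoConnected := h.twoConnected.iso φ
  inner_hexagonal f hf := by
    obtain ⟨f, rfl⟩ := (rotFaceEquiv φ M.rot).surjective f
    obtain ⟨h1, h2⟩ := h.inner_hexagonal f fun e => hf (e ▸ rfl)
    rw [PlaneMap.faceDarts_map]
    refine ⟨by rw [Set.ncard_image_of_injective _ (dartEquiv φ).injective, h1], ?_⟩
    rintro _ ⟨d, hd, rfl⟩ _ ⟨e, he, rfl⟩ hde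
    exact congrArg _ (h2 hd he (φ.injective hde))
  hexagon_inner C hC := by
    obtain ⟨C, rfl⟩ := exists_eq_map_iso φ C
    obtain ⟨f, h1, h2⟩ := h.hexagon_inner C ((isCycle_map_iso_iff φ).1 hC)
    refine ⟨rotFaceEquiv φ M.rot f, fun e => h1 ((rotFaceEquiv φ M.rot).injective e), ?_⟩
    rw [PlaneMap.faceDarts_map, Subgraph.edgeSet_map, h2, Set.image_image, Set.image_image]
    rfl
  disjoint_or_one_edge C D hC hD hne := by
    obtain ⟨C, rfl⟩ := exists_eq_map_iso φ C
    obtain ⟨D, rfl⟩ := exists_eq_map_iso φ D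
    have hinj : Function.Injective (Sym2.map φ.toHom) := Sym2.map.injective φ.injective
    rcases h.disjoint_or_one_edge C D ((isCycle_map_iso_iff φ).1 hC)
      ((isCycle_map_iso_iff φ).1 hD) (fun e => hne (e ▸ rfl)) with h1 | ⟨e, h1, h2⟩
    · exact Or.inl ((Set.disjoint_image_iff φ.injective).2 h1)
    · refine Or.inr ⟨e.map φ.toHom, ?_, ?_⟩
      · simp only [Subgraph.edgeSet_map, hinj.mem_set_image]
        exact h1
      · simp only [Subgraph.edgeSet_map]
        rintro _ ⟨⟨e', h3, rfl⟩, h4⟩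
        rw [hinj.mem_set_image] at h4
        rw [h2 e' ⟨h3, h4⟩]
  no_three_edge C D E hC hD hE h1 h2 h3 := by
    obtain ⟨C, rfl⟩ := exists_eq_map_iso φ C
    obtain ⟨D, rfl⟩ := exists_eq_map_iso φ D
    obtain ⟨E, rfl⟩ := exists_eq_map_iso φ E
    have hinj : Function.Injective (Sym2.map φ.toHom) := Sym2.map.injective φ.injective
    simp only [Subgraph.edgeSet_map]
    rintro ⟨_, ⟨e, h4, rfl⟩, h5, h6⟩
    rw [hinj.mem_set_image] at h5 h6
    exact h.no_three_edge C D E ((isCycle_map_iso_iff φ).1 hC) ((isCycle_map_iso_iff φ).1 hD)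
      ((isCycle_map_iso_iff φ).1 hE) (fun e => h1 (e ▸ rfl)) (fun e => h2 (e ▸ rfl))
      (fun e => h3 (e ▸ rfl)) ⟨e, h4, h5, h6⟩

/-- Needed to recognise the base of the extremal families: being catacondensed is passed from one
two-hexagon graph to all isomorphic ones. -/
theorem IsCatacondensed.iso (h : IsCatacondensed G) (φ : G ≃g H) : IsCatacondensed H := by
  obtain ⟨⟨M, hM⟩, h⟩ := h
  refine ⟨⟨M.map φ, hM.iso φ⟩, ?_⟩
  rintro x ⟨C, D, E, hC, hD, hE, h1, h2, h3, h4, h5, h6⟩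
  obtain ⟨C, rfl⟩ := exists_eq_map_iso φ C
  obtain ⟨D, rfl⟩ := exists_eq_map_iso φ D
  obtain ⟨E, rfl⟩ := exists_eq_map_iso φ E
  obtain ⟨x, rfl⟩ := φ.surjective x
  have hinj : Function.Injective φ.toHom := φ.injective
  exact h x ⟨C, D, E, (isCycle_map_iso_iff φ).1 hC, (isCycle_map_iso_iff φ).1 hD,
    (isCycle_map_iso_iff φ).1 hE, fun e => h1 (e ▸ rfl), fun e => h2 (e ▸ rfl),
    fun e => h3 (e ▸ rfl), (mem_map_verts _ hinj).1 h4, (mem_map_verts _ hinj).1 h5,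
    (mem_map_verts _ hinj).1 h6⟩

end Transport

theorem Grown.nonempty_iso {q : Bool} {V : Type u} {G : SimpleGraph V} (h : Grown q 0 0 0 G) :
    Nonempty (twoHexagonGraph q ≃g G) := by
  cases h with
  | base _ h => exact h

/-! ### Uniqueness of the graphs with two hexagons -/

section Two

variable {V : Type u} {S : SimpleGraph V} (hS : IsCatacondensed S) (h2 : numHexagons S = 2)

include hS h2

theorem IsCatacondensed.grown_of_numHexagons_eq_two : Grown false 0 0 0 S := by
  obtain ⟨l, a, b, h, hg⟩ := hS.hexSystem.exists_grown_false h2.ge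
  obtain ⟨rfl, rfl, rfl⟩ : l = 0 ∧ a = 0 ∧ b = 0 := by omega
  exact hg

theorem IsCatacondensed.grown_insertQuadrilaterals :
    Grown true 0 0 0 (insertQuadrilaterals S) := by
  obtain ⟨l, a, b, h, hg⟩ := hS.hexSystem.exists_grown_true h2.ge
  obtain ⟨rfl, rfl, rfl⟩ : l = 0 ∧ a = 0 ∧ b = 0 := by omega
  exact hg

variable {W : Type v} {G : SimpleGraph W}

/-- One catacondensed graph with two hexagons suffices: it is isomorphic to `twoHexagonGraph false`,
so no plane embedding of the latter has to be constructed. -/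
theorem IsCatacondensed.of_iso_twoHexagonGraph (φ : twoHexagonGraph false ≃g G) :
    IsCatacondensed G ∧ numHexagons G = 2 := by
  obtain ⟨ψ⟩ := (hS.grown_of_numHexagons_eq_two h2).nonempty_iso
  exact ⟨hS.iso (ψ.symm.trans φ), by rw [numHexagons_iso (ψ.symm.trans φ), h2]⟩

theorem IsCatacondensed.isPhenylene_of_iso (φ : twoHexagonGraph true ≃g G) :
    IsPhenylene G ∧ numHexagons G = 2 := by
  -- The benzenoid underlying a phenylene must live in the same universe as the phenylene, which may
  -- differ from that of `S`.
  let S' : SimpleGraph (ULift.{v} (AttV false (Fin 2 ⊕ Fin 4))) :=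
    (twoHexagonGraph false).comap ULift.down
  let ψ : twoHexagonGraph false ≃g S' := ⟨Equiv.ulift.symm, Iff.rfl⟩
  obtain ⟨h3, h4⟩ := hS.of_iso_twoHexagonGraph h2 ψ
  have hg := h3.grown_insertQuadrilaterals h4
  obtain ⟨χ⟩ := hg.nonempty_iso
  refine ⟨⟨_, S', h3, h4.ge, ⟨χ.symm.trans φ⟩⟩, ?_⟩
  rw [numHexagons_iso (χ.symm.trans φ), hg.spec.2.1]

end Two

/-! ### Phenylenes as grown graphs -/

section Phenylene

variable {V : Type u} {G : SimpleGraph V}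

theorem IsPhenylene.exists_grown (hG : IsPhenylene G) : ∃ l a b, Grown true l a b G := by
  obtain ⟨W, S, hS, h2, ⟨φ⟩⟩ := hG
  obtain ⟨l, a, b, -, hg⟩ := hS.hexSystem.exists_grown_true h2
  exact ⟨l, a, b, hg.iso φ⟩

/-- Both the benzenoid and its phenylene have 2 + l + a + 2b hexagons, with the same l, a, b. -/
theorem IsPhenylene.exists_catacondensed (hG : IsPhenylene G) (h2 : numHexagons G = 2) :
    ∃ (W : Type u) (S : SimpleGraph W), IsCatacondensed S ∧ numHexagons S = 2 := by
  obtain ⟨W, S, hS, h3, ⟨φ⟩⟩ := hG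
  obtain ⟨l, a, b, h4, hg⟩ := hS.hexSystem.exists_grown_true h3
  refine ⟨W, S, hS, ?_⟩
  have h5 := numHexagons_iso φ
  have h6 := hg.spec.2.1
  omega

theorem IsPhenylene.grown_of_numHexagons_eq_two (hG : IsPhenylene G) (h2 : numHexagons G = 2) :
    Grown true 0 0 0 G := by
  obtain ⟨l, a, b, hg⟩ := hG.exists_grown
  have := hg.spec.2.1
  obtain ⟨rfl, rfl, rfl⟩ : l = 0 ∧ a = 0 ∧ b = 0 := by omega
  exact hg

end Phenylene

/-! ### Graphs built without linear steps -/

section Built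

variable {V : Type u} {G : SimpleGraph V} {k l : ℕ}

theorem BuiltB.grown (h : BuiltB k l G) : Grown false 0 l k G := by
  induction h with
  | base G h1 h2 => exact h1.grown_of_numHexagons_eq_two h2
  | extensionOne G₀ G _ h ih => exact .extensionOne G₀ G ih h
  | extensionTwo G₀ G _ h ih => exact .extensionTwo G₀ G ih h

theorem BuiltP.grown (h : BuiltP k l G) : Grown true 0 l k G := by
  induction h with
  | base G h1 h2 => exact h1.grown_of_numHexagons_eq_two h2
  | extensionOne G₀ G _ h ih => exact .extensionOne G₀ G ih h
  | extensionTwo G₀ G _ h ih => exact .extensionTwo G₀ G ih h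

theorem BuiltB.exists_catacondensed (h : BuiltB k l G) :
    ∃ (W : Type u) (S : SimpleGraph W), IsCatacondensed S ∧ numHexagons S = 2 := by
  induction h with
  | base G h1 h2 => exact ⟨_, G, h1, h2⟩
  | extensionOne _ _ _ _ ih => exact ih
  | extensionTwo _ _ _ _ ih => exact ih

theorem BuiltP.exists_catacondensed (h : BuiltP k l G) :
    ∃ (W : Type u) (S : SimpleGraph W), IsCatacondensed S ∧ numHexagons S = 2 := by
  induction h with
  | base G h1 h2 => exact h1.exists_catacondensed h2
  | extensionOne _ _ _ _ ih => exact ih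
  | extensionTwo _ _ _ _ ih => exact ih

variable {W : Type v} {S : SimpleGraph W} (hS : IsCatacondensed S) (h2 : numHexagons S = 2)

include hS h2

/-- The auxiliary graph `S` serves the base case only, where `twoHexagonGraph false` must be known
to be catacondensed. -/
theorem Grown.builtB (h : Grown false 0 l k G) : BuiltB k l G := by
  generalize hq : false = q at h
  generalize hm : 0 = m at h
  induction h with
  | base G h =>
    subst hq
    obtain ⟨h3, h4⟩ := hS.of_iso_twoHexagonGraph h2 h.some
    exact .base G h3 h4
  | linear => omega
  | extensionTwo G₀ G _ h ih => subst hq; exact .extensionTwo G₀ G (ih hm) h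
  | extensionOne G₀ G _ h ih => subst hq; exact .extensionOne G₀ G (ih hm) h

theorem Grown.builtP (h : Grown true 0 l k G) : BuiltP k l G := by
  generalize hq : true = q at h
  generalize hm : 0 = m at h
  induction h with
  | base G h =>
    subst hq
    obtain ⟨h3, h4⟩ := hS.isPhenylene_of_iso h2 h.some
    exact .base G h3 h4
  | linear => omega
  | extensionTwo G₀ G _ h ih => subst hq; exact .extensionTwo G₀ G (ih hm) h
  | extensionOne G₀ G _ h ih => subst hq; exact .extensionOne G₀ G (ih hm) h

end Built

/-! ### Membership in the families and the final comparison -/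

section Family

variable {V : Type u} {G : SimpleGraph V} {h : ℕ}

theorem exists_iff_even_or_odd (hh : 2 ≤ h) (P : ℕ → ℕ → Prop) :
    (Even h ∧ P (h / 2 - 1) 0) ∨ (Odd h ∧ P ((h - 1) / 2 - 1) 1) ↔
      ∃ k a, a ≤ 1 ∧ h = 2 + a + 2 * k ∧ P k a := by
  constructor
  · rintro (⟨⟨m, rfl⟩, hP⟩ | ⟨⟨m, rfl⟩, hP⟩)
    · exact ⟨_, _, by omega, by omega, hP⟩
    · exact ⟨_, _, by omega, by omega, hP⟩
  · rintro ⟨k, a, ha, rfl, hP⟩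
    interval_cases a
    · refine Or.inl ⟨⟨k + 1, by ring⟩, ?_⟩
      rwa [show (2 + 0 + 2 * k) / 2 - 1 = k by omega]
    · refine Or.inr ⟨⟨k + 1, by ring⟩, ?_⟩
      rwa [show (2 + 1 + 2 * k - 1) / 2 - 1 = k by omega]

theorem familyB_iff (hh : 2 ≤ h) :
    FamilyB h G ↔ ∃ k a, a ≤ 1 ∧ h = 2 + a + 2 * k ∧ BuiltB k a G :=
  exists_iff_even_or_odd hh fun k a => BuiltB k a G

theorem familyP_iff (hh : 2 ≤ h) :
    FamilyP h G ↔ ∃ k a, a ≤ 1 ∧ h = 2 + a + 2 * k ∧ BuiltP k a G :=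
  exists_iff_even_or_odd hh fun k a => BuiltP k a G

/-- Linear extensions, and more than one extension 2, make the Wiener polarity index smaller. -/
theorem Grown.wienerPolarity_le {q : Bool} {W : Type v} {G' : SimpleGraph W} {l a b a' b' : ℕ}
    (hG : Grown q l a b G) (hn : numHexagons G = h) (hG' : Grown q 0 a' b' G') (ha' : a' ≤ 1)
    (hn' : h = 2 + a' + 2 * b') : wienerPolarity G ≤ wienerPolarity G' ∧
      (wienerPolarity G = wienerPolarity G' ↔ l = 0 ∧ a = a' ∧ b = b') := by
  obtain ⟨-, h1, h2⟩ := hG.spec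
  obtain ⟨-, -, h3⟩ := hG'.spec
  rw [h2, h3]
  -- With the number of hexagons fixed, twice the index falls short of a common value by 3l + a. On
  -- the other side the shortfall is a' ≤ 1, where a' has the parity of l + a.
  cases q <;> simp only [attGain] <;> omega

end Family

end Benzenoid

theorem theorem4 (h : ℕ) (hh : 2 ≤ h) :
    (∀ {V : Type u} {V' : Type v} (G : SimpleGraph V) (G' : SimpleGraph V'),
      Benzenoid.IsCatacondensed G → Benzenoid.numHexagons G = h → Benzenoid.FamilyB h G' →
        Benzenoid.wienerPolarity G ≤ Benzenoid.wienerPolarity G' ∧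
        (Benzenoid.wienerPolarity G = Benzenoid.wienerPolarity G' ↔ Benzenoid.FamilyB h G)) ∧
    (∀ {V : Type u} {V' : Type v} (G : SimpleGraph V) (G' : SimpleGraph V'),
      Benzenoid.IsPhenylene G → Benzenoid.numHexagons G = h → Benzenoid.FamilyP h G' →
        Benzenoid.wienerPolarity G ≤ Benzenoid.wienerPolarity G' ∧
        (Benzenoid.wienerPolarity G = Benzenoid.wienerPolarity G' ↔ Benzenoid.FamilyP h G)) := by
  constructor
  · intro V V' G G' hG hn hG'
    obtain ⟨k, e, he, hk, hbuilt⟩ := (Benzenoid.familyB_iff hh).1 hG'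
    -- The construction of `G'` provides the catacondensed graph with two hexagons that is needed to
    -- place `G` in the family.
    obtain ⟨_, S, hS, hS2⟩ := hbuilt.exists_catacondensed
    obtain ⟨l, a, b, -, hgrown⟩ := hG.hexSystem.exists_grown_false (hh.trans_eq hn.symm)
    obtain ⟨hle, heq⟩ := hgrown.wienerPolarity_le hn hbuilt.grown he hk
    refine ⟨hle, fun hW => ?_, fun hfam => ?_⟩
    · obtain ⟨rfl, rfl, rfl⟩ := heq.1 hW
      exact (Benzenoid.familyB_iff hh).2 ⟨_, _, he, hk, hgrown.builtB hS hS2⟩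
    · obtain ⟨k', e', he', hk', hbuilt'⟩ := (Benzenoid.familyB_iff hh).1 hfam
      -- Two members of the family have the same counts: a is at most 1 and has the parity of h, and
      -- this determines the number of Extensions 1.
      exact (hbuilt'.grown.wienerPolarity_le hn hbuilt.grown he hk).2.2
        ⟨rfl, by omega, by omega⟩
  · intro V V' G G' hG hn hG'
    obtain ⟨k, e, he, hk, hbuilt⟩ := (Benzenoid.familyP_iff hh).1 hG'
    obtain ⟨_, S, hS, hS2⟩ := hbuilt.exists_catacondensed
    obtain ⟨l, a, b, hgrown⟩ := hG.exists_grown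
    obtain ⟨hle, heq⟩ := hgrown.wienerPolarity_le hn hbuilt.grown he hk
    refine ⟨hle, fun hW => ?_, fun hfam => ?_⟩
    · obtain ⟨rfl, rfl, rfl⟩ := heq.1 hW
      exact (Benzenoid.familyP_iff hh).2 ⟨_, _, he, hk, hgrown.builtP hS hS2⟩
    · obtain ⟨k', e', he', hk', hbuilt'⟩ := (Benzenoid.familyP_iff hh).1 hfam
      exact (hbuilt'.grown.wienerPolarity_le hn hbuilt.grown he hk).2.2
        ⟨rfl, by omega, by omega⟩
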